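/- Let $M$ be a connected smooth surface (Hausdorff, second countable). A (strictly convex, fiber-globally defined) Finsler metric on $M$ is a smooth function $F: TM\setminus 0\to\mathbb R_{>0}$ with $F(x,\lambda y)=\lambda F(x,y)$ for all $\lambda>0$ whose fundamental tensor $g_{ij}(x,y)=\tfrac12\,\partial^2F^2/\partial y^i\partial y^j$ is positive definite at all $(x,y)\in TM\setminus 0$ (one sets $F(x,0)=0$). With $E=\tfrac12F^2$, its geodesics are the solutions of $\ddot c^i+2G^i(c,\dot c)=0$, $\dot c\neq 0$, where $2G^i=g^{ij}\big(E_{x^\ell y^j}y^\ell-E_{x^j}\big)$. Such a metric $F$ is called - *Berwald*, if there is a smooth torsion-free affine connection on $M$ whose parallel transport along smooth curves preserves $F$; - *generalized Berwald*, if there is a smooth affine connection on $M$, possibly with torsion, whose parallel transport along smooth curves preserves $F$; - *Douglas*, if there is a smooth affine connection on $M$ whose geodesics coincide with those of $F$ up to orientation preserving reparametrization; - a *Randers metric* $\alpha+\beta$, if $F(x,y)=\sqrt{\alpha_x(y,y)}+\beta_x(y)$ for a smooth Riemannian metric $\alpha$ and a smooth 1-form $\beta$ on $M$. **Theorem.**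 A Finsler metric $F$ on a connected surface $M$ is both Douglas and generalized Berwald if and only if $F$ is Berwald or $F$ is a Randers metric $\alpha+\beta$ such that $\beta$ is closed and has constant length with respect to $\alpha$ (that is, $\alpha^{ij}\beta_i\beta_j$ is constant on $M$). -/

import Mathlib

open Set Bundle
open scoped Manifold ContDiff Topology

noncomputable section

namespace Finsler

/-- The model space of coordinate vectors `(y¹, …, yⁿ)`. -/
abbrev Coord (n : ℕ) : Type := EuclideanSpace ℝ (Fin n)

section Coordinates

variable {n : ℕ} {M : Type*} [TopologicalSpace M] [ChartedSpace (Coord n) M]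
  [IsManifold (𝓡 n) ∞ M]

/-- `coordVec x₀ x v` lists the components of the tangent vector `v ∈ T_xM` in the local coordinates
of `M` given by the preferred chart at `x₀` (for `x` in the domain of that chart). -/
def coordVec (x₀ x : M) (v : TangentSpace (𝓡 n) x) : Coord n :=
  (trivializationAt (Coord n) (TangentSpace (𝓡 n) (M := M)) x₀).continuousLinearMapAt ℝ x v

/-- `coordField x₀ w` is the local vector field `wⁱ ∂_{xⁱ}` with constant components `w` in the
local coordinates of `M` given by the preferred chart at `x₀`
(meaningful on the domain of that chart). -/
def coordField (x₀ : M) (w : Coord n) (x : M) : TangentSpace (𝓡 n) x :=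
  (trivializationAt (Coord n) (TangentSpace (𝓡 n) (M := M)) x₀).symmL ℝ x w

/-- `coordVec x₀ x` is the differential at `x` of the chart. -/
theorem coordVec_eq_mfderiv {x₀ x : M} (hx : x ∈ (chartAt (Coord n) x₀).source)
    (v : TangentSpace (𝓡 n) x) :
    coordVec x₀ x v = mfderiv (𝓡 n) 𝓘(ℝ, Coord n) (extChartAt (𝓡 n) x₀) x v := by
  rw [coordVec, TangentBundle.continuousLinearMapAt_trivializationAt hx]
  rfl

theorem coordVec_coordField {x₀ x : M} (hx : x ∈ (chartAt (Coord n) x₀).source)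
    (w : Coord n) : coordVec x₀ x (coordField x₀ w x) = w :=
  (trivializationAt (Coord n) (TangentSpace (𝓡 n) (M := M)) x₀).continuousLinearMapAt_symmL
    (by simpa using hx) w

theorem coordField_coordVec {x₀ x : M} (hx : x ∈ (chartAt (Coord n) x₀).source)
    (v : TangentSpace (𝓡 n) x) : coordField x₀ (coordVec x₀ x v) x = v :=
  (trivializationAt (Coord n) (TangentSpace (𝓡 n) (M := M)) x₀).symmL_continuousLinearMapAt
    (by simpa using hx) v

/-- The energy `E = ½ F²` as a function of the induced local coordinates `(x, y)` on `TM`. -/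
def energyCoord (F : ∀ x : M, TangentSpace (𝓡 n) x → ℝ) (x₀ : M) (p : Coord n × Coord n) : ℝ :=
  (1 / 2) * F ((extChartAt (𝓡 n) x₀).symm p.1)
    (coordField x₀ p.2 ((extChartAt (𝓡 n) x₀).symm p.1)) ^ 2

end Coordinates

/-- The partial derivative `∂L/∂xⁱ` of a function `L(x, y)`. -/
def partialX {n : ℕ} (i : Fin n) (L : Coord n × Coord n → ℝ) (p : Coord n × Coord n) : ℝ :=
  fderiv ℝ L p (EuclideanSpace.single i 1, 0)

/-- The partial derivative `∂L/∂yⁱ` of a function `L(x, y)`. -/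
def partialY {n : ℕ} (i : Fin n) (L : Coord n × Coord n → ℝ) (p : Coord n × Coord n) : ℝ :=
  fderiv ℝ L p (0, EuclideanSpace.single i 1)

section FinslerMetrics

variable {n : ℕ} {M : Type*} [TopologicalSpace M] [ChartedSpace (Coord n) M]
  [IsManifold (𝓡 n) ∞ M]

/-- The matrix `g_{ij}(x, y) = ½ ∂²F²/∂yⁱ∂yʲ` in local coordinates. -/
def fundamentalMatrix (F : ∀ x : M, TangentSpace (𝓡 n) x → ℝ) (x₀ : M) (p : Coord n × Coord n) :
    Matrix (Fin n) (Fin n) ℝ :=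
  Matrix.of fun i j => partialY i (partialY j (energyCoord F x₀)) p

/-- The numbers `2Gⁱ(x, y) = g^{ij} (E_{xˡyʲ} yˡ - E_{xʲ})` in local coordinates. -/
def sprayCoeff (F : ∀ x : M, TangentSpace (𝓡 n) x → ℝ) (x₀ : M) (p : Coord n × Coord n)
    (i : Fin n) : ℝ :=
  ∑ j, (fundamentalMatrix F x₀ p)⁻¹ i j *
    ((∑ l, partialX l (partialY j (energyCoord F x₀)) p * p.2 l)
      - partialX j (energyCoord F x₀) p)

variable (n M) in
/-- A strictly convex Finsler metric, defined on all of `TM ∖ 0`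
(and extended by the value `0` to the zero section). -/
structure FinslerMetric where
  /-- The function `F(x, y)`. -/
  toFun : ∀ x : M, TangentSpace (𝓡 n) x → ℝ
  map_zero : ∀ x : M, toFun x 0 = 0
  pos : ∀ (x : M) (y : TangentSpace (𝓡 n) x), y ≠ 0 → 0 < toFun x y
  homogeneous : ∀ (x : M) (y : TangentSpace (𝓡 n) x) (r : ℝ), 0 < r →
    toFun x (r • y) = r * toFun x y
  smooth : ContMDiffOn (𝓡 n).tangent 𝓘(ℝ, ℝ) ∞
    (fun p : TangentBundle (𝓡 n) M => toFun p.proj p.snd) {p | p.snd ≠ 0}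
  posDef : ∀ (x₀ : M), ∀ u ∈ (extChartAt (𝓡 n) x₀).target, ∀ y : Coord n, y ≠ 0 →
    (fundamentalMatrix toFun x₀ (u, y)).PosDef

end FinslerMetrics

section Connections

variable {n : ℕ} {M : Type*} [TopologicalSpace M] [ChartedSpace (Coord n) M]
  [IsManifold (𝓡 n) ∞ M]

variable (n M) in
/-- Affine connections on `M` (possibly with torsion). -/
abbrev AffineConnection : Type _ :=
  CovariantDerivative (𝓡 n) (Coord n) (TangentSpace (𝓡 n) (M := M))

/-- `christoffel D x₀ x u w` is the coordinate vector with components `Γⁱ_{jk}(x) uʲ wᵏ`, where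
`Γⁱ_{jk} ∂_i = ∇_{∂_j} ∂_k` in the local coordinates of the preferred chart at `x₀`. -/
def christoffel (D : AffineConnection n M) (x₀ x : M) (u w : Coord n) : Coord n :=
  coordVec x₀ x (D (coordField x₀ w) x (coordField x₀ u x))

/-- The velocity vector of a curve. -/
def velocity (c : ℝ → M) (t : ℝ) : TangentSpace (𝓡 n) (c t) :=
  mfderiv 𝓘(ℝ, ℝ) (𝓡 n) c t (1 : ℝ)

/-- The vector field `X` along the curve `c`, `t ∈ J`, is parallel: in all local coordinates
`Ẋⁱ + Γⁱ_{jk}(c) ċʲ Xᵏ = 0`. -/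
def IsParallelAlong (D : AffineConnection n M) (J : Set ℝ) (c : ℝ → M)
    (X : ∀ t : ℝ, TangentSpace (𝓡 n) (c t)) : Prop :=
  ∀ t ∈ J, ∀ x₀ : M, c t ∈ (chartAt (Coord n) x₀).source →
    HasDerivAt (fun s => coordVec x₀ (c s) (X s))
      (-christoffel D x₀ (c t) (coordVec x₀ (c t) (velocity c t)) (coordVec x₀ (c t) (X t))) t

/-- `c` is a smooth curve on the open interval `J`. -/
def IsSmoothCurve (J : Set ℝ) (c : ℝ → M) : Prop :=
  IsOpen J ∧ J.OrdConnected ∧ ContMDiffOn 𝓘(ℝ, ℝ) (𝓡 n) ∞ c J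

/-- `c` is a smooth curve with nowhere vanishing velocity on the open interval `J`. -/
def IsRegularCurve (J : Set ℝ) (c : ℝ → M) : Prop :=
  IsSmoothCurve (n := n) J c ∧ ∀ t ∈ J, velocity (n := n) c t ≠ 0

/-- The parallel transport of the connection `D` preserves `F`: along every smooth curve, `F` is
constant on every parallel vector field. -/
def PreservedBy (F : FinslerMetric n M) (D : AffineConnection n M) : Prop :=
  ∀ (J : Set ℝ) (c : ℝ → M) (X : ∀ t : ℝ, TangentSpace (𝓡 n) (c t)),
    IsSmoothCurve (n := n) J c → IsParallelAlong D J c X →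
      ∀ s ∈ J, ∀ t ∈ J, F.toFun (c s) (X s) = F.toFun (c t) (X t)

/-- (Non-constant) geodesics of an affine connection. -/
def IsConnectionGeodesic (D : AffineConnection n M) (J : Set ℝ) (c : ℝ → M) : Prop :=
  IsRegularCurve (n := n) J c ∧ IsParallelAlong D J c (velocity c)

/-- (Non-constant) geodesics of a Finsler metric: in all local coordinates
`c̈ⁱ + 2Gⁱ(c, ċ) = 0`. -/
def IsFinslerGeodesic (F : FinslerMetric n M) (J : Set ℝ) (c : ℝ → M) : Prop :=
  IsRegularCurve (n := n) J c ∧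
    ∀ t ∈ J, ∀ x₀ : M, c t ∈ (chartAt (Coord n) x₀).source → ∀ i : Fin n,
      HasDerivAt (fun s => coordVec (n := n) x₀ (c s) (velocity c s) i)
        (-sprayCoeff F.toFun x₀
          (extChartAt (𝓡 n) x₀ (c t), coordVec x₀ (c t) (velocity c t)) i) t

/-- The curve `c'` on `J'` is an orientation preserving reparametrization of the curve
`c` on `J`. -/
def IsReparametrization (J : Set ℝ) (c : ℝ → M) (J' : Set ℝ) (c' : ℝ → M) : Prop :=
  ∃ φ : ℝ → ℝ, ContDiffOn ℝ ∞ φ J' ∧ (∀ t ∈ J', 0 < deriv φ t) ∧ φ '' J' = J ∧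
    ∀ t ∈ J', c' t = c (φ t)

/-- `F` is Douglas: its geodesics coincide with the geodesics of a smooth affine connection
up to orientation preserving reparametrization. -/
def IsDouglas (F : FinslerMetric n M) : Prop :=
  ∃ D : AffineConnection n M, D.ContMDiffCovariantDerivative ∞ ∧
    (∀ J c, IsFinslerGeodesic F J c →
      ∃ J' c', IsReparametrization J c J' c' ∧ IsConnectionGeodesic D J' c') ∧
    (∀ J c, IsConnectionGeodesic D J c →
      ∃ J' c', IsReparametrization J c J' c' ∧ IsFinslerGeodesic F J' c')

/-- `F` is generalized Berwald: the parallel transport of some smooth affine connection, possibly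
with torsion, preserves `F`. -/
def IsGeneralizedBerwald (F : FinslerMetric n M) : Prop :=
  ∃ D : AffineConnection n M, D.ContMDiffCovariantDerivative ∞ ∧ PreservedBy F D

/-- `F` is Berwald: the parallel transport of some smooth torsion-free affine connection
preserves `F`. -/
def IsBerwald (F : FinslerMetric n M) : Prop :=
  ∃ D : AffineConnection n M, D.ContMDiffCovariantDerivative ∞ ∧ D.torsion = 0 ∧ PreservedBy F D

end Connections

section Randers

variable {n : ℕ} {M : Type*} [TopologicalSpace M] [ChartedSpace (Coord n) M]
  [IsManifold (𝓡 n) ∞ M]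

variable (n M) in
/-- Smooth Riemannian metrics on `M`. -/
abbrev RiemannianMetric : Type _ :=
  ContMDiffRiemannianMetric (𝓡 n) ∞ (Coord n) (TangentSpace (𝓡 n) (M := M))

variable (n M) in
/-- Smooth 1-forms on `M`. -/
structure OneForm where
  /-- The covector `β_x`. -/
  toFun : ∀ x : M, TangentSpace (𝓡 n) x →L[ℝ] ℝ
  smooth : ContMDiff (𝓡 n) ((𝓡 n).prod 𝓘(ℝ, Coord n →L[ℝ] ℝ)) ∞
    (fun x => TotalSpace.mk' (Coord n →L[ℝ] ℝ)
      (E := fun x : M => TangentSpace (𝓡 n) x →L[ℝ] ℝ) x (toFun x))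

/-- The component `β_i` in local coordinates, at the point with coordinates `u`. -/
def OneForm.component (β : OneForm n M) (x₀ : M) (i : Fin n) (u : Coord n) : ℝ :=
  β.toFun ((extChartAt (𝓡 n) x₀).symm u)
    (coordField x₀ (EuclideanSpace.single i 1) ((extChartAt (𝓡 n) x₀).symm u))

/-- `dβ = 0`: in all local coordinates `∂β_j/∂xⁱ = ∂β_i/∂xʲ`. -/
def OneForm.IsClosed (β : OneForm n M) : Prop :=
  ∀ x₀ : M, ∀ u ∈ (extChartAt (𝓡 n) x₀).target, ∀ i j : Fin n,
    fderiv ℝ (β.component x₀ j) u (EuclideanSpace.single i 1) =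
      fderiv ℝ (β.component x₀ i) u (EuclideanSpace.single j 1)

/-- The matrix `α_{ij}` of a Riemannian metric in local coordinates, at the point with
coordinates `u`. -/
def metricMatrix (α : RiemannianMetric n M) (x₀ : M) (u : Coord n) : Matrix (Fin n) (Fin n) ℝ :=
  Matrix.of fun i j => α.inner ((extChartAt (𝓡 n) x₀).symm u)
    (coordField x₀ (EuclideanSpace.single i 1) ((extChartAt (𝓡 n) x₀).symm u))
    (coordField x₀ (EuclideanSpace.single j 1) ((extChartAt (𝓡 n) x₀).symm u))

/-- The length of `β` with respect to `α` is constant: there is a constant equal to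
`α^{ij} β_i β_j` at all points and in all local coordinates. -/
def HasConstantLength (α : RiemannianMetric n M) (β : OneForm n M) : Prop :=
  ∃ k : ℝ, ∀ x₀ : M, ∀ u ∈ (extChartAt (𝓡 n) x₀).target,
    ∑ i, ∑ j, (metricMatrix α x₀ u)⁻¹ i j * β.component x₀ i u * β.component x₀ j u = k

/-- `F` is the Randers metric `F(x, y) = √(α_x(y, y)) + β_x(y)`. -/
def IsRanders (F : FinslerMetric n M) (α : RiemannianMetric n M) (β : OneForm n M) : Prop :=
  ∀ (x : M) (y : TangentSpace (𝓡 n) x), F.toFun x y = √(α.inner x y y) + β.toFun x y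

end Randers

end Finsler

end

open Set Bundle
open scoped Manifold ContDiff Topology

noncomputable section

namespace Finsler

set_option linter.unusedSectionVars false

/-! ### Vector fields and functions in the charts of the manifold. -/

section ChartCalculus

variable {n : ℕ} {M : Type*} [TopologicalSpace M] [ChartedSpace (Coord n) M]
  [IsManifold (𝓡 n) ∞ M]

/-! Suppose a connection with Christoffel symbols `Γ` preserves `F`, so that `dF (v, -Γ v y) = 0`.
The Euler-Lagrange expression of `F` along the spray `Γ y y` is then `F_y (T(y, w))`, with `T` the
torsion (`eulerLagrange_of_parallel`). If `F` is also Douglas, its spray is `B y y` up to a multiple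
of `y`, with `B` bilinear. Comparing the two sprays gives `F_yy (C y y, w) = F_y (T(y, w))` with `C
= B - Γ` (`hessian_difference_eq_torsion`).

On a surface `T(y, w) = det(y, w) τ`, and the Hessian of a 1-homogeneous function is `W det(y, ·)²`.
Where `τ ≠ 0` the identity therefore says that the derivative of `F` along `τ` is `W` times a cubic
form. On the circle this becomes `f = q W`, `f' = -sin θ W`. Periodicity of `W` forces an explicit
solution (`circle_rigidity`), and integration in the direction of `τ` gives a norm `√(quadratic) +
linear` whose linear part kills `τ` (`randers_of_hessian`, `isRandersNorm_of_torsion`).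

Either the torsion vanishes identically, and `F` is Berwald, or one point with torsion makes every
tangent norm a Randers norm, because parallel transport is a linear isometry between fibres. Then
`α` and `β` come from the even and odd parts of `F`. The form `β` has constant length because these
isometries preserve it. It is parallel, so `dβ (v, w) = β (T(v, w))`, which is zero since `β` kills
`τ`.

Conversely, a Berwald metric has the spray of its torsion-free connection. For a Randers metric with
`dβ = 0`, the Euler-Lagrange expression of `β` vanishes, so `F` and `α` have the same geodesics up
to parametrization (`isDouglas_of_isRanders`). If `β` has constant length, the Levi-Civita
connection can be corrected by a skew endomorphism-valued form that makes `β` parallel; the new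
connection preserves `α` and `β`, hence `F` (`isGeneralizedBerwald_of_randers`). -/

theorem mem_chart_target {x₀ : M} {u : Coord n} (hu : u ∈ (extChartAt (𝓡 n) x₀).target) :
    (extChartAt (𝓡 n) x₀).symm u ∈ (chartAt (Coord n) x₀).source := by
  rw [← extChartAt_source (𝓡 n)]
  exact (extChartAt (𝓡 n) x₀).map_target hu

theorem extChartAt_mem_target {x₀ x : M} (hx : x ∈ (chartAt (Coord n) x₀).source) :
    extChartAt (𝓡 n) x₀ x ∈ (extChartAt (𝓡 n) x₀).target :=
  (extChartAt (𝓡 n) x₀).map_source (by rwa [extChartAt_source])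

theorem extChartAt_symm_left {x₀ x : M} (hx : x ∈ (chartAt (Coord n) x₀).source) :
    (extChartAt (𝓡 n) x₀).symm (extChartAt (𝓡 n) x₀ x) = x :=
  (extChartAt (𝓡 n) x₀).left_inv (by rwa [extChartAt_source])

theorem extChartAt_symm_right {x₀ : M} {u : Coord n} (hu : u ∈ (extChartAt (𝓡 n) x₀).target) :
    extChartAt (𝓡 n) x₀ ((extChartAt (𝓡 n) x₀).symm u) = u :=
  (extChartAt (𝓡 n) x₀).right_inv hu

theorem isOpen_target (x₀ : M) : IsOpen (extChartAt (𝓡 n) x₀).target :=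
  isOpen_extChartAt_target x₀

theorem isOpen_source (x₀ : M) : IsOpen (chartAt (Coord n) x₀).source :=
  (chartAt (Coord n) x₀).open_source

theorem coordVec_add (x₀ x : M) (v w : TangentSpace (𝓡 n) x) :
    coordVec x₀ x (v + w) = coordVec x₀ x v + coordVec x₀ x w := map_add _ v w

theorem coordVec_smul (x₀ x : M) (a : ℝ) (v : TangentSpace (𝓡 n) x) :
    coordVec x₀ x (a • v) = a • coordVec x₀ x v := map_smul _ a v

theorem coordField_add (x₀ : M) (v w : Coord n) (x : M) :
    coordField x₀ (v + w) x = coordField x₀ v x + coordField x₀ w x := map_add _ v w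

theorem coordField_smul (x₀ : M) (a : ℝ) (v : Coord n) (x : M) :
    coordField x₀ (a • v) x = a • coordField x₀ v x := map_smul _ a v

theorem coordField_neg (x₀ : M) (v : Coord n) (x : M) :
    coordField x₀ (-v) x = - coordField x₀ v x := map_neg _ v

theorem coordField_zero (x₀ : M) (x : M) : coordField x₀ (0 : Coord n) x = 0 := map_zero _

theorem coordVec_zero (x₀ x : M) : coordVec x₀ x (0 : TangentSpace (𝓡 n) x) = 0 := map_zero _

theorem coordField_ne_zero {x₀ x : M} (hx : x ∈ (chartAt (Coord n) x₀).source) {w : Coord n}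
    (hw : w ≠ 0) : coordField x₀ w x ≠ 0 := by
  intro h
  apply hw
  rw [← coordVec_coordField hx w, h, coordVec_zero]

theorem coordVec_ne_zero {x₀ x : M} (hx : x ∈ (chartAt (Coord n) x₀).source)
    {v : TangentSpace (𝓡 n) x} (hv : v ≠ 0) : coordVec x₀ x v ≠ 0 := by
  intro h
  apply hv
  rw [← coordField_coordVec hx v, h, coordField_zero]

theorem coordVec_eq_snd {x₀ x : M} (hx : x ∈ (chartAt (Coord n) x₀).source)
    (v : TangentSpace (𝓡 n) x) :
    coordVec x₀ x v = (trivializationAt (Coord n) (TangentSpace (𝓡 n) (M := M)) x₀ ⟨x, v⟩).2 := by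
  rw [coordVec, Trivialization.continuousLinearMapAt_apply,
    Trivialization.coe_linearMapAt_of_mem _ (by simpa using hx)]

theorem eventually_source {x₀ x : M} (hx : x ∈ (chartAt (Coord n) x₀).source) :
    ∀ᶠ z in 𝓝 x, z ∈ (chartAt (Coord n) x₀).source := (isOpen_source x₀).mem_nhds hx

/-- Differentiability of a vector field at a point. -/
abbrev FieldDiffAt (σ : ∀ x : M, TangentSpace (𝓡 n) x) (x : M) : Prop :=
  MDifferentiableAt (𝓡 n) ((𝓡 n).prod 𝓘(ℝ, Coord n)) (fun z => TotalSpace.mk' (Coord n) z (σ z)) x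

/-- Smoothness of a vector field at a point. -/
abbrev FieldSmoothAt (σ : ∀ x : M, TangentSpace (𝓡 n) x) (x : M) : Prop :=
  ContMDiffAt (𝓡 n) ((𝓡 n).prod 𝓘(ℝ, Coord n)) ∞ (fun z => TotalSpace.mk' (Coord n) z (σ z)) x

theorem fieldDiffAt_iff {x₀ x : M} (hx : x ∈ (chartAt (Coord n) x₀).source)
    (σ : ∀ x : M, TangentSpace (𝓡 n) x) :
    FieldDiffAt σ x ↔
      MDifferentiableAt (𝓡 n) 𝓘(ℝ, Coord n) (fun z => coordVec x₀ z (σ z)) x := by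
  rw [FieldDiffAt, Trivialization.mdifferentiableAt_section_iff (𝓡 n)
    (trivializationAt (Coord n) (TangentSpace (𝓡 n) (M := M)) x₀) σ (by simpa using hx)]
  apply Filter.EventuallyEq.mdifferentiableAt_iff
  filter_upwards [eventually_source hx] with z hz
  exact (coordVec_eq_snd hz _).symm

theorem fieldSmoothAt_iff {x₀ x : M} (hx : x ∈ (chartAt (Coord n) x₀).source)
    (σ : ∀ x : M, TangentSpace (𝓡 n) x) :
    FieldSmoothAt σ x ↔ ContMDiffAt (𝓡 n) 𝓘(ℝ, Coord n) ∞ (fun z => coordVec x₀ z (σ z)) x := by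
  rw [FieldSmoothAt, Trivialization.contMDiffAt_section_iff
    (trivializationAt (Coord n) (TangentSpace (𝓡 n) (M := M)) x₀) (by simpa using hx)]
  apply Filter.EventuallyEq.contMDiffAt_iff
  filter_upwards [eventually_source hx] with z hz
  exact (coordVec_eq_snd hz _).symm

theorem contMDiffAt_extChartAt_symm {x₀ x : M} (hx : x ∈ (chartAt (Coord n) x₀).source) :
    ContMDiffAt 𝓘(ℝ, Coord n) (𝓡 n) ∞ (extChartAt (𝓡 n) x₀).symm (extChartAt (𝓡 n) x₀ x) :=
  (contMDiffOn_extChartAt_symm x₀ (n := ∞)).contMDiffAt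
    ((isOpen_target x₀).mem_nhds (extChartAt_mem_target hx))

theorem eventuallyEq_comp_chart {V : Type*} {x₀ x : M} (hx : x ∈ (chartAt (Coord n) x₀).source)
    (g : M → V) : g =ᶠ[𝓝 x] (g ∘ (extChartAt (𝓡 n) x₀).symm) ∘ extChartAt (𝓡 n) x₀ := by
  filter_upwards [eventually_source hx] with z hz
  rw [Function.comp_apply, Function.comp_apply, extChartAt_symm_left hz]

section

variable {V : Type*} [NormedAddCommGroup V] [NormedSpace ℝ V] {x₀ x : M}

theorem mdiffAt_iff_coord (hx : x ∈ (chartAt (Coord n) x₀).source) (g : M → V) :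
    MDifferentiableAt (𝓡 n) 𝓘(ℝ, V) g x ↔
      DifferentiableAt ℝ (g ∘ (extChartAt (𝓡 n) x₀).symm) (extChartAt (𝓡 n) x₀ x) := by
  constructor
  · intro h
    rw [← mdifferentiableAt_iff_differentiableAt]
    exact MDifferentiableAt.comp (I' := 𝓡 n) _ (by rwa [extChartAt_symm_left hx])
      ((contMDiffAt_extChartAt_symm hx).mdifferentiableAt (by simp))
  · intro h
    rw [← mdifferentiableAt_iff_differentiableAt] at h
    exact (h.comp _ (mdifferentiableAt_extChartAt hx)).congr_of_eventuallyEq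
      (eventuallyEq_comp_chart hx g)

theorem smoothAt_iff_coord (hx : x ∈ (chartAt (Coord n) x₀).source) (g : M → V) :
    ContMDiffAt (𝓡 n) 𝓘(ℝ, V) ∞ g x ↔
      ContDiffAt ℝ ∞ (g ∘ (extChartAt (𝓡 n) x₀).symm) (extChartAt (𝓡 n) x₀ x) := by
  constructor
  · intro h
    rw [← contMDiffAt_iff_contDiffAt]
    exact ContMDiffAt.comp (I' := 𝓡 n) _ (by rwa [extChartAt_symm_left hx])
      (contMDiffAt_extChartAt_symm hx)
  · intro h
    rw [← contMDiffAt_iff_contDiffAt] at h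
    exact (h.comp _ (contMDiffAt_extChartAt' hx)).congr_of_eventuallyEq
      (eventuallyEq_comp_chart hx g)

theorem mvfderiv_eq_fderiv_coord (hx : x ∈ (chartAt (Coord n) x₀).source) {g : M → V}
    (hg : MDifferentiableAt (𝓡 n) 𝓘(ℝ, V) g x) (v : TangentSpace (𝓡 n) x) :
    mvfderiv (𝓡 n) g x v = fderiv ℝ (g ∘ (extChartAt (𝓡 n) x₀).symm) (extChartAt (𝓡 n) x₀ x)
      (coordVec x₀ x v) := by
  have h := (mdiffAt_iff_coord hx g).1 hg
  rw [coordVec_eq_mfderiv hx]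
  have h2 := mfderiv_comp x (mdifferentiableAt_iff_differentiableAt.2 h)
    (mdifferentiableAt_extChartAt (I := 𝓡 n) hx)
  rw [← (eventuallyEq_comp_chart hx g).mfderiv_eq, mfderiv_eq_fderiv] at h2
  exact congrArg (fun L => L v) h2

end

theorem fieldDiffAt_coordField {x₀ x : M} (hx : x ∈ (chartAt (Coord n) x₀).source) (w : Coord n) :
    FieldDiffAt (coordField x₀ w) x := by
  rw [fieldDiffAt_iff hx]
  refine (mdifferentiableAt_const (c := w)).congr_of_eventuallyEq ?_
  filter_upwards [eventually_source hx] with z hz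
  exact coordVec_coordField hz w

theorem fieldSmoothAt_coordField {x₀ x : M} (hx : x ∈ (chartAt (Coord n) x₀).source) (w : Coord n) :
    FieldSmoothAt (coordField x₀ w) x := by
  rw [fieldSmoothAt_iff hx]
  refine (contMDiffAt_const (c := w)).congr_of_eventuallyEq ?_
  filter_upwards [eventually_source hx] with z hz
  exact coordVec_coordField hz w


end ChartCalculus

/-! ### Christoffel symbols and covariant derivatives in a chart. -/

section ConnectionCalculus

variable {n : ℕ} {M : Type*} [TopologicalSpace M] [ChartedSpace (Coord n) M]
  [IsManifold (𝓡 n) ∞ M]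

theorem sum_smul_single (w : Coord n) : ∑ i, w i • EuclideanSpace.single i (1 : ℝ) = w := by
  ext j
  simp [Pi.single_apply]

theorem fieldDiffAt_smul {f : M → ℝ} {σ : ∀ x : M, TangentSpace (𝓡 n) x} {x : M}
    (hf : MDifferentiableAt (𝓡 n) 𝓘(ℝ, ℝ) f x) (hσ : FieldDiffAt σ x) :
    FieldDiffAt (f • σ) x := by
  have hx := mem_chart_source (Coord n) x
  rw [fieldDiffAt_iff hx] at hσ ⊢
  have : (fun z => coordVec x z ((f • σ) z)) = fun z => f z • coordVec x z (σ z) := by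
    ext1 z
    exact coordVec_smul x z _ _
  rw [this]
  exact hf.smul hσ

theorem fieldDiffAt_sum {ι : Type*} (s : Finset ι) {σ : ι → ∀ x : M, TangentSpace (𝓡 n) x} {x : M}
    (hσ : ∀ i ∈ s, FieldDiffAt (σ i) x) : FieldDiffAt (∑ i ∈ s, σ i) x := by
  classical
  induction s using Finset.induction_on with
  | empty =>
    have hx := mem_chart_source (Coord n) x
    rw [fieldDiffAt_iff hx]
    have : (fun z => coordVec x z ((∑ i ∈ (∅ : Finset ι), σ i) z)) = fun _ => 0 := by
      ext1 z
      exact coordVec_zero x z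
    rw [this]
    exact mdifferentiableAt_const
  | insert a s ha ih =>
    have hx := mem_chart_source (Coord n) x
    have h1 := hσ a (Finset.mem_insert_self a s)
    have h2 := ih fun i hi => hσ i (Finset.mem_insert_of_mem hi)
    rw [Finset.sum_insert ha]
    rw [fieldDiffAt_iff hx] at h1 h2 ⊢
    have : (fun z => coordVec x z ((σ a + ∑ i ∈ s, σ i) z)) =
        fun z => coordVec x z (σ a z) + coordVec x z ((∑ i ∈ s, σ i) z) := by
      ext1 z
      exact coordVec_add x z _ _
    rw [this]
    exact h1.add h2

/-- Serves for expanding a field in a coordinate frame. The differentiability hypotheses stay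
because additivity and the Leibniz rule hold only for differentiable fields. -/
theorem cov_sum_smul (D : AffineConnection n M) {ι : Type*} (s : Finset ι) {f : ι → M → ℝ}
    {σ : ι → ∀ x : M, TangentSpace (𝓡 n) x} {x : M}
    (hf : ∀ i ∈ s, MDifferentiableAt (𝓡 n) 𝓘(ℝ, ℝ) (f i) x)
    (hσ : ∀ i ∈ s, FieldDiffAt (σ i) x) (v : TangentSpace (𝓡 n) x) :
    D (∑ i ∈ s, f i • σ i) x v =
      ∑ i ∈ s, (f i x • D (σ i) x v + mvfderiv (𝓡 n) (f i) x v • σ i x) := by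
  classical
  induction s using Finset.induction_on with
  | empty => simp
  | insert a s ha ih =>
    rw [Finset.sum_insert ha, Finset.sum_insert ha,
      D.isCovariantDerivativeOnUniv.add
        (fieldDiffAt_smul (hf a (Finset.mem_insert_self a s)) (hσ a (Finset.mem_insert_self a s)))
        (fieldDiffAt_sum s fun i hi => fieldDiffAt_smul (hf i (Finset.mem_insert_of_mem hi))
          (hσ i (Finset.mem_insert_of_mem hi))),
      D.isCovariantDerivativeOnUniv.leibniz (hσ a (Finset.mem_insert_self a s))
        (hf a (Finset.mem_insert_self a s)),
      add_apply, ih (fun i hi => hf i (Finset.mem_insert_of_mem hi))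
        (fun i hi => hσ i (Finset.mem_insert_of_mem hi))]
    rfl

theorem christoffel_add_left (D : AffineConnection n M) (x₀ x : M) (u u' w : Coord n) :
    christoffel D x₀ x (u + u') w = christoffel D x₀ x u w + christoffel D x₀ x u' w := by
  rw [christoffel, coordField_add, map_add, coordVec_add]; rfl

theorem christoffel_smul_left (D : AffineConnection n M) (x₀ x : M) (a : ℝ) (u w : Coord n) :
    christoffel D x₀ x (a • u) w = a • christoffel D x₀ x u w := by
  rw [christoffel, coordField_smul, map_smul, coordVec_smul]; rfl

theorem christoffel_add_right (D : AffineConnection n M) {x₀ x : M}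
    (hx : x ∈ (chartAt (Coord n) x₀).source) (u w w' : Coord n) :
    christoffel D x₀ x u (w + w') = christoffel D x₀ x u w + christoffel D x₀ x u w' := by
  have : coordField x₀ (w + w') = coordField x₀ w + coordField x₀ w' := by
    ext1 z; exact coordField_add x₀ w w' z
  rw [christoffel, this, D.isCovariantDerivativeOnUniv.add (fieldDiffAt_coordField hx w)
    (fieldDiffAt_coordField hx w'), add_apply, coordVec_add]; rfl

theorem christoffel_smul_right (D : AffineConnection n M) {x₀ x : M}
    (hx : x ∈ (chartAt (Coord n) x₀).source) (a : ℝ) (u w : Coord n) :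
    christoffel D x₀ x u (a • w) = a • christoffel D x₀ x u w := by
  have : coordField x₀ (a • w) = a • coordField x₀ w := by
    ext1 z; exact coordField_smul x₀ a w z
  rw [christoffel, this, D.isCovariantDerivativeOnUniv.smul_const a (fieldDiffAt_coordField hx w),
    smul_apply, coordVec_smul]; rfl

open Classical in
/-- The Christoffel symbols in a chart, as a bilinear map. -/
def christoffelL (D : AffineConnection n M) (x₀ : M) (u : Coord n) :
    Coord n →L[ℝ] Coord n →L[ℝ] Coord n :=
  -- Linearity in the second argument needs differentiable coordinate fields, which is guaranteed
  -- only on the chart domain; off the target the value 0 is a convention.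
  if h : u ∈ (extChartAt (𝓡 n) x₀).target then
    (LinearMap.mk₂ ℝ (fun v w => christoffel D x₀ ((extChartAt (𝓡 n) x₀).symm u) v w)
      (christoffel_add_left D x₀ _) (christoffel_smul_left D x₀ _)
      (christoffel_add_right D (mem_chart_target h))
      (christoffel_smul_right D (mem_chart_target h))).toContinuousBilinearMap
  else 0

theorem christoffelL_apply (D : AffineConnection n M) {x₀ : M} {u : Coord n}
    (h : u ∈ (extChartAt (𝓡 n) x₀).target) (v w : Coord n) :
    christoffelL D x₀ u v w = christoffel D x₀ ((extChartAt (𝓡 n) x₀).symm u) v w := by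
  rw [christoffelL, dif_pos h]
  rfl

theorem christoffel_eq_christoffelL (D : AffineConnection n M) {x₀ x : M}
    (hx : x ∈ (chartAt (Coord n) x₀).source) (v w : Coord n) :
    christoffel D x₀ x v w = christoffelL D x₀ (extChartAt (𝓡 n) x₀ x) v w := by
  rw [christoffelL_apply D (extChartAt_mem_target hx), extChartAt_symm_left hx]

/-- The components of a vector field in a chart. -/
def components (x₀ : M) (σ : ∀ x : M, TangentSpace (𝓡 n) x) (u : Coord n) : Coord n :=
  coordVec x₀ ((extChartAt (𝓡 n) x₀).symm u) (σ ((extChartAt (𝓡 n) x₀).symm u))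

theorem components_extChartAt {x₀ x : M} (hx : x ∈ (chartAt (Coord n) x₀).source)
    (σ : ∀ x : M, TangentSpace (𝓡 n) x) :
    components x₀ σ (extChartAt (𝓡 n) x₀ x) = coordVec x₀ x (σ x) := by
  -- The base point is generalized first, because the type of `σ x` depends on it.
  have : ∀ z, z = x → coordVec x₀ z (σ z) = coordVec x₀ x (σ x) := by
    rintro _ rfl
    rfl
  exact this _ (extChartAt_symm_left hx)

theorem differentiableAt_components {x₀ x : M} (hx : x ∈ (chartAt (Coord n) x₀).source)
    {σ : ∀ x : M, TangentSpace (𝓡 n) x} (hσ : FieldDiffAt σ x) :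
    DifferentiableAt ℝ (components x₀ σ) (extChartAt (𝓡 n) x₀ x) :=
  (mdiffAt_iff_coord hx _).1 ((fieldDiffAt_iff hx σ).1 hσ)

theorem fieldSmoothAt_iff_components {x₀ x : M} (hx : x ∈ (chartAt (Coord n) x₀).source)
    {σ : ∀ x : M, TangentSpace (𝓡 n) x} :
    FieldSmoothAt σ x ↔ ContDiffAt ℝ ∞ (components x₀ σ) (extChartAt (𝓡 n) x₀ x) :=
  (fieldSmoothAt_iff hx σ).trans (smoothAt_iff_coord hx _)

/-- The covariant derivative in local coordinates. -/
theorem coordVec_cov (D : AffineConnection n M) {x₀ x : M}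
    (hx : x ∈ (chartAt (Coord n) x₀).source) {σ : ∀ x : M, TangentSpace (𝓡 n) x}
    (hσ : FieldDiffAt σ x) (v : TangentSpace (𝓡 n) x) :
    coordVec x₀ x (D σ x v) =
      fderiv ℝ (components x₀ σ) (extChartAt (𝓡 n) x₀ x) (coordVec x₀ x v) +
        christoffel D x₀ x (coordVec x₀ x v) (coordVec x₀ x (σ x)) := by
  set f : Fin n → M → ℝ := fun i z => coordVec x₀ z (σ z) i with hf
  have h0 := (fieldDiffAt_iff hx σ).1 hσ
  have hfd : ∀ i, MDifferentiableAt (𝓡 n) 𝓘(ℝ, ℝ) (f i) x := fun i =>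
    ((EuclideanSpace.proj (𝕜 := ℝ) i).differentiableAt.mdifferentiableAt).comp x h0
  have hS : ∀ i, FieldDiffAt (coordField x₀ (EuclideanSpace.single i (1 : ℝ))) x := fun i =>
    fieldDiffAt_coordField hx _
  have heq : ∀ᶠ z in 𝓝 x, σ z =
      (∑ i, f i • coordField x₀ (EuclideanSpace.single i (1 : ℝ))) z := by
    filter_upwards [eventually_source hx] with z hz
    rw [← coordField_coordVec hz (σ z)]
    conv_lhs => rw [← sum_smul_single (coordVec x₀ z (σ z))]
    rw [Finset.sum_apply]
    exact map_sum ((trivializationAt (Coord n) (TangentSpace (𝓡 n) (M := M)) x₀).symmL ℝ z) _ _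
      |>.trans (Finset.sum_congr rfl fun i _ => coordField_smul x₀ _ _ z)
  -- A connection is local, so `σ` may be replaced by its frame expansion, valid only near `x`.
  rw [D.isCovariantDerivativeOnUniv.congr_of_eventuallyEq hσ
    (fieldDiffAt_sum _ fun i _ => fieldDiffAt_smul (hfd i) (hS i)) Filter.univ_mem heq,
    cov_sum_smul D _ (fun i _ => hfd i) (fun i _ => hS i)]
  have hmap : ∀ g : Fin n → TangentSpace (𝓡 n) x,
      coordVec x₀ x (∑ i, g i) = ∑ i, coordVec x₀ x (g i) := fun g => map_sum _ _ _
  have hdi : ∀ i, mvfderiv (𝓡 n) (f i) x v =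
      (fderiv ℝ (components x₀ σ) (extChartAt (𝓡 n) x₀ x) (coordVec x₀ x v)) i := by
    intro i
    rw [mvfderiv_eq_fderiv_coord hx (hfd i)]
    have : f i ∘ (extChartAt (𝓡 n) x₀).symm =
      (EuclideanSpace.proj (𝕜 := ℝ) i) ∘ components x₀ σ := rfl
    rw [this, ((EuclideanSpace.proj (𝕜 := ℝ) i).hasFDerivAt.comp _
      (differentiableAt_components hx hσ).hasFDerivAt).fderiv]
    rfl
  rw [hmap]
  simp only [coordVec_add, coordVec_smul, coordVec_coordField hx, Finset.sum_add_distrib, hdi,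
    sum_smul_single]
  rw [add_comm]
  congr 1
  conv_rhs => rw [christoffel_eq_christoffelL D hx, ← sum_smul_single (coordVec x₀ x (σ x)),
    map_sum]
  refine Finset.sum_congr rfl fun i _ => ?_
  rw [map_smul, ← christoffel_eq_christoffelL D hx, christoffel, coordField_coordVec hx]

/-- The transformation law of the Christoffel symbols. -/
theorem coordVec_coordField_christoffel (D : AffineConnection n M) {x₀ x₁ x : M}
    (h₀ : x ∈ (chartAt (Coord n) x₀).source) (h₁ : x ∈ (chartAt (Coord n) x₁).source)
    (u w : Coord n) :
    coordVec x₀ x (coordField x₁ (christoffel D x₁ x u w) x) =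
      fderiv ℝ (components x₀ (coordField x₁ w)) (extChartAt (𝓡 n) x₀ x)
        (coordVec x₀ x (coordField x₁ u x)) +
        christoffel D x₀ x (coordVec x₀ x (coordField x₁ u x))
          (coordVec x₀ x (coordField x₁ w x)) := by
  rw [← coordVec_cov D h₀ (fieldDiffAt_coordField h₁ w), christoffel, coordField_coordVec h₁]

end ConnectionCalculus

/-! ### Smoothness of a connection is smoothness of its Christoffel symbols. -/

section SmoothChristoffel

variable {n : ℕ} {M : Type*} [TopologicalSpace M] [ChartedSpace (Coord n) M]
  [IsManifold (𝓡 n) ∞ M]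

/-- A linear map on `Coord n` is a finite sum of coordinate projections times its values on the
basis, so smoothness may be tested on vectors. -/
theorem contDiffAt_clm_of_apply {V W : Type*} [NormedAddCommGroup V] [NormedSpace ℝ V]
    [NormedAddCommGroup W] [NormedSpace ℝ W] {f : V → Coord n →L[ℝ] W} {u : V}
    (h : ∀ w, ContDiffAt ℝ ∞ (fun z => f z w) u) : ContDiffAt ℝ ∞ f u := by
  have : f = fun z => ∑ i, (EuclideanSpace.proj (𝕜 := ℝ) i).smulRight
      (f z (EuclideanSpace.single i (1 : ℝ))) := by
    ext1 z
    refine ContinuousLinearMap.ext fun w => ?_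
    conv_lhs => rw [← sum_smul_single w, map_sum]
    rw [sum_apply]
    refine Finset.sum_congr rfl fun i _ => ?_
    rw [map_smul]
    rfl
  rw [this]
  refine ContDiffAt.sum fun i _ => ?_
  exact ((ContinuousLinearMap.smulRightL ℝ (Coord n) W
    (EuclideanSpace.proj (𝕜 := ℝ) i)).contDiff.contDiffAt).comp u (h _)

/-- Smoothness of a connection is tested on globally smooth fields; a bump function extends
coordinate fields to such fields without changing them near the point. -/
theorem exists_global_field [T2Space M] {σ : ∀ x : M, TangentSpace (𝓡 n) x} {U : Set M}
    (hU : IsOpen U) {x : M} (hx : x ∈ U) (hσ : ∀ z ∈ U, FieldSmoothAt σ z) :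
    ∃ τ : ∀ x : M, TangentSpace (𝓡 n) x, (∀ z, FieldSmoothAt τ z) ∧ ∀ᶠ z in 𝓝 x, τ z = σ z := by
  obtain ⟨f, -, hf⟩ := (SmoothBumpFunction.nhds_basis_tsupport (I := 𝓡 n) x).mem_iff.1
    (hU.mem_nhds hx)
  refine ⟨(f : M → ℝ) • σ, fun z => ?_, ?_⟩
  · exact ContMDiffOn.smul_section_of_tsupport (f.contMDiff.contMDiffOn) hU hf
      (fun y hy => (hσ y hy).contMDiffWithinAt) z
  · filter_upwards [f.eventuallyEq_one] with z hz
    rw [Pi.smul_apply', hz]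
    exact one_smul ℝ _

theorem FieldSmoothAt.fieldDiffAt {σ : ∀ x : M, TangentSpace (𝓡 n) x} {x : M}
    (h : FieldSmoothAt σ x) : FieldDiffAt σ x := h.mdifferentiableAt (by simp)

theorem contDiffAt_christoffelL [T2Space M] (D : AffineConnection n M)
    (hD : D.ContMDiffCovariantDerivative ∞) {x₀ : M} {u : Coord n}
    (hu : u ∈ (extChartAt (𝓡 n) x₀).target) : ContDiffAt ℝ ∞ (christoffelL D x₀) u := by
  refine contDiffAt_clm_of_apply fun v => contDiffAt_clm_of_apply fun w => ?_
  have hx := mem_chart_target hu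
  set x := (extChartAt (𝓡 n) x₀).symm u with hxdef
  have hux : extChartAt (𝓡 n) x₀ x = u := extChartAt_symm_right hu
  obtain ⟨τ, hτ, hτe⟩ := exists_global_field (isOpen_source x₀) hx
    (fun z hz => fieldSmoothAt_coordField hz w)
  have h1 := hD.contMDiff.contMDiff (σ := τ) (fun z _ => (hτ z).contMDiffWithinAt.of_le (by simp))
  have h2 := (h1.contMDiffAt Filter.univ_mem (x := x)).clm_bundle_apply
    (fieldSmoothAt_coordField hx v)
  have h3 : FieldSmoothAt (fun z => D τ z (coordField x₀ v z)) x := h2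
  rw [fieldSmoothAt_iff_components hx, hux] at h3
  refine h3.congr_of_eventuallyEq ?_
  have hcont : ContinuousAt (extChartAt (𝓡 n) x₀).symm u :=
    (continuousOn_extChartAt_symm x₀).continuousAt ((isOpen_target x₀).mem_nhds hu)
  -- The two fields must agree in a neighbourhood of every nearby point, not just at it, for their
  -- covariant derivatives to agree there.
  filter_upwards [(isOpen_target x₀).mem_nhds hu,
    hcont.eventually (eventually_eventually_nhds.2 hτe)] with z hz hz'
  rw [christoffelL_apply D hz, christoffel, components,
    D.isCovariantDerivativeOnUniv.congr_of_eventuallyEq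
      (fieldDiffAt_coordField (mem_chart_target hz) w) (hτ _).fieldDiffAt Filter.univ_mem]
  exact hz'.mono fun y hy => hy.symm

/-- A connection with smooth Christoffel symbols is smooth. -/
theorem smooth_of_christoffelL (D : AffineConnection n M)
    (h : ∀ (x₀ : M), ∀ u ∈ (extChartAt (𝓡 n) x₀).target, ContDiffAt ℝ ∞ (christoffelL D x₀) u) :
    D.ContMDiffCovariantDerivative ∞ := by
  refine ⟨⟨fun {σ} hσ x _ => ContMDiffAt.contMDiffWithinAt ?_⟩⟩
  have hσ' : ∀ z, FieldSmoothAt σ z := fun z =>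
    (hσ.contMDiffAt (Filter.univ_mem (f := 𝓝 z))).of_le (by simp)
  have hx := mem_chart_source (Coord n) x
  have hu := extChartAt_mem_target hx
  rw [contMDiffAt_hom_bundle]
  refine ⟨contMDiffAt_id, ?_⟩
  rw [smoothAt_iff_coord hx]
  refine contDiffAt_clm_of_apply fun w => ?_
  have hc : ContDiffAt ℝ ∞ (components x σ) (extChartAt (𝓡 n) x x) :=
    (fieldSmoothAt_iff_components hx).1 (hσ' x)
  have hd : ContDiffAt ℝ ∞ (fun u => fderiv ℝ (components x σ) u w +
      christoffelL D x u w (components x σ u)) (extChartAt (𝓡 n) x x) :=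
    ((hc.fderiv_right (m := ∞) (by simp)).clm_apply contDiffAt_const).add
      (((h x _ hu).clm_apply contDiffAt_const).clm_apply hc)
  refine hd.congr_of_eventuallyEq ?_
  filter_upwards [(isOpen_target x).mem_nhds hu] with z hz
  have hzx := mem_chart_target hz
  have := coordVec_cov D hzx (hσ' _).fieldDiffAt
    (coordField x w ((extChartAt (𝓡 n) x).symm z))
  rw [coordVec_coordField hzx, extChartAt_symm_right hz, ← christoffelL_apply D hz] at this
  exact this

end SmoothChristoffel

/-! ### Velocities of curves and chart independence of parallel transport. -/

section Curves

variable {n : ℕ} {M : Type*} [TopologicalSpace M] [ChartedSpace (Coord n) M]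
  [IsManifold (𝓡 n) ∞ M]

theorem IsSmoothCurve.smoothAt {J : Set ℝ} {c : ℝ → M} (hc : IsSmoothCurve (n := n) J c) {t : ℝ}
    (ht : t ∈ J) : ContMDiffAt 𝓘(ℝ, ℝ) (𝓡 n) ∞ c t :=
  hc.2.2.contMDiffAt (hc.1.mem_nhds ht)

theorem hasDerivAt_chart_comp {c : ℝ → M} {t : ℝ} (hc : ContMDiffAt 𝓘(ℝ, ℝ) (𝓡 n) ∞ c t) {x₀ : M}
    (hx : c t ∈ (chartAt (Coord n) x₀).source) :
    HasDerivAt (fun s => extChartAt (𝓡 n) x₀ (c s)) (coordVec x₀ (c t) (velocity c t)) t := by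
  have h1 : MDifferentiableAt 𝓘(ℝ, ℝ) (𝓡 n) c t := hc.mdifferentiableAt (by simp)
  have h2 := (mdifferentiableAt_extChartAt (I := 𝓡 n) hx).hasMFDerivAt.comp t h1.hasMFDerivAt
  have h3 : ∀ L : ℝ →L[ℝ] Coord n, HasFDerivAt (fun s => extChartAt (𝓡 n) x₀ (c s)) L t →
      HasDerivAt (fun s => extChartAt (𝓡 n) x₀ (c s)) (L 1) t := fun L h => h.hasDerivAt
  rw [coordVec_eq_mfderiv hx]
  exact h3 _ (hasMFDerivAt_iff_hasFDerivAt.1 h2)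

theorem eventually_mem_source {c : ℝ → M} {t : ℝ} (hc : ContMDiffAt 𝓘(ℝ, ℝ) (𝓡 n) ∞ c t) {x₀ : M}
    (hx : c t ∈ (chartAt (Coord n) x₀).source) :
    ∀ᶠ s in 𝓝 t, c s ∈ (chartAt (Coord n) x₀).source :=
  hc.continuousAt.eventually (eventually_source hx)

/-- The equation of parallel transport does not depend on the chart. -/
theorem parallel_equation_change (D : AffineConnection n M) {c : ℝ → M} {t : ℝ}
    (hc : ContMDiffAt 𝓘(ℝ, ℝ) (𝓡 n) ∞ c t) {X : ∀ t : ℝ, TangentSpace (𝓡 n) (c t)} {x₀ x₁ : M}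
    (h₀ : c t ∈ (chartAt (Coord n) x₀).source) (h₁ : c t ∈ (chartAt (Coord n) x₁).source)
    (hX : HasDerivAt (fun s => coordVec x₁ (c s) (X s))
      (-christoffel D x₁ (c t) (coordVec x₁ (c t) (velocity c t)) (coordVec x₁ (c t) (X t))) t) :
    HasDerivAt (fun s => coordVec x₀ (c s) (X s))
      (-christoffel D x₀ (c t) (coordVec x₀ (c t) (velocity c t)) (coordVec x₀ (c t) (X t))) t := by
  set e : Fin n → Coord n := fun i => EuclideanSpace.single i (1 : ℝ) with he
  set A : Coord n →L[ℝ] Coord n :=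
    ((trivializationAt (Coord n) (TangentSpace (𝓡 n) (M := M)) x₀).continuousLinearMapAt ℝ (c t)).comp
      ((trivializationAt (Coord n) (TangentSpace (𝓡 n) (M := M)) x₁).symmL ℝ (c t)) with hA
  have hAapp : ∀ w, coordVec x₀ (c t) (coordField x₁ w (c t)) = A w := fun w => rfl
  have hvec : ∀ v, coordVec x₀ (c t) v = A (coordVec x₁ (c t) v) := fun v => by
    rw [← hAapp, coordField_coordVec h₁]
  have hexp : (fun s => coordVec x₀ (c s) (X s)) =ᶠ[𝓝 t] fun s => ∑ i,
      (coordVec x₁ (c s) (X s)) i • components x₀ (coordField x₁ (e i))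
        (extChartAt (𝓡 n) x₀ (c s)) := by
    filter_upwards [eventually_mem_source hc h₀, eventually_mem_source hc h₁] with s hs₀ hs₁
    simp only [components_extChartAt hs₀]
    conv_lhs => rw [← coordField_coordVec hs₁ (X s), ← sum_smul_single (coordVec x₁ (c s) (X s))]
    refine (map_sum (((trivializationAt (Coord n) (TangentSpace (𝓡 n) (M := M))
      x₀).continuousLinearMapAt ℝ (c s)).comp ((trivializationAt (Coord n)
      (TangentSpace (𝓡 n) (M := M)) x₁).symmL ℝ (c s))) _ _).trans
      (Finset.sum_congr rfl fun i _ => map_smul _ _ _)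
  -- By the transformation law, the second derivatives of the change of charts are the difference of
  -- the two Christoffel terms. Expanding `X` in the frame of `x₁`, the term in `christoffel D x₁`
  -- cancels against the equation for `X`.
  have hcomp : ∀ i, HasDerivAt (fun s => components x₀ (coordField x₁ (e i))
      (extChartAt (𝓡 n) x₀ (c s))) (A (christoffel D x₁ (c t) (coordVec x₁ (c t) (velocity c t)) (e i))
        - christoffel D x₀ (c t) (coordVec x₀ (c t) (velocity c t)) (A (e i))) t := by
    intro i
    have h := (differentiableAt_components h₀ (fieldDiffAt_coordField h₁ (e i))).hasFDerivAt
    have h' := h.comp_hasDerivAt t (hasDerivAt_chart_comp hc h₀)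
    refine h'.congr_deriv ?_
    have := coordVec_coordField_christoffel D h₀ h₁ (coordVec x₁ (c t) (velocity c t)) (e i)
    rw [coordField_coordVec h₁, hAapp, hAapp] at this
    rw [eq_comm, sub_eq_iff_eq_add]
    exact this
  have hXi : ∀ i, HasDerivAt (fun s => (coordVec x₁ (c s) (X s)) i)
      ((-christoffel D x₁ (c t) (coordVec x₁ (c t) (velocity c t)) (coordVec x₁ (c t) (X t))) i) t :=
    fun i => (EuclideanSpace.proj (𝕜 := ℝ) i).hasFDerivAt.comp_hasDerivAt t hX
  have hsum := HasDerivAt.fun_sum (u := Finset.univ) fun i _ => (hXi i).smul (hcomp i)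
  refine (hsum.congr_of_eventuallyEq hexp).congr_deriv ?_
  simp only [components_extChartAt h₀, hAapp]
  rw [hvec (X t)]
  set X1 := coordVec x₁ (c t) (X t)
  simp only [christoffel_eq_christoffelL D h₁, christoffel_eq_christoffelL D h₀]
  set G1 := christoffelL D x₁ (extChartAt (𝓡 n) x₁ (c t)) (coordVec x₁ (c t) (velocity c t))
  set G0 := christoffelL D x₀ (extChartAt (𝓡 n) x₀ (c t)) (coordVec x₀ (c t) (velocity c t))
  have key : ∀ (L : Coord n →L[ℝ] Coord n) (w : Coord n), ∑ i, w i • L (e i) = L w := by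
    intro L w
    conv_rhs => rw [← sum_smul_single w, map_sum]
    exact Finset.sum_congr rfl fun i _ => (map_smul _ _ _).symm
  have h1 := key A (-G1 X1)
  have h2 := key (A.comp G1 - G0.comp A) X1
  simp only [sub_apply, ContinuousLinearMap.comp_apply] at h2
  rw [Finset.sum_add_distrib, h1, h2, map_neg]
  abel

end Curves

/-! ### Linear differential equations on a fixed interval. -/

section LinearODE

theorem eventually_norm_lt {X E : Type*} [TopologicalSpace X] [NormedAddCommGroup E] {f : X → E}
    {u : X} (h : ContinuousAt f u) : ∀ᶠ z in 𝓝 u, ‖f z‖ < ‖f u‖ + 1 :=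
  h.norm.eventually_lt continuousAt_const (lt_add_one _)

/-- The bound 1/8 lets one application of Picard-Lindelöf cover all of `[-1, 2]`, which has `[0, 1]`
in its interior. In the ball of radius `‖w‖ + 1` about `w` the speed is at most `(2‖w‖ + 1)/8`, and
the time elapsed is at most 3, so the solution stays in the ball. -/
theorem exists_linear_ode {V : Type*} [NormedAddCommGroup V] [NormedSpace ℝ V] [CompleteSpace V]
    {A : ℝ → V →L[ℝ] V} (hA : ContinuousOn A (Icc (-1) 2))
    (hb : ∀ t ∈ Icc (-1 : ℝ) 2, ‖A t‖ ≤ 1 / 8) {t₀ : ℝ} (ht₀ : t₀ ∈ Icc (-1 : ℝ) 2) (w : V) :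
    ∃ X : ℝ → V, X t₀ = w ∧ ∀ t ∈ Ioo (-1 : ℝ) 2, HasDerivAt X (A t (X t)) t := by
  have hpl : IsPicardLindelof (fun t x => A t x) (⟨t₀, ht₀⟩ : Icc (-1 : ℝ) 2) w (‖w‖₊ + 1) 0
      ((1 / 8) * (2 * ‖w‖₊ + 1)) (1 / 8) := by
    refine ⟨fun t ht => ?_, fun x _ => hA.clm_apply continuousOn_const, fun t ht x hx => ?_, ?_⟩
    · refine ((A t).lipschitz.weaken ?_).lipschitzOnWith
      rw [← NNReal.coe_le_coe]
      simpa using hb t ht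
    · have h1 : ‖x‖ ≤ 2 * ‖w‖ + 1 := by
        rw [mem_closedBall_iff_norm] at hx
        have := norm_le_norm_add_norm_sub' x w
        push_cast [coe_nnnorm] at hx
        linarith
      calc ‖A t x‖ ≤ ‖A t‖ * ‖x‖ := (A t).le_opNorm x
        _ ≤ (1 / 8) * (2 * ‖w‖ + 1) := mul_le_mul (hb t ht) h1 (norm_nonneg _) (by norm_num)
        _ = _ := by push_cast [coe_nnnorm]; ring
    · have h3 : max ((2 : ℝ) - t₀) (t₀ - -1) ≤ 3 := max_le (by linarith [ht₀.1]) (by linarith [ht₀.2])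
      push_cast [coe_nnnorm]
      have := norm_nonneg w
      calc (1 / 8 * (2 * ‖w‖ + 1)) * max ((2 : ℝ) - t₀) (t₀ - -1)
          ≤ (1 / 8 * (2 * ‖w‖ + 1)) * 3 := mul_le_mul_of_nonneg_left h3 (by positivity)
        _ ≤ ‖w‖ + 1 - 0 := by linarith
  obtain ⟨X, h1, h2⟩ := hpl.exists_eq_forall_mem_Icc_hasDerivWithinAt₀
  exact ⟨X, h1, fun t ht => (h2 t (Ioo_subset_Icc_self ht)).hasDerivAt (Icc_mem_nhds ht.1 ht.2)⟩

end LinearODE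

/-! ### Invariance of the metric under parallel transport. -/

section Transport

variable {n : ℕ} {M : Type*} [TopologicalSpace M] [ChartedSpace (Coord n) M]
  [IsManifold (𝓡 n) ∞ M]

theorem isSmoothCurve_lift {J : Set ℝ} (hJ : IsOpen J) (hJ' : J.OrdConnected) {γ : ℝ → Coord n}
    (hγ : ContDiffOn ℝ ∞ γ J) {x₀ : M} (hm : ∀ t ∈ J, γ t ∈ (extChartAt (𝓡 n) x₀).target) :
    IsSmoothCurve (n := n) J (fun t => (extChartAt (𝓡 n) x₀).symm (γ t)) :=
  ⟨hJ, hJ', (contMDiffOn_extChartAt_symm x₀).comp hγ.contMDiffOn hm⟩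

theorem coordVec_velocity_lift {J : Set ℝ} (hJ : IsOpen J) (hJ' : J.OrdConnected) {γ : ℝ → Coord n}
    (hγ : ContDiffOn ℝ ∞ γ J) {x₀ : M} (hm : ∀ t ∈ J, γ t ∈ (extChartAt (𝓡 n) x₀).target)
    {t : ℝ} (ht : t ∈ J) :
    coordVec x₀ _ (velocity (n := n) (fun t => (extChartAt (𝓡 n) x₀).symm (γ t)) t) = deriv γ t := by
  have h1 := hasDerivAt_chart_comp ((isSmoothCurve_lift hJ hJ' hγ hm).smoothAt ht)
    (mem_chart_target (hm t ht))
  rw [← h1.deriv]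
  apply Filter.EventuallyEq.deriv_eq
  filter_upwards [hJ.mem_nhds ht] with s hs
  exact extChartAt_symm_right (hm s hs)

theorem isParallelAlong_lift (D : AffineConnection n M) {J : Set ℝ} (hJ : IsOpen J)
    (hJ' : J.OrdConnected) {γ : ℝ → Coord n} (hγ : ContDiffOn ℝ ∞ γ J) {x₀ : M}
    (hm : ∀ t ∈ J, γ t ∈ (extChartAt (𝓡 n) x₀).target) {X : ℝ → Coord n}
    (hX : ∀ t ∈ J, HasDerivAt X (-christoffelL D x₀ (γ t) (deriv γ t) (X t)) t) :
    IsParallelAlong D J (fun t => (extChartAt (𝓡 n) x₀).symm (γ t))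
      (fun t => coordField x₀ (X t) ((extChartAt (𝓡 n) x₀).symm (γ t))) := by
  intro t ht x₁ hx₁
  refine parallel_equation_change D ((isSmoothCurve_lift hJ hJ' hγ hm).smoothAt ht) hx₁
    (mem_chart_target (hm t ht)) ?_
  rw [coordVec_velocity_lift hJ hJ' hγ hm ht, coordVec_coordField (mem_chart_target (hm t ht)),
    ← christoffelL_apply D (hm t ht)]
  refine (hX t ht).congr_of_eventuallyEq ?_
  filter_upwards [hJ.mem_nhds ht] with s hs
  exact coordVec_coordField (mem_chart_target (hm s hs)) _

/-- The Finsler function in the induced local coordinates. -/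
def finslerCoord (F : FinslerMetric n M) (x₀ : M) (p : Coord n × Coord n) : ℝ :=
  F.toFun ((extChartAt (𝓡 n) x₀).symm p.1) (coordField x₀ p.2 ((extChartAt (𝓡 n) x₀).symm p.1))

theorem energyCoord_eq (F : FinslerMetric n M) (x₀ : M) :
    energyCoord F.toFun x₀ = fun p => (1 / 2) * finslerCoord F x₀ p ^ 2 := rfl

theorem finslerCoord_extChartAt (F : FinslerMetric n M) {x₀ x : M}
    (hx : x ∈ (chartAt (Coord n) x₀).source) (v : TangentSpace (𝓡 n) x) :
    finslerCoord F x₀ (extChartAt (𝓡 n) x₀ x, coordVec x₀ x v) = F.toFun x v := by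
  have : ∀ z, z = x → F.toFun z (coordField x₀ (coordVec x₀ x v) z) = F.toFun x v := by
    rintro _ rfl
    rw [coordField_coordVec hx]
  exact this _ (extChartAt_symm_left hx)

theorem finslerCoord_zero (F : FinslerMetric n M) (x₀ : M) (u : Coord n) :
    finslerCoord F x₀ (u, 0) = 0 := by
  rw [finslerCoord, coordField_zero, F.map_zero]

theorem finslerCoord_pos (F : FinslerMetric n M) {x₀ : M} {u y : Coord n}
    (hu : u ∈ (extChartAt (𝓡 n) x₀).target) (hy : y ≠ 0) : 0 < finslerCoord F x₀ (u, y) :=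
  F.pos _ _ (coordField_ne_zero (mem_chart_target hu) hy)

theorem finslerCoord_smul (F : FinslerMetric n M) (x₀ : M) (u y : Coord n) {r : ℝ} (hr : 0 < r) :
    finslerCoord F x₀ (u, r • y) = r * finslerCoord F x₀ (u, y) := by
  rw [finslerCoord, coordField_smul, F.homogeneous _ _ r hr]; rfl

theorem contMDiffAt_coordField_uncurry {x₀ : M} {u : Coord n}
    (hu : u ∈ (extChartAt (𝓡 n) x₀).target) (y : Coord n) :
    ContMDiffAt 𝓘(ℝ, Coord n × Coord n) (𝓡 n).tangent ∞
      (fun p : Coord n × Coord n => (⟨(extChartAt (𝓡 n) x₀).symm p.1,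
        coordField x₀ p.2 ((extChartAt (𝓡 n) x₀).symm p.1)⟩ : TangentBundle (𝓡 n) M)) (u, y) := by
  have hs : ContMDiffAt 𝓘(ℝ, Coord n × Coord n) (𝓡 n) ∞
      (fun p : Coord n × Coord n => (extChartAt (𝓡 n) x₀).symm p.1) (u, y) := by
    have := contMDiffAt_extChartAt_symm (mem_chart_target hu)
    rw [extChartAt_symm_right hu] at this
    exact ContMDiffAt.comp (u, y) this contDiffAt_fst.contMDiffAt
  refine ((trivializationAt (Coord n) (TangentSpace (𝓡 n) (M := M)) x₀).contMDiffAt_iff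
    (IM := 𝓘(ℝ, Coord n × Coord n)) (IB := 𝓡 n) (n := ∞) (x₀ := (u, y)) ?_).2 ⟨hs, ?_⟩
  · rw [Trivialization.mem_source]
    simpa using mem_chart_target hu
  · refine (contDiffAt_snd (p := (u, y))).contMDiffAt.congr_of_eventuallyEq ?_
    have : ∀ᶠ p : Coord n × Coord n in 𝓝 (u, y), p.1 ∈ (extChartAt (𝓡 n) x₀).target :=
      continuousAt_fst.eventually ((isOpen_target x₀).mem_nhds hu)
    filter_upwards [this] with p hp
    rw [← coordVec_eq_snd (mem_chart_target hp), coordVec_coordField (mem_chart_target hp)]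

theorem contDiffAt_finslerCoord (F : FinslerMetric n M) {x₀ : M} {u y : Coord n}
    (hu : u ∈ (extChartAt (𝓡 n) x₀).target) (hy : y ≠ 0) :
    ContDiffAt ℝ ∞ (finslerCoord F x₀) (u, y) := by
  rw [← contMDiffAt_iff_contDiffAt]
  have h1 := F.smooth ⟨(extChartAt (𝓡 n) x₀).symm u,
    coordField x₀ y ((extChartAt (𝓡 n) x₀).symm u)⟩ (coordField_ne_zero (mem_chart_target hu) hy)
  have h2 := (contMDiffAt_coordField_uncurry hu y).contMDiffWithinAt (s := 
    (extChartAt (𝓡 n) x₀).target ×ˢ {y | y ≠ 0})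
  refine (ContMDiffWithinAt.comp (u, y) h1 h2 ?_).contMDiffAt ?_
  · rintro ⟨u', y'⟩ ⟨h, h'⟩
    exact coordField_ne_zero (mem_chart_target h) h'
  · exact ((isOpen_target x₀).prod isOpen_ne).mem_nhds ⟨hu, hy⟩

theorem PreservedBy.finslerCoord_eq {F : FinslerMetric n M} {D : AffineConnection n M}
    (h : PreservedBy F D) {J : Set ℝ} (hJ : IsOpen J)
    (hJ' : J.OrdConnected) {γ : ℝ → Coord n} (hγ : ContDiffOn ℝ ∞ γ J) {x₀ : M}
    (hm : ∀ t ∈ J, γ t ∈ (extChartAt (𝓡 n) x₀).target) {X : ℝ → Coord n}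
    (hX : ∀ t ∈ J, HasDerivAt X (-christoffelL D x₀ (γ t) (deriv γ t) (X t)) t) {s t : ℝ}
    (hs : s ∈ J) (ht : t ∈ J) :
    finslerCoord F x₀ (γ s, X s) = finslerCoord F x₀ (γ t, X t) :=
  h J _ _ (isSmoothCurve_lift hJ hJ' hγ hm) (isParallelAlong_lift D hJ hJ' hγ hm hX) s hs t ht

theorem deriv_segment (u v : Coord n) (t : ℝ) : deriv (fun t : ℝ => u + t • v) t = v := by
  have := ((hasDerivAt_id t).smul_const v).const_add u
  simpa using this.deriv

set_option synthInstance.maxHeartbeats 200000 in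
/-- Parallel transport along short coordinate segments. -/
theorem exists_transport_segment [T2Space M] (D : AffineConnection n M)
    (hD : D.ContMDiffCovariantDerivative ∞) {x₀ : M} {u : Coord n}
    (hu : u ∈ (extChartAt (𝓡 n) x₀).target) :
    ∃ r > 0, ∀ v : Coord n, ‖v‖ < r →
      (∀ t ∈ Icc (-1 : ℝ) 2, u + t • v ∈ (extChartAt (𝓡 n) x₀).target) ∧
      ∀ t₀ ∈ Icc (-1 : ℝ) 2, ∀ w : Coord n, ∃ X : ℝ → Coord n, X t₀ = w ∧
        ∀ t ∈ Ioo (-1 : ℝ) 2, HasDerivAt X (-christoffelL D x₀ (u + t • v) v (X t)) t := by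
  have hcont := (contDiffAt_christoffelL D hD hu).continuousAt
  have hb : ∀ᶠ z in 𝓝 u, ‖christoffelL D x₀ z‖ < ‖christoffelL D x₀ u‖ + 1 :=
    eventually_norm_lt hcont
  obtain ⟨ρ, hρ, hball⟩ := Metric.eventually_nhds_iff.1
    (Filter.Eventually.and ((isOpen_target x₀).mem_nhds hu) hb)
  set K := ‖christoffelL D x₀ u‖ + 1 with hK
  have hKpos : 0 < K := by positivity
  -- Since `|t| ≤ 2`, the bound `ρ / 2` keeps the segment in the ball where the Christoffel symbols
  -- are bounded by `K`; the bound `1 / (8 * K)` yields the constant 1/8 of the linear equation.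
  refine ⟨min (ρ / 2) (1 / (8 * K)), by positivity, fun v hv => ?_⟩
  have hv1 : ‖v‖ < ρ / 2 := hv.trans_le (min_le_left _ _)
  have hv2 : ‖v‖ < 1 / (8 * K) := hv.trans_le (min_le_right _ _)
  have hin : ∀ t ∈ Icc (-1 : ℝ) 2, dist (u + t • v) u < ρ := by
    intro t ht
    rw [dist_eq_norm, add_sub_cancel_left, norm_smul]
    have : ‖t‖ ≤ 2 := by
      rw [Real.norm_eq_abs, abs_le]; constructor <;> linarith [ht.1, ht.2]
    nlinarith [norm_nonneg v, norm_nonneg t]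
  have hmem : ∀ t ∈ Icc (-1 : ℝ) 2, u + t • v ∈ (extChartAt (𝓡 n) x₀).target :=
    fun t ht => (hball (hin t ht)).1
  refine ⟨hmem, fun t₀ ht₀ w => ?_⟩
  refine exists_linear_ode (A := fun t => -christoffelL D x₀ (u + t • v) v) ?_ ?_ ht₀ w
  · intro t ht
    have h1 := (contDiffAt_christoffelL D hD (hmem t ht)).continuousAt
    have h2 : ContinuousAt (fun t : ℝ => u + t • v) t := by fun_prop
    have h3 : ContinuousAt (fun t : ℝ => christoffelL D x₀ (u + t • v)) t :=
      ContinuousAt.comp (f := fun t : ℝ => u + t • v) h1 h2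
    exact ((h3.clm_apply continuousAt_const).neg).continuousWithinAt
  · intro t ht
    rw [norm_neg]
    calc ‖christoffelL D x₀ (u + t • v) v‖ ≤ ‖christoffelL D x₀ (u + t • v)‖ * ‖v‖ :=
          ContinuousLinearMap.le_opNorm _ _
      _ ≤ K * (1 / (8 * K)) :=
          mul_le_mul (hball (hin t ht)).2.le hv2.le (norm_nonneg _) hKpos.le
      _ = 1 / 8 := by field_simp

theorem contDiffOn_segment (u v : Coord n) (s : Set ℝ) :
    ContDiffOn ℝ ∞ (fun t : ℝ => u + t • v) s := by fun_prop

/-- Invariance of `F` under parallel transport, in infinitesimal form. -/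
theorem PreservedBy.fderiv_eq_zero [T2Space M] {F : FinslerMetric n M} {D : AffineConnection n M}
    (h : PreservedBy F D) (hD : D.ContMDiffCovariantDerivative ∞) {x₀ : M} {u y : Coord n}
    (hu : u ∈ (extChartAt (𝓡 n) x₀).target) (hy : y ≠ 0) (v : Coord n) :
    fderiv ℝ (finslerCoord F x₀) (u, y) (v, -christoffelL D x₀ u v y) = 0 := by
  obtain ⟨r, hr, H⟩ := exists_transport_segment D hD hu
  -- Transport is available only along short segments, so `v` is scaled down; the resulting identity
  -- is linear in `v`, and `ε` cancels at the end.
  obtain ⟨ε, hε, hεv⟩ : ∃ ε : ℝ, 0 < ε ∧ ‖ε • v‖ < r := by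
    refine ⟨r / (2 * (‖v‖ + 1)), by positivity, ?_⟩
    rw [norm_smul, Real.norm_of_nonneg (by positivity), div_mul_eq_mul_div, div_lt_iff₀ (by positivity)]
    nlinarith [norm_nonneg v]
  obtain ⟨hm, hX⟩ := H (ε • v) hεv
  obtain ⟨X, hX0, hX⟩ := hX 0 (by norm_num) y
  have hconst : ∀ t ∈ Ioo (-1 : ℝ) 2, finslerCoord F x₀ (u + t • ε • v, X t) =
      finslerCoord F x₀ (u + (0 : ℝ) • ε • v, X 0) := fun t ht =>
    h.finslerCoord_eq isOpen_Ioo ordConnected_Ioo (contDiffOn_segment u (ε • v) _)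
      (fun t ht => hm t (Ioo_subset_Icc_self ht))
      (fun t ht => by rw [deriv_segment]; exact hX t ht) ht (by norm_num)
  have h0 : (0 : ℝ) ∈ Ioo (-1 : ℝ) 2 := by norm_num
  have hγ : HasDerivAt (fun t : ℝ => u + t • ε • v) (ε • v) 0 := by
    simpa using ((hasDerivAt_id (0 : ℝ)).smul_const (ε • v)).const_add u
  have hd := (contDiffAt_finslerCoord F hu hy).differentiableAt (by simp) |>.hasFDerivAt
  have hp : HasDerivAt (fun t : ℝ => (u + t • ε • v, X t))
      (ε • v, -christoffelL D x₀ u (ε • v) y) 0 := by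
    have := hγ.prodMk (hX 0 h0)
    simpa [hX0] using this
  have hd' : HasFDerivAt (finslerCoord F x₀) (fderiv ℝ (finslerCoord F x₀) (u, y))
      ((fun t : ℝ => (u + t • ε • v, X t)) 0) := by
    simpa [hX0] using hd
  have h1 := hd'.comp_hasDerivAt (0 : ℝ) hp
  have h2 : HasDerivAt (finslerCoord F x₀ ∘ fun t : ℝ => (u + t • ε • v, X t)) 0 0 := by
    refine (hasDerivAt_const (0 : ℝ) (finslerCoord F x₀ (u + (0 : ℝ) • ε • v, X 0))).congr_of_eventuallyEq ?_
    filter_upwards [isOpen_Ioo.mem_nhds h0] with t ht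
    exact hconst t ht
  have h3 := h1.unique h2
  have h4 : ((ε • v, -christoffelL D x₀ u (ε • v) y) : Coord n × Coord n) =
      ε • (v, -christoffelL D x₀ u v y) := by
    rw [map_smul, Prod.smul_mk]
    simp
  rw [h4, map_smul, smul_eq_mul] at h3
  exact (mul_eq_zero.1 h3).resolve_left hε.ne'

/-- The norms `F_x` on all tangent spaces are linearly isometric. -/
theorem PreservedBy.exists_isometry [T2Space M] [ConnectedSpace M] {F : FinslerMetric n M}
    {D : AffineConnection n M} (h : PreservedBy F D) (hD : D.ContMDiffCovariantDerivative ∞)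
    (x x' : M) : ∃ L : TangentSpace (𝓡 n) x ≃ₗ[ℝ] TangentSpace (𝓡 n) x',
      ∀ v, F.toFun x' (L v) = F.toFun x v := by
  let P : M → M → Prop := fun x x' => ∃ L : TangentSpace (𝓡 n) x ≃ₗ[ℝ]
    TangentSpace (𝓡 n) x', ∀ v, F.toFun x' (L v) = F.toFun x v
  have : Std.Symm P := ⟨fun a b ⟨L, hL⟩ =>
    ⟨L.symm, fun v => by rw [← hL, L.apply_symm_apply]⟩⟩
  -- Being linearly isometric is an equivalence relation on points, so on a connected manifold only
  -- points near a given `x₀` matter; these are reached by one coordinate segment.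
  refine PreconnectedSpace.induction₂ P (fun x₀ => ?_)
    ⟨fun a b c ⟨L, hL⟩ ⟨L', hL'⟩ => ⟨L.trans L', fun v => (hL' _).trans (hL v)⟩⟩ x x'
  · have hx₀ := mem_chart_source (Coord n) x₀
    have hu := extChartAt_mem_target hx₀
    obtain ⟨r, hr, H⟩ := exists_transport_segment D hD hu
    have hev : ∀ᶠ z in 𝓝 x₀, ‖extChartAt (𝓡 n) x₀ z - extChartAt (𝓡 n) x₀ x₀‖ < r := by
      have : ContinuousAt (fun z => ‖extChartAt (𝓡 n) x₀ z - extChartAt (𝓡 n) x₀ x₀‖) x₀ :=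
        ((continuousAt_extChartAt x₀).sub continuousAt_const).norm
      exact this.eventually_lt continuousAt_const (by simpa using hr)
    filter_upwards [hev, eventually_source hx₀] with z hz hzs
    obtain ⟨hm, hX⟩ := H _ hz
    set u := extChartAt (𝓡 n) x₀ x₀
    set v := extChartAt (𝓡 n) x₀ z - u with hv
    -- The basis vectors are transported from time 0 to time 1. Combinations of parallel fields are
    -- parallel, so transport extends linearly, and positivity of `F` makes the resulting map
    -- injective.
    have hX' : ∀ i : Fin n, ∃ X : ℝ → Coord n, X 0 = EuclideanSpace.single i (1 : ℝ) ∧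
        ∀ t ∈ Ioo (-1 : ℝ) 2, HasDerivAt X (-christoffelL D x₀ (u + t • v) v (X t)) t :=
      fun i => hX 0 (by norm_num) _
    choose X hX0 hXd using hX'
    have hcomb : ∀ w : Coord n, finslerCoord F x₀ (extChartAt (𝓡 n) x₀ z, ∑ i, w i • X i 1) =
        finslerCoord F x₀ (u, w) := by
      intro w
      have hs : ∀ t ∈ Ioo (-1 : ℝ) 2, HasDerivAt (fun t => ∑ i, w i • X i t)
          (-christoffelL D x₀ (u + t • v) v (∑ i, w i • X i t)) t := by
        intro t ht
        have := HasDerivAt.fun_sum (u := Finset.univ) fun i _ => (hXd i t ht).const_smul (w i)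
        refine this.congr_deriv ?_
        rw [map_sum, ← Finset.sum_neg_distrib]
        refine Finset.sum_congr rfl fun i _ => ?_
        rw [map_smul, smul_neg]
      have := h.finslerCoord_eq isOpen_Ioo ordConnected_Ioo (contDiffOn_segment u v _)
        (fun t ht => hm t (Ioo_subset_Icc_self ht))
        (fun t ht => by rw [deriv_segment]; exact hs t ht)
        (s := 1) (t := 0) (by norm_num) (by norm_num)
      simp only [hX0, sum_smul_single, zero_smul, add_zero, one_smul] at this
      rw [← this, hv, add_sub_cancel]
    let L : TangentSpace (𝓡 n) x₀ →ₗ[ℝ] TangentSpace (𝓡 n) z :=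
      { toFun := fun w => coordField x₀ (∑ i, (coordVec x₀ x₀ w) i • X i 1) z
        map_add' := fun a b => by
          rw [coordVec_add, ← coordField_add, ← Finset.sum_add_distrib]
          congr 1
          exact Finset.sum_congr rfl fun i _ => add_smul _ _ _
        map_smul' := fun a b => by
          rw [coordVec_smul, RingHom.id_apply, ← coordField_smul, Finset.smul_sum]
          congr 1
          exact Finset.sum_congr rfl fun i _ => mul_smul _ _ _ }
    have hL : ∀ w, F.toFun z (L w) = F.toFun x₀ w := by
      intro w
      have h1 := hcomb (coordVec x₀ x₀ w)
      rw [finslerCoord_extChartAt F hx₀] at h1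
      rw [← h1, ← finslerCoord_extChartAt F hzs]
      congr 2
      exact coordVec_coordField hzs _
    have hinj : Function.Injective L := by
      rw [injective_iff_map_eq_zero]
      intro w hw
      by_contra hne
      have := F.pos x₀ w hne
      rw [← hL, hw, F.map_zero] at this
      exact lt_irrefl _ this
    have : FiniteDimensional ℝ (TangentSpace (𝓡 n) x₀) :=
      inferInstanceAs (FiniteDimensional ℝ (Coord n))
    have : FiniteDimensional ℝ (TangentSpace (𝓡 n) z) :=
      inferInstanceAs (FiniteDimensional ℝ (Coord n))
    exact ⟨LinearEquiv.ofInjectiveOfFinrankEq L hinj rfl, hL⟩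

end Transport

/-! ### Euler-Lagrange expressions of homogeneous Lagrangians. -/

section EulerLagrange

variable {n : ℕ}

/-- The Euler-Lagrange expression of a Lagrangian `L(x, y)` along the spray with acceleration `-G`,
evaluated on `w`. -/
def eulerLagrange (L : Coord n × Coord n → ℝ) (G : Coord n) (p : Coord n × Coord n)
    (w : Coord n) : ℝ :=
  fderiv ℝ (fderiv ℝ L) p (p.2, -G) (0, w) - fderiv ℝ L p (w, 0)

theorem eventually_differentiableAt {L : Coord n × Coord n → ℝ} {p : Coord n × Coord n}
    (hL : ContDiffAt ℝ ∞ L p) : ∀ᶠ q in 𝓝 p, DifferentiableAt ℝ L q := by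
  have h1 : ContDiffAt ℝ 1 L p := hL.of_le (by simp)
  exact (h1.eventually (by decide)).mono fun q hq => hq.differentiableAt one_ne_zero

theorem differentiableAt_fderiv {L : Coord n × Coord n → ℝ} {p : Coord n × Coord n}
    (hL : ContDiffAt ℝ ∞ L p) : DifferentiableAt ℝ (fderiv ℝ L) p :=
  (hL.fderiv_right (m := ∞) (by simp)).differentiableAt (by simp)

theorem fderiv_fderiv_apply {L : Coord n × Coord n → ℝ} {p : Coord n × Coord n}
    (hL : ContDiffAt ℝ ∞ L p) (a b : Coord n × Coord n) :
    fderiv ℝ (fun q => fderiv ℝ L q b) p a = fderiv ℝ (fderiv ℝ L) p a b := by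
  have := ((differentiableAt_fderiv hL).hasFDerivAt.clm_apply (hasFDerivAt_const b p)).fderiv
  rw [this]
  simp

theorem fderiv_fderiv_symm {L : Coord n × Coord n → ℝ} {p : Coord n × Coord n}
    (hL : ContDiffAt ℝ ∞ L p) (a b : Coord n × Coord n) :
    fderiv ℝ (fderiv ℝ L) p a b = fderiv ℝ (fderiv ℝ L) p b a :=
  (hL.isSymmSndFDerivAt (by simp; exact ENat.LEInfty.out)) a b

theorem hasFDerivAt_halfSq {L : Coord n × Coord n → ℝ} {q : Coord n × Coord n}
    (hL : DifferentiableAt ℝ L q) :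
    HasFDerivAt (fun q => (1 / 2) * L q ^ 2) (L q • fderiv ℝ L q) q := by
  have := (hL.hasFDerivAt.pow 2).const_mul (1 / 2)
  refine this.congr_fderiv ?_
  ext <;> simp <;> ring

theorem fderiv_fderiv_halfSq {L : Coord n × Coord n → ℝ} {p : Coord n × Coord n}
    (hL : ContDiffAt ℝ ∞ L p) (a b : Coord n × Coord n) :
    fderiv ℝ (fderiv ℝ fun q => (1 / 2) * L q ^ 2) p a b =
      L p * fderiv ℝ (fderiv ℝ L) p a b + fderiv ℝ L p a * fderiv ℝ L p b := by
  have h1 : fderiv ℝ (fun q => (1 / 2) * L q ^ 2) =ᶠ[𝓝 p] fun q => L q • fderiv ℝ L q :=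
    (eventually_differentiableAt hL).mono fun q hq => (hasFDerivAt_halfSq hq).fderiv
  have h2 := (hL.differentiableAt (by simp)).hasFDerivAt.fun_smul
    (differentiableAt_fderiv hL).hasFDerivAt
  rw [h1.fderiv_eq, h2.fderiv]
  simp

theorem contDiffAt_halfSq {L : Coord n × Coord n → ℝ} {p : Coord n × Coord n}
    (hL : ContDiffAt ℝ ∞ L p) : ContDiffAt ℝ ∞ (fun q => (1 / 2) * L q ^ 2) p :=
  contDiffAt_const.mul (hL.pow 2)

/-- When the expression of `L` vanishes, that of the energy is a multiple of `L_y`; such a multiple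
accounts exactly for a projective change of spray. -/
theorem eulerLagrange_halfSq {L : Coord n × Coord n → ℝ} {p : Coord n × Coord n}
    (hL : ContDiffAt ℝ ∞ L p) (G w : Coord n) :
    eulerLagrange (fun q => (1 / 2) * L q ^ 2) G p w =
      L p * eulerLagrange L G p w + fderiv ℝ L p (p.2, -G) * fderiv ℝ L p (0, w) := by
  rw [eulerLagrange, eulerLagrange, fderiv_fderiv_halfSq hL,
    (hasFDerivAt_halfSq (hL.differentiableAt (by simp))).fderiv]
  simp
  ring

theorem eulerLagrange_add {L L' : Coord n × Coord n → ℝ} {p : Coord n × Coord n}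
    (hL : ContDiffAt ℝ ∞ L p) (hL' : ContDiffAt ℝ ∞ L' p) (G w : Coord n) :
    eulerLagrange (fun q => L q + L' q) G p w = eulerLagrange L G p w + eulerLagrange L' G p w := by
  have h1 : fderiv ℝ (fun q => L q + L' q) =ᶠ[𝓝 p] fun q => fderiv ℝ L q + fderiv ℝ L' q := by
    filter_upwards [(eventually_differentiableAt hL), (eventually_differentiableAt hL')] with q hq hq'
    exact fderiv_fun_add hq hq'
  rw [eulerLagrange, eulerLagrange, eulerLagrange, h1.fderiv_eq, h1.self_of_nhds,
    fderiv_fun_add (differentiableAt_fderiv hL) (differentiableAt_fderiv hL')]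
  simp
  ring

/-- The Euler-Lagrange expression of a Lagrangian invariant under parallel transport. -/
theorem eulerLagrange_of_parallel {L : Coord n × Coord n → ℝ} {u y : Coord n}
    (hL : ContDiffAt ℝ ∞ L (u, y)) (hy : y ≠ 0) {Γ : Coord n →L[ℝ] Coord n →L[ℝ] Coord n}
    (hΓ : ∀ z ≠ 0, ∀ v, fderiv ℝ L (u, z) (v, -Γ v z) = 0) (w : Coord n) :
    eulerLagrange L (Γ y y) (u, y) w = fderiv ℝ L (u, y) (0, Γ y w - Γ w y) := by
  -- The identity `hΓ` with `v = y` is differentiated in the fibre along `w`, giving `L'' (0, w) (y,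
  -- -Γ y y) = L' (0, Γ y w)`; the same identity with `v = w` turns `L' (w, 0)` into `L' (0, Γ w
  -- y)`.
  have hγ : HasDerivAt (fun t : ℝ => (u, y + t • w)) ((0, w) : Coord n × Coord n) 0 := by
    have h1 : HasDerivAt (fun t : ℝ => y + t • w) w 0 := by
      simpa using ((hasDerivAt_id (0 : ℝ)).smul_const w).const_add y
    exact (hasDerivAt_const (0 : ℝ) u).prodMk h1
  have hd : HasFDerivAt (fderiv ℝ L) (fderiv ℝ (fderiv ℝ L) (u, y))
      ((fun t : ℝ => (u, y + t • w)) 0) := by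
    simpa using (differentiableAt_fderiv hL).hasFDerivAt
  have h1 := hd.comp_hasDerivAt (0 : ℝ) hγ
  have h2 : HasDerivAt (fun t : ℝ => ((y, -Γ y (y + t • w)) : Coord n × Coord n)) (0, -Γ y w) 0 := by
    have h3 : HasDerivAt (fun t : ℝ => -Γ y (y + t • w)) (-Γ y w) 0 := by
      have h1 : HasDerivAt (fun t : ℝ => y + t • w) w 0 := by
        simpa using ((hasDerivAt_id (0 : ℝ)).smul_const w).const_add y
      exact ((Γ y).hasFDerivAt.comp_hasDerivAt (0 : ℝ) h1).neg
    exact (hasDerivAt_const (0 : ℝ) y).prodMk h3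
  have h4 := h1.clm_apply h2
  have h5 : HasDerivAt (fun t : ℝ => fderiv ℝ L (u, y + t • w) (y, -Γ y (y + t • w))) 0 0 := by
    refine (hasDerivAt_const (0 : ℝ) (0 : ℝ)).congr_of_eventuallyEq ?_
    have hc : ContinuousAt (fun t : ℝ => y + t • w) 0 := by fun_prop
    filter_upwards [hc.eventually_ne (by simpa using hy : y + (0 : ℝ) • w ≠ 0)] with t ht
    exact hΓ _ ht y
  have h6 := h4.unique h5
  simp only [Function.comp, zero_smul, add_zero] at h6
  have h7 := hΓ y hy w
  have e1 : ((w, -Γ w y) : Coord n × Coord n) = (w, 0) - (0, Γ w y) := by simp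
  have e2 : ((0, -Γ y w) : Coord n × Coord n) = -(0, Γ y w) := by simp
  have e3 : ((0, Γ y w - Γ w y) : Coord n × Coord n) = (0, Γ y w) - (0, Γ w y) := by simp
  rw [e1, map_sub] at h7
  rw [e2, map_neg] at h6
  rw [eulerLagrange, fderiv_fderiv_symm hL, e3, map_sub]
  linarith

/-- Euler's identity for degree one. -/
theorem fderiv_radial {L : Coord n × Coord n → ℝ} {u y : Coord n}
    (hL : ContDiffAt ℝ ∞ L (u, y))
    (hom : ∀ (z : Coord n) (r : ℝ), 0 < r → L (u, r • z) = r * L (u, z)) :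
    fderiv ℝ L (u, y) (0, y) = L (u, y) := by
  have hγ : HasDerivAt (fun t : ℝ => (u, t • y)) ((0, y) : Coord n × Coord n) 1 := by
    have h1 : HasDerivAt (fun t : ℝ => t • y) y 1 := by
      simpa using (hasDerivAt_id (1 : ℝ)).smul_const y
    exact (hasDerivAt_const (1 : ℝ) u).prodMk h1
  have hd : HasFDerivAt L (fderiv ℝ L (u, y)) ((fun t : ℝ => (u, t • y)) 1) := by
    simpa using (hL.differentiableAt (by simp)).hasFDerivAt
  have h1 := hd.comp_hasDerivAt (1 : ℝ) hγ
  have h2 : HasDerivAt (L ∘ fun t : ℝ => (u, t • y)) (L (u, y)) 1 := by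
    have : HasDerivAt (fun t : ℝ => t * L (u, y)) (L (u, y)) 1 := by
      simpa using (hasDerivAt_id (1 : ℝ)).mul_const (L (u, y))
    refine this.congr_of_eventuallyEq ?_
    filter_upwards [lt_mem_nhds (zero_lt_one (α := ℝ))] with t ht
    exact hom y t ht
  exact h1.unique h2

theorem fderiv_prodMap_of_homogeneous {L : Coord n × Coord n → ℝ} {u y : Coord n}
    (hom : ∀ (u z : Coord n) (r : ℝ), 0 < r → L (u, r • z) = r * L (u, z)) {r : ℝ} (hr : 0 < r)
    (hL : DifferentiableAt ℝ L (u, y)) (hL' : DifferentiableAt ℝ L (u, r • y)) (v w : Coord n) :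
    fderiv ℝ L (u, r • y) (v, r • w) = r * fderiv ℝ L (u, y) (v, w) := by
  let m : Coord n × Coord n →L[ℝ] Coord n × Coord n :=
    (ContinuousLinearMap.fst ℝ _ _).prod (r • ContinuousLinearMap.snd ℝ _ _)
  have h1 : HasFDerivAt (L ∘ m) ((fderiv ℝ L (u, r • y)).comp m) (u, y) :=
    HasFDerivAt.comp (u, y) (f := m) (g := L) hL'.hasFDerivAt m.hasFDerivAt
  have h2 : HasFDerivAt (L ∘ m) (r • fderiv ℝ L (u, y)) (u, y) := by
    have : L ∘ m = fun p => r * L p := by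
      ext1 ⟨a, b⟩
      exact hom a b r hr
    rw [this]
    exact hL.hasFDerivAt.const_mul r
  exact congrArg (fun A => A (v, w)) (h1.unique h2)

theorem fderiv_smul_of_homogeneous {L : Coord n × Coord n → ℝ} {u y : Coord n}
    (hom : ∀ (u z : Coord n) (r : ℝ), 0 < r → L (u, r • z) = r * L (u, z)) {r : ℝ} (hr : 0 < r)
    (hL : DifferentiableAt ℝ L (u, y)) (hL' : DifferentiableAt ℝ L (u, r • y)) (w : Coord n) :
    fderiv ℝ L (u, r • y) (0, w) = fderiv ℝ L (u, y) (0, w) := by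
  have h := fderiv_prodMap_of_homogeneous hom hr hL hL' 0 w
  have h' : ((0, r • w) : Coord n × Coord n) = r • (0, w) := by simp
  rw [h', map_smul, smul_eq_mul] at h
  exact mul_left_cancel₀ hr.ne' h

/-- The fibre derivative is homogeneous of degree 0, hence constant along the ray through `y`: the
fibre Hessian is degenerate exactly in the way that projective freedom requires. -/
theorem fderiv_fderiv_radial {L : Coord n × Coord n → ℝ} {u y : Coord n}
    (hL : ContDiffAt ℝ ∞ L (u, y))
    (hom : ∀ (u z : Coord n) (r : ℝ), 0 < r → L (u, r • z) = r * L (u, z)) (w : Coord n) :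
    fderiv ℝ (fderiv ℝ L) (u, y) (0, y) (0, w) = 0 := by
  have hγ : HasDerivAt (fun t : ℝ => (u, t • y)) ((0, y) : Coord n × Coord n) 1 := by
    have h1 : HasDerivAt (fun t : ℝ => t • y) y 1 := by
      simpa using (hasDerivAt_id (1 : ℝ)).smul_const y
    exact (hasDerivAt_const (1 : ℝ) u).prodMk h1
  have hd : HasFDerivAt (fderiv ℝ L) (fderiv ℝ (fderiv ℝ L) (u, y))
      ((fun t : ℝ => (u, t • y)) 1) := by
    simpa using (differentiableAt_fderiv hL).hasFDerivAt
  have h0 := hd.comp_hasDerivAt (1 : ℝ) hγ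
  have h1 := h0.clm_apply (hasDerivAt_const (1 : ℝ) ((0, w) : Coord n × Coord n))
  rw [map_zero, add_zero] at h1
  have h2 : HasDerivAt (fun t : ℝ => fderiv ℝ L (u, t • y) (0, w)) 0 1 := by
    refine (hasDerivAt_const (1 : ℝ) (fderiv ℝ L (u, y) (0, w))).congr_of_eventuallyEq ?_
    have hc : ContinuousAt (fun t : ℝ => (u, t • y)) 1 := by fun_prop
    have h3 : ∀ᶠ q in 𝓝 (u, (1 : ℝ) • y), DifferentiableAt ℝ L q := by
      rw [one_smul]
      exact (eventually_differentiableAt hL)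
    filter_upwards [lt_mem_nhds (zero_lt_one (α := ℝ)), hc.eventually h3] with t ht htd
    exact fderiv_smul_of_homogeneous hom ht (hL.differentiableAt (by simp)) htd w
  exact h1.unique h2

end EulerLagrange

/-! ### The geodesic spray of a Finsler metric. -/

section Spray

variable {n : ℕ} {M : Type*} [TopologicalSpace M] [ChartedSpace (Coord n) M]
  [IsManifold (𝓡 n) ∞ M] (F : FinslerMetric n M) {x₀ : M} {u y : Coord n}

/-- The vector with components `2Gⁱ`. -/
def sprayVec (x₀ : M) (p : Coord n × Coord n) : Coord n :=
  WithLp.toLp 2 (sprayCoeff F.toFun x₀ p)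

theorem contDiffAt_energyCoord (hu : u ∈ (extChartAt (𝓡 n) x₀).target) (hy : y ≠ 0) :
    ContDiffAt ℝ ∞ (energyCoord F.toFun x₀) (u, y) :=
  contDiffAt_halfSq (contDiffAt_finslerCoord F hu hy)

theorem fundamentalMatrix_apply (hu : u ∈ (extChartAt (𝓡 n) x₀).target) (hy : y ≠ 0)
    (i j : Fin n) : fundamentalMatrix F.toFun x₀ (u, y) i j =
      fderiv ℝ (fderiv ℝ (energyCoord F.toFun x₀)) (u, y) (0, EuclideanSpace.single i 1)
        (0, EuclideanSpace.single j 1) :=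
  fderiv_fderiv_apply (contDiffAt_energyCoord F hu hy) _ _

theorem sum_smul_apply_snd (A : Coord n × Coord n →L[ℝ] ℝ) (z : Coord n) :
    ∑ i, z i * A (0, EuclideanSpace.single i (1 : ℝ)) = A (0, z) := by
  have := map_sum (A.comp (ContinuousLinearMap.inr ℝ (Coord n) (Coord n)))
    (fun i => z i • EuclideanSpace.single i (1 : ℝ)) Finset.univ
  rw [sum_smul_single] at this
  simpa using this.symm

theorem sum_smul_apply_fst (A : Coord n × Coord n →L[ℝ] ℝ) (z : Coord n) :
    ∑ i, z i * A (EuclideanSpace.single i (1 : ℝ), 0) = A (z, 0) := by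
  have := map_sum (A.comp (ContinuousLinearMap.inl ℝ (Coord n) (Coord n)))
    (fun i => z i • EuclideanSpace.single i (1 : ℝ)) Finset.univ
  rw [sum_smul_single] at this
  simpa using this.symm

theorem isUnit_det_fundamentalMatrix (hu : u ∈ (extChartAt (𝓡 n) x₀).target) (hy : y ≠ 0) :
    IsUnit (fundamentalMatrix F.toFun x₀ (u, y)).det :=
  (F.posDef x₀ u hu y hy).det_pos.ne'.isUnit

/-- The defining equation of the spray coefficients. -/
theorem hessian_sprayVec (hu : u ∈ (extChartAt (𝓡 n) x₀).target) (hy : y ≠ 0) (G w : Coord n) :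
    fderiv ℝ (fderiv ℝ (energyCoord F.toFun x₀)) (u, y) (0, sprayVec F x₀ (u, y) - G) (0, w) =
      eulerLagrange (energyCoord F.toFun x₀) G (u, y) w := by
  set E := energyCoord F.toFun x₀ with hE
  have hEs := contDiffAt_energyCoord F hu hy
  set g := fundamentalMatrix F.toFun x₀ (u, y) with hg
  set b : Fin n → ℝ := fun j => (∑ l, partialX l (partialY j E) (u, y) * y l) -
    partialX j E (u, y) with hb
  have hS : ∀ i, sprayVec F x₀ (u, y) i = (g⁻¹.mulVec b) i := fun i => rfl
  have hb' : ∀ j, b j = fderiv ℝ (fderiv ℝ E) (u, y) (y, 0) (0, EuclideanSpace.single j 1) -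
      fderiv ℝ E (u, y) (EuclideanSpace.single j 1, 0) := by
    intro j
    have h1 : ∀ l, partialX l (partialY j E) (u, y) =
        ((fderiv ℝ (fderiv ℝ E) (u, y)).flip (0, EuclideanSpace.single j 1))
          (EuclideanSpace.single l 1, 0) := fun l => fderiv_fderiv_apply hEs _ _
    simp only [hb, h1]
    congr 1
    rw [← ContinuousLinearMap.flip_apply, ← sum_smul_apply_fst]
    exact Finset.sum_congr rfl fun l _ => mul_comm _ _
  have hgS : ∀ j, fderiv ℝ (fderiv ℝ E) (u, y) (0, sprayVec F x₀ (u, y))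
      (0, EuclideanSpace.single j 1) = b j := by
    intro j
    have h1 : (g.mulVec (g⁻¹.mulVec b)) j = b j := by
      rw [Matrix.mulVec_mulVec, Matrix.mul_nonsing_inv _ (isUnit_det_fundamentalMatrix F hu hy),
        Matrix.one_mulVec]
    rw [← h1, fderiv_fderiv_symm hEs, ← sum_smul_apply_snd]
    refine Finset.sum_congr rfl fun i _ => ?_
    change _ = g j i * g⁻¹.mulVec b i
    rw [hS, mul_comm, hg, fundamentalMatrix_apply F hu hy]
  have hmain : ∀ j, fderiv ℝ (fderiv ℝ E) (u, y) (0, sprayVec F x₀ (u, y) - G)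
      (0, EuclideanSpace.single j 1) = eulerLagrange E G (u, y) (EuclideanSpace.single j 1) := by
    intro j
    have e1 : ((0, sprayVec F x₀ (u, y) - G) : Coord n × Coord n) =
      (0, sprayVec F x₀ (u, y)) - (0, G) := by simp
    have e2 : ((y, -G) : Coord n × Coord n) = (y, 0) - (0, G) := by simp
    rw [eulerLagrange, e1, e2, map_sub, map_sub, sub_apply, sub_apply, hgS, hb']
    ring
  rw [← sum_smul_apply_snd]
  simp only [hmain]
  simp only [eulerLagrange, mul_sub, Finset.sum_sub_distrib, sum_smul_apply_snd, sum_smul_apply_fst]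

theorem hessian_energy_injective (hu : u ∈ (extChartAt (𝓡 n) x₀).target) (hy : y ≠ 0)
    {z : Coord n}
    (hz : ∀ w, fderiv ℝ (fderiv ℝ (energyCoord F.toFun x₀)) (u, y) (0, z) (0, w) = 0) : z = 0 := by
  have hEs := contDiffAt_energyCoord F hu hy
  set g := fundamentalMatrix F.toFun x₀ (u, y) with hg
  have h1 : g.mulVec z.ofLp = 0 := by
    funext j
    have := hz (EuclideanSpace.single j 1)
    rw [fderiv_fderiv_symm hEs, ← sum_smul_apply_snd] at this
    rw [Pi.zero_apply, ← this]
    change ∑ i, g j i * z i = _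
    refine Finset.sum_congr rfl fun i _ => ?_
    rw [mul_comm, hg, fundamentalMatrix_apply F hu hy]
  have h2 : g⁻¹.mulVec (g.mulVec z.ofLp) = z.ofLp := by
    rw [Matrix.mulVec_mulVec, Matrix.nonsing_inv_mul _ (isUnit_det_fundamentalMatrix F hu hy),
      Matrix.one_mulVec]
  rw [h1, Matrix.mulVec_zero] at h2
  ext i
  exact (congrFun h2 i).symm

/-- Adding a multiple of `y` to the spray changes the Euler-Lagrange side of the energy only by a
multiple of `F_y`. -/
theorem hessian_energy_radial (hu : u ∈ (extChartAt (𝓡 n) x₀).target) (hy : y ≠ 0) (w : Coord n) :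
    fderiv ℝ (fderiv ℝ (energyCoord F.toFun x₀)) (u, y) (0, y) (0, w) =
      finslerCoord F x₀ (u, y) * fderiv ℝ (finslerCoord F x₀) (u, y) (0, w) := by
  have hL := contDiffAt_finslerCoord F hu hy
  rw [energyCoord_eq, fderiv_fderiv_halfSq hL, fderiv_fderiv_radial hL
    (fun u z r hr => finslerCoord_smul F x₀ u z hr), fderiv_radial hL
    (fun z r hr => finslerCoord_smul F x₀ u z hr)]
  ring

/-- If `F` satisfies the Euler-Lagrange equations along the spray with acceleration `-G`, this spray
is projectively equivalent to the geodesic spray of `F`. -/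
theorem sprayVec_of_eulerLagrange (hu : u ∈ (extChartAt (𝓡 n) x₀).target) (hy : y ≠ 0)
    {G : Coord n} (h : ∀ w, eulerLagrange (finslerCoord F x₀) G (u, y) w = 0) :
    sprayVec F x₀ (u, y) = G + (fderiv ℝ (finslerCoord F x₀) (u, y) (y, -G) /
      finslerCoord F x₀ (u, y)) • y := by
  have hL := contDiffAt_finslerCoord F hu hy
  have hpos := finslerCoord_pos F hu hy
  rw [← sub_eq_iff_eq_add', ← sub_eq_zero]
  set P := fderiv ℝ (finslerCoord F x₀) (u, y) (y, -G) / finslerCoord F x₀ (u, y) with hP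
  refine hessian_energy_injective F hu hy fun w => ?_
  have e1 : ((0, sprayVec F x₀ (u, y) - G - P • y) : Coord n × Coord n) =
      (0, sprayVec F x₀ (u, y) - G) - P • (0, y) := by simp
  rw [e1, map_sub, map_smul, sub_apply, smul_apply, hessian_sprayVec F hu hy,
    hessian_energy_radial F hu hy, energyCoord_eq, eulerLagrange_halfSq hL, h w, smul_eq_mul, hP]
  field_simp
  ring

end Spray

/-! ### Geodesics, reparametrization and the spray of a Douglas metric. -/

section Geodesics

variable {n : ℕ} {M : Type*} [TopologicalSpace M] [ChartedSpace (Coord n) M]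
  [IsManifold (𝓡 n) ∞ M]

theorem hasDerivAt_of_components {X : ℝ → Coord n} {X' : Coord n} {t : ℝ}
    (h : ∀ i, HasDerivAt (fun s => X s i) (X' i) t) : HasDerivAt X X' t := by
  have h1 := HasDerivAt.fun_sum (u := Finset.univ) fun i _ =>
    (h i).smul_const (EuclideanSpace.single i (1 : ℝ))
  simpa only [sum_smul_single] using h1

theorem hasDerivAt_component {X : ℝ → Coord n} {X' : Coord n} {t : ℝ} (h : HasDerivAt X X' t)
    (i : Fin n) : HasDerivAt (fun s => X s i) (X' i) t :=
  (EuclideanSpace.proj (𝕜 := ℝ) i).hasFDerivAt.comp_hasDerivAt t h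

theorem hasDerivAt_fst_snd {α : ℝ → Coord n × Coord n} {a : Coord n × Coord n} {t : ℝ}
    (h : HasDerivAt α a t) :
    HasDerivAt (fun s => (α s).1) a.1 t ∧ HasDerivAt (fun s => (α s).2) a.2 t :=
  ⟨(ContinuousLinearMap.fst ℝ (Coord n) (Coord n)).hasFDerivAt.comp_hasDerivAt t h,
    (ContinuousLinearMap.snd ℝ (Coord n) (Coord n)).hasFDerivAt.comp_hasDerivAt t h⟩

theorem coordVec_velocity_comp {c c' : ℝ → M} {φ : ℝ → ℝ} {t : ℝ}
    (hc : ContMDiffAt 𝓘(ℝ, ℝ) (𝓡 n) ∞ c (φ t)) (hφ : ContDiffAt ℝ ∞ φ t)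
    (he : ∀ᶠ s in 𝓝 t, c' s = c (φ s)) {x₀ : M} (hx : c' t ∈ (chartAt (Coord n) x₀).source) :
    coordVec x₀ (c' t) (velocity (n := n) c' t) =
      deriv φ t • coordVec x₀ (c (φ t)) (velocity (n := n) c (φ t)) := by
  have h0 : c' t = c (φ t) := he.self_of_nhds
  have hc' : ContMDiffAt 𝓘(ℝ, ℝ) (𝓡 n) ∞ c' t :=
    (hc.comp t hφ.contMDiffAt).congr_of_eventuallyEq he
  have h1 := hasDerivAt_chart_comp hc' hx
  have h2 := hasDerivAt_chart_comp hc (by rwa [← h0])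
  have h3 := h2.scomp t (hφ.differentiableAt (by simp)).hasDerivAt
  refine h1.unique (h3.congr_of_eventuallyEq ?_)
  filter_upwards [he] with s hs
  rw [hs]; rfl

/-- The second-order chain rule: a reparametrization scales the acceleration by `(φ')²` and adds a
multiple of the velocity. -/
theorem hasDerivAt_velocity_comp {c c' : ℝ → M} {φ : ℝ → ℝ} {t : ℝ}
    (hc : ∀ᶠ s in 𝓝 (φ t), ContMDiffAt 𝓘(ℝ, ℝ) (𝓡 n) ∞ c s)
    (hφ : ∀ᶠ s in 𝓝 t, ContDiffAt ℝ ∞ φ s)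
    (he : ∀ᶠ s in 𝓝 t, c' s = c (φ s)) {x₀ : M} (hx : c' t ∈ (chartAt (Coord n) x₀).source)
    {A : Coord n} (hA : HasDerivAt (fun s => coordVec x₀ (c s) (velocity c s)) A (φ t)) {b : ℝ}
    (hb : HasDerivAt (deriv φ) b t) :
    HasDerivAt (fun s => coordVec x₀ (c' s) (velocity c' s))
      (deriv φ t ^ 2 • A + b • coordVec x₀ (c (φ t)) (velocity c (φ t))) t := by
  have hφt := hφ.self_of_nhds
  have hc' : ContMDiffAt 𝓘(ℝ, ℝ) (𝓡 n) ∞ c' t :=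
    (hc.self_of_nhds.comp t hφt.contMDiffAt).congr_of_eventuallyEq he
  have hd := (hφt.differentiableAt (by simp)).hasDerivAt
  have h1 := hb.smul (hA.scomp t hd)
  have h2 := h1.congr_of_eventuallyEq (f₁ := fun s => coordVec x₀ (c' s) (velocity c' s)) ?_
  · refine h2.congr_deriv ?_
    rw [smul_smul, ← sq]; rfl
  · filter_upwards [hφt.continuousAt.eventually hc, hφ, he.eventually_nhds,
      eventually_mem_source hc' hx] with s h1 h2 h3 h4
    exact coordVec_velocity_comp h1 h2 h3 h4

/-- Existence of geodesics of a smooth affine connection. -/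
theorem exists_connectionGeodesic [T2Space M] (D : AffineConnection n M)
    (hD : D.ContMDiffCovariantDerivative ∞) {x₀ : M} {u y : Coord n}
    (hu : u ∈ (extChartAt (𝓡 n) x₀).target) (hy : y ≠ 0) :
    ∃ (J : Set ℝ) (c : ℝ → M), 0 ∈ J ∧ IsConnectionGeodesic D J c ∧
      c 0 = (extChartAt (𝓡 n) x₀).symm u ∧ coordVec x₀ (c 0) (velocity c 0) = y := by
  -- The geodesic equation as an autonomous first-order system for position and velocity.
  set V : Coord n × Coord n → Coord n × Coord n :=
    fun p => (p.2, -christoffelL D x₀ p.1 p.2 p.2) with hV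
  have hVs : ∀ p : Coord n × Coord n, p.1 ∈ (extChartAt (𝓡 n) x₀).target → ContDiffAt ℝ ∞ V p := by
    intro p hp
    have h1 : ContDiffAt ℝ ∞ (fun p : Coord n × Coord n => christoffelL D x₀ p.1) p :=
      (contDiffAt_christoffelL D hD hp).comp p contDiffAt_fst
    exact contDiffAt_snd.prodMk
      (((h1.clm_apply contDiffAt_snd).clm_apply contDiffAt_snd).neg)
  obtain ⟨α, hα0, ε, hε, hα⟩ :=
    ((hVs (u, y) hu).of_le (by simp : (1 : ℕ∞ω) ≤ ∞)).exists_forall_mem_closedBall_exists_eq_forall_mem_Ioo_hasDerivAt₀ 0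
  have hcont : ContinuousAt α 0 := (hα 0 (by constructor <;> linarith)).continuousAt
  have hev : ∀ᶠ t in 𝓝 (0 : ℝ), (α t).1 ∈ (extChartAt (𝓡 n) x₀).target ∧ (α t).2 ≠ 0 := by
    refine hcont.eventually (p := fun q : Coord n × Coord n =>
      q.1 ∈ (extChartAt (𝓡 n) x₀).target ∧ q.2 ≠ 0) ?_
    rw [hα0]
    exact ((isOpen_target x₀).prod isOpen_ne).mem_nhds ⟨hu, hy⟩
  obtain ⟨ρ, hρ, hball⟩ := Metric.eventually_nhds_iff.1 hev
  set δ := min (ε / 2) (ρ / 2) with hδ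
  have hδ0 : 0 < δ := by positivity
  have hδε : δ < ε := (min_le_left _ _).trans_lt (by linarith)
  have hδρ : δ < ρ := (min_le_right _ _).trans_lt (by linarith)
  have hI : ∀ t ∈ Icc (-δ) δ, (α t).1 ∈ (extChartAt (𝓡 n) x₀).target ∧ (α t).2 ≠ 0 := by
    intro t ht
    apply hball
    rw [dist_zero_right, Real.norm_eq_abs]
    exact (abs_le.2 ht).trans_lt hδρ
  have hαd : ∀ t ∈ Icc (-δ) δ, HasDerivAt α (V (α t)) t := fun t ht =>
    hα t ⟨by linarith [ht.1], by linarith [ht.2]⟩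
  -- The solution is as regular as the vector field. This is applied on a closed interval inside the
  -- domain of existence, and the geodesic is its restriction to the interior.
  have hsm : ContDiffOn ℝ ∞ α (Icc (-δ) δ) := by
    refine ODE.contDiffOn_enat_Icc_of_hasDerivWithinAt (f := fun _ => V) (n := ⊤)
      (u := {p | p.1 ∈ (extChartAt (𝓡 n) x₀).target}) ?_
      (fun t ht => (hαd t ht).hasDerivWithinAt) (fun t ht => (hI t ht).1)
    rintro ⟨t, p⟩ ⟨-, hp⟩
    exact ((hVs p hp).comp (t, p) contDiffAt_snd).contDiffWithinAt
  set J := Ioo (-δ) δ with hJ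
  have hJI : J ⊆ Icc (-δ) δ := Ioo_subset_Icc_self
  set γ : ℝ → Coord n := fun t => (α t).1 with hγ
  have hγs : ContDiffOn ℝ ∞ γ J := (contDiff_fst.comp_contDiffOn hsm).mono hJI
  have hγd : ∀ t ∈ J, deriv γ t = (α t).2 := fun t ht => (hasDerivAt_fst_snd (hαd t (hJI ht))).1.deriv
  have hm : ∀ t ∈ J, γ t ∈ (extChartAt (𝓡 n) x₀).target := fun t ht => (hI t (hJI ht)).1
  have h0 : (0 : ℝ) ∈ J := ⟨by linarith, hδ0⟩
  have hcs := isSmoothCurve_lift isOpen_Ioo ordConnected_Ioo hγs hm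
  have hvel : ∀ t ∈ J, coordVec x₀ _
      (velocity (n := n) (fun t => (extChartAt (𝓡 n) x₀).symm (γ t)) t) = (α t).2 :=
    fun t ht => (coordVec_velocity_lift isOpen_Ioo ordConnected_Ioo hγs hm ht).trans (hγd t ht)
  refine ⟨J, fun t => (extChartAt (𝓡 n) x₀).symm (γ t), h0, ⟨⟨hcs, ?_⟩, ?_⟩, ?_, ?_⟩
  · intro t ht h
    refine (hI t (hJI ht)).2 ?_
    rw [← hvel t ht, h, coordVec_zero]
  · intro t ht x₁ hx₁
    refine parallel_equation_change D (hcs.smoothAt ht) hx₁ (mem_chart_target (hm t ht)) ?_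
    rw [hvel t ht, ← christoffelL_apply D (hm t ht)]
    refine (hasDerivAt_fst_snd (hαd t (hJI ht))).2.congr_of_eventuallyEq ?_
    filter_upwards [isOpen_Ioo.mem_nhds ht] with s hs
    exact hvel s hs
  · simp [hγ, hα0]
  · rw [hvel 0 h0, hα0]

/-- In local coordinates, the geodesic spray of a Douglas metric is projectively equivalent to the
spray of an affine connection. -/
theorem IsDouglas.exists_sprayVec_eq [T2Space M] {F : FinslerMetric n M} (h : IsDouglas F) :
    ∃ D : AffineConnection n M, ∀ (x₀ : M), ∀ u ∈ (extChartAt (𝓡 n) x₀).target,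
      ∀ y : Coord n, y ≠ 0 → ∃ r > (0 : ℝ), ∃ μ : ℝ, sprayVec F x₀ (u, r • y) =
        christoffelL D x₀ u (r • y) (r • y) + μ • r • y := by
  -- Only one half of the definition matters: geodesics of the connection are Finsler geodesics
  -- after reparametrization, and they exist in every direction.
  obtain ⟨D, hD, -, h2⟩ := h
  refine ⟨D, fun x₀ u hu y hy => ?_⟩
  obtain ⟨J, c, h0, hgeo, hc0, hv0⟩ := exists_connectionGeodesic D hD hu hy
  obtain ⟨J', c', ⟨φ, hφ, hφ', hφJ, hcc⟩, hF⟩ := h2 J c hgeo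
  obtain ⟨t, ht, hφt⟩ : (0 : ℝ) ∈ φ '' J' := hφJ ▸ h0
  have hJ' : IsOpen J' := hF.1.1.1
  have hφs : ∀ s ∈ J', ContDiffAt ℝ ∞ φ s := fun s hs => hφ.contDiffAt (hJ'.mem_nhds hs)
  have he : ∀ᶠ s in 𝓝 t, c' s = c (φ s) := by
    filter_upwards [hJ'.mem_nhds ht] with s hs
    exact hcc s hs
  have hct : c' t = c 0 := by rw [he.self_of_nhds, hφt]
  have hx : c 0 ∈ (chartAt (Coord n) x₀).source := by rw [hc0]; exact mem_chart_target hu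
  have hx' : c' t ∈ (chartAt (Coord n) x₀).source := by rwa [hct]
  have hu0 : extChartAt (𝓡 n) x₀ (c 0) = u := by rw [hc0, extChartAt_symm_right hu]
  have hvt : coordVec x₀ (c (φ t)) (velocity c (φ t)) = y := by rw [hφt, hv0]
  have hA := hgeo.2 0 h0 x₀ hx
  rw [hv0, christoffel_eq_christoffelL D hx, hu0, ← hφt] at hA
  have hb : HasDerivAt (deriv φ) (deriv (deriv φ) t) t := by
    have h1 : ContDiffAt ℝ 1 (deriv φ) t :=
      ((hφ.deriv_of_isOpen hJ' (m := ∞) (by simp)).contDiffAt (hJ'.mem_nhds ht)).of_le (by simp)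
    exact (h1.differentiableAt one_ne_zero).hasDerivAt
  have hacc := hasDerivAt_velocity_comp (c' := c') (x₀ := x₀) (t := t)
    (by filter_upwards [hgeo.1.1.1.mem_nhds (hφt ▸ h0 : φ t ∈ J)] with s hs
        exact hgeo.1.1.smoothAt hs)
    (by filter_upwards [hJ'.mem_nhds ht] with s hs using hφs s hs) he hx' hA hb
  have hvc := coordVec_velocity_comp (hgeo.1.1.smoothAt (hφt ▸ h0 : φ t ∈ J)) (hφs t ht) he hx'
  rw [hvt] at hacc hvc
  have hspray : ∀ i, -sprayVec F x₀ (u, deriv φ t • y) i =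
      (deriv φ t ^ 2 • -christoffelL D x₀ u y y + deriv (deriv φ) t • y) i := by
    intro i
    have h3 := hF.2 t ht x₀ hx' i
    have h4 := (hasDerivAt_component hacc i).unique h3
    rw [h4, hvc, hct, hu0]
    rfl
  have hpos := hφ' t ht
  -- The Finsler geodesic passes through the point with velocity `φ' y`, so the identity is obtained
  -- at that multiple of `y` only; homogeneity removes the factor later.
  refine ⟨deriv φ t, hpos, -(deriv (deriv φ) t / deriv φ t), ?_⟩
  ext i
  have h5 := hspray i
  simp only [PiLp.add_apply, PiLp.smul_apply, PiLp.neg_apply, smul_eq_mul, map_smul, smul_apply] at h5 ⊢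
  rw [← neg_inj, h5]
  field_simp
  ring

end Geodesics

/-! ### Scaling of the fibre Hessian. -/

section Projective

variable {n : ℕ}

/-- The fibre derivative is constant on rays; differentiating this in the fibre shows the Hessian to
be homogeneous of degree -1. -/
theorem fderiv_fderiv_smul_of_homogeneous {L : Coord n × Coord n → ℝ} {u y : Coord n}
    (hom : ∀ (u z : Coord n) (r : ℝ), 0 < r → L (u, r • z) = r * L (u, z)) {r : ℝ} (hr : 0 < r)
    (hL : ContDiffAt ℝ ∞ L (u, y)) (hL' : ContDiffAt ℝ ∞ L (u, r • y)) (v w : Coord n) :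
    r * fderiv ℝ (fderiv ℝ L) (u, r • y) (0, v) (0, w) =
      fderiv ℝ (fderiv ℝ L) (u, y) (0, v) (0, w) := by
  have h1 : HasDerivAt (fun t : ℝ => y + t • v) v 0 := by
    simpa using ((hasDerivAt_id (0 : ℝ)).smul_const v).const_add y
  have hγ : HasDerivAt (fun t : ℝ => (u, y + t • v)) ((0, v) : Coord n × Coord n) 0 :=
    (hasDerivAt_const (0 : ℝ) u).prodMk h1
  have hγ' : HasDerivAt (fun t : ℝ => (u, r • (y + t • v))) ((0, r • v) : Coord n × Coord n) 0 :=
    (hasDerivAt_const (0 : ℝ) u).prodMk (h1.const_smul r)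
  have hd : HasFDerivAt (fderiv ℝ L) (fderiv ℝ (fderiv ℝ L) (u, y))
      ((fun t : ℝ => (u, y + t • v)) 0) := by
    simpa using (differentiableAt_fderiv hL).hasFDerivAt
  have hd' : HasFDerivAt (fderiv ℝ L) (fderiv ℝ (fderiv ℝ L) (u, r • y))
      ((fun t : ℝ => (u, r • (y + t • v))) 0) := by
    simpa using (differentiableAt_fderiv hL').hasFDerivAt
  have f1 := hd.comp_hasDerivAt (0 : ℝ) hγ
  have f2 := hd'.comp_hasDerivAt (0 : ℝ) hγ'
  have e1 := f1.clm_apply (hasDerivAt_const (0 : ℝ) ((0, w) : Coord n × Coord n))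
  have e2 := f2.clm_apply (hasDerivAt_const (0 : ℝ) ((0, w) : Coord n × Coord n))
  rw [map_zero, add_zero] at e1 e2
  have hc1 := hγ.continuousAt
  have hc2 := hγ'.continuousAt
  have h2 := eventually_differentiableAt hL
  have h3 := eventually_differentiableAt hL'
  have e3 := e1.unique (e2.congr_of_eventuallyEq ?_)
  · have : ((0, r • v) : Coord n × Coord n) = r • (0, v) := by simp
    rw [e3, this, map_smul, smul_apply, smul_eq_mul]
  · have h2' : ∀ᶠ t in 𝓝 (0 : ℝ), DifferentiableAt ℝ L (u, y + t • v) :=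
      hc1.eventually (by simpa using h2)
    have h3' : ∀ᶠ t in 𝓝 (0 : ℝ), DifferentiableAt ℝ L (u, r • (y + t • v)) :=
      hc2.eventually (by simpa using h3)
    filter_upwards [h2', h3'] with t ht ht'
    exact (fderiv_smul_of_homogeneous hom hr ht ht' w).symm

end Projective

/-! ### The rigidity argument on the circle and its integration to the plane. -/

section PlaneNorms

open Real

/-- The zeros of the cosine are simple, hence isolated, so continuity allows division by it. -/
theorem eq_zero_of_cos_mul {h : ℝ → ℝ} (hc : Continuous h) (h0 : ∀ θ, cos θ * h θ = 0) (θ : ℝ) :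
    h θ = 0 := by
  by_cases hθ : cos θ = 0
  · have hs : -sin θ ≠ 0 := by
      intro hs
      have := sin_sq_add_cos_sq θ
      rw [hθ, neg_eq_zero.1 hs] at this
      norm_num at this
    have h1 : ∀ᶠ z in 𝓝[≠] θ, h z = 0 := by
      filter_upwards [(hasDerivAt_cos θ).eventually_ne (c := 0) hs] with z hz
      exact (mul_eq_zero.1 (h0 z)).resolve_left hz
    have h2 : Filter.Tendsto h (𝓝[≠] θ) (𝓝 (h θ)) := hc.continuousAt.mono_left nhdsWithin_le_nhds
    exact tendsto_nhds_unique h2 ((tendsto_const_nhds).congr' (h1.mono fun z hz => hz.symm))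
  · exact (mul_eq_zero.1 (h0 θ)).resolve_left hθ

theorem exists_polar {s t : ℝ} (ht : 0 ≤ t) (h : (s, t) ≠ 0) :
    ∃ r > 0, ∃ θ ∈ Icc 0 π, s = r * cos θ ∧ t = r * sin θ := by
  have hpos : 0 < s ^ 2 + t ^ 2 := by
    rcases eq_or_ne s 0 with rfl | hs
    · have : t ≠ 0 := by rintro rfl; exact h rfl
      positivity
    · positivity
  have hr : 0 < √(s ^ 2 + t ^ 2) := sqrt_pos.2 hpos
  have hr2 := sq_sqrt hpos.le
  set r := √(s ^ 2 + t ^ 2) with hrdef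
  have hsr : |s / r| ≤ 1 := by
    rw [abs_div, abs_of_pos hr, div_le_one hr]
    exact abs_le_of_sq_le_sq (by nlinarith [sq_nonneg t]) hr.le
  have hcos : cos (arccos (s / r)) = s / r := cos_arccos (neg_le_of_abs_le hsr) (le_of_abs_le hsr)
  refine ⟨r, hr, arccos (s / r), ⟨arccos_nonneg _, arccos_le_pi _⟩, ?_, ?_⟩
  · rw [hcos]; field_simp
  · rw [sin_arccos]
    have : 1 - (s / r) ^ 2 = (t / r) ^ 2 := by
      field_simp
      linarith
    rw [this, sqrt_sq (by positivity)]
    field_simp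

/-- The rigidity of the equation `f = q W`, `f' = -sin θ W` on the circle, where `q` is a cubic
trigonometric form with the factor `cos θ`. -/
theorem circle_rigidity {W : ℝ → ℝ} (hW : ContDiff ℝ 1 W) (hpos : ∀ θ, 0 < W θ)
    (hper : W (2 * π) = W 0) {q₀ q₁ q₂ : ℝ}
    (hf : ∀ θ, HasDerivAt (fun θ => cos θ * (q₀ * cos θ ^ 2 + q₁ * cos θ * sin θ + q₂ * sin θ ^ 2)
      * W θ) (-sin θ * W θ) θ) :
    0 < q₀ ∧ ∃ k > 0, ∀ θ, cos θ * (q₀ * cos θ ^ 2 + q₁ * cos θ * sin θ + q₂ * sin θ ^ 2) * W θ =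
      k * cos θ / √(q₀ * cos θ ^ 2 + sin θ ^ 2) := by
  set R : ℝ → ℝ := fun θ => q₀ * cos θ ^ 2 + q₁ * cos θ * sin θ + q₂ * sin θ ^ 2 with hR
  set R' : ℝ → ℝ := fun θ => 2 * (q₂ - q₀) * sin θ * cos θ + q₁ * (cos θ ^ 2 - sin θ ^ 2) with hR'
  have hRd : ∀ θ, HasDerivAt R (R' θ) θ := by
    intro θ
    have h := ((((hasDerivAt_cos θ).pow 2).const_mul q₀).add
      (((hasDerivAt_cos θ).const_mul q₁).mul (hasDerivAt_sin θ))).add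
      (((hasDerivAt_sin θ).pow 2).const_mul q₂)
    refine h.congr_deriv ?_
    simp only [hR']
    ring
  have hWd : ∀ θ, HasDerivAt W (deriv W θ) θ := fun θ =>
    (hW.differentiable one_ne_zero θ).hasDerivAt
  have hW'c : Continuous (deriv W) := hW.continuous_deriv le_rfl
  have hRc : Continuous R := by fun_prop
  have hR'c : Continuous R' := by fun_prop
  have key : ∀ θ, (-sin θ * R θ + cos θ * R' θ) * W θ + cos θ * R θ * deriv W θ =
      -sin θ * W θ := fun θ =>
    (((hasDerivAt_cos θ).mul (hRd θ)).mul (hWd θ)).unique (hf θ)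
  -- At `π / 2` the cosine vanishes and the equation reduces to `q₂ W = W`.
  have hq2 : q₂ = 1 := by
    have h := key (π / 2)
    simp only [hR, cos_pi_div_two, sin_pi_div_two] at h
    have := hpos (π / 2)
    have h2 : (q₂ - 1) * W (π / 2) = 0 := by linarith
    have := (mul_eq_zero.1 h2).resolve_right this.ne'
    linarith
  -- On `(0, π)` the derivative `-sin θ W` is negative, and the function vanishes at `π / 2`. So it
  -- has the sign of the cosine, which makes its factor `R` positive.
  have hanti : StrictAntiOn (fun θ => cos θ * R θ * W θ) (Icc 0 π) := by
    refine strictAntiOn_of_deriv_neg (convex_Icc 0 π)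
      (fun θ _ => (hf θ).continuousAt.continuousWithinAt) fun θ hθ => ?_
    rw [interior_Icc] at hθ
    rw [(hf θ).deriv]
    nlinarith [mul_pos (sin_pos_of_pos_of_lt_pi hθ.1 hθ.2) (hpos θ)]
  have hhalf : π / 2 ∈ Icc 0 π := ⟨by positivity, by linarith [pi_pos]⟩
  have hRpos0 : ∀ θ ∈ Icc 0 π, 0 < R θ := by
    intro θ hθ
    rcases lt_trichotomy θ (π / 2) with h | h | h
    · have h1 := hanti hθ hhalf h
      simp only [cos_pi_div_two, zero_mul] at h1
      have hc : 0 < cos θ := cos_pos_of_mem_Ioo ⟨by linarith [hθ.1, pi_pos], h⟩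
      have h2 : 0 < cos θ * R θ := pos_of_mul_pos_left h1 (hpos θ).le
      exact pos_of_mul_pos_right h2 hc.le
    · rw [h]
      simp [hR, hq2]
    · have h1 := hanti hhalf hθ h
      simp only [cos_pi_div_two, zero_mul] at h1
      have hc : cos θ < 0 := cos_neg_of_pi_div_two_lt_of_lt h (by linarith [hθ.2, pi_pos])
      have h2 : cos θ * R θ < 0 := neg_of_mul_neg_left h1 (hpos θ).le
      exact pos_of_mul_neg_right h2 hc.le
  -- `R` is a quadratic form, hence even, and positivity on the closed upper half circle implies it
  -- everywhere.
  have hRpos : ∀ θ, 0 < R θ := by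
    intro θ
    have hne : ∀ a b : ℝ, a ^ 2 + b ^ 2 = 1 → (a, b) ≠ 0 := by
      intro a b hab h
      rw [Prod.mk_eq_zero] at h
      rw [h.1, h.2] at hab
      norm_num at hab
    rcases le_total 0 (sin θ) with h | h
    · obtain ⟨r, hr, φ, hφ, h1, h2⟩ := exists_polar h (hne (cos θ) (sin θ) (cos_sq_add_sin_sq θ))
      have : R θ = r ^ 2 * R φ := by simp only [hR]; rw [h1, h2]; ring
      rw [this]
      exact mul_pos (by positivity) (hRpos0 φ hφ)
    · obtain ⟨r, hr, φ, hφ, h1, h2⟩ := exists_polar (s := -cos θ) (neg_nonneg.2 h)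
        (hne (-cos θ) (-sin θ) (by rw [neg_sq, neg_sq]; exact cos_sq_add_sin_sq θ))
      have : R θ = r ^ 2 * R φ := by
        simp only [hR]
        rw [neg_eq_iff_eq_neg.1 h1, neg_eq_iff_eq_neg.1 h2]; ring
      rw [this]
      exact mul_pos (by positivity) (hRpos0 φ hφ)
  have hq0 : 0 < q₀ := by
    have := hRpos 0
    simpa [hR] using this
  -- Since `q₂ = 1`, the difference `R - 1` is divisible by `cos θ`; moving the right side of `key`
  -- to the left allows division of the whole equation by `cos θ`.
  have hlog : ∀ θ, R' θ * W θ + R θ * deriv W θ -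
      sin θ * ((q₀ - 1) * cos θ + q₁ * sin θ) * W θ = 0 := by
    refine eq_zero_of_cos_mul (by fun_prop) fun θ => ?_
    have h1 := key θ
    have h2 : R θ - 1 = cos θ * ((q₀ - 1) * cos θ + q₁ * sin θ) := by
      have := sin_sq_add_cos_sq θ
      simp only [hR, hq2]
      linear_combination this
    linear_combination h1 + sin θ * W θ * h2
  -- An integrating factor: the equation for `W' / W` becomes `G' = q₁ R² W²`, whose sign is that of
  -- the constant `q₁`.
  set G : ℝ → ℝ := fun θ => R θ ^ 3 * W θ ^ 2 with hG
  have hGd : ∀ θ, HasDerivAt G (q₁ * (R θ ^ 2 * W θ ^ 2)) θ := by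
    intro θ
    refine (((hRd θ).pow 3).mul ((hWd θ).pow 2)).congr_deriv ?_
    have h1 := hlog θ
    have h2 : R' θ + 2 * sin θ * ((q₀ - 1) * cos θ + q₁ * sin θ) = q₁ := by
      have := sin_sq_add_cos_sq θ
      simp only [hR', hq2]
      linear_combination q₁ * this
    push_cast
    simp only [Pi.pow_apply]
    linear_combination 2 * R θ ^ 2 * W θ * h1 + R θ ^ 2 * W θ ^ 2 * h2
  have hGper : G (2 * π) = G 0 := by simp [hG, hR, hper]
  -- A nonzero `q₁` would make `G` strictly monotone, contradicting periodicity. Then `G` is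
  -- constant, and `R W` is a constant over `√R`.
  have hq1 : q₁ = 0 := by
    have hRW : ∀ θ, 0 < R θ ^ 2 * W θ ^ 2 := fun θ => by
      have := hRpos θ; have := hpos θ; positivity
    have h2π : (0 : ℝ) < 2 * π := by positivity
    rcases lt_trichotomy q₁ 0 with h | h | h
    · have : StrictAnti G := strictAnti_of_deriv_neg fun θ => by
        rw [(hGd θ).deriv]; exact mul_neg_of_neg_of_pos h (hRW θ)
      exact absurd hGper (this h2π).ne
    · exact h
    · have : StrictMono G := strictMono_of_deriv_pos fun θ => by
        rw [(hGd θ).deriv]; exact mul_pos h (hRW θ)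
      exact absurd hGper (this h2π).ne'
  have hGconst : ∀ θ, G θ = G 0 := fun θ =>
    is_const_of_deriv_eq_zero (fun z => (hGd z).differentiableAt)
      (fun z => by rw [(hGd z).deriv, hq1, zero_mul]) θ 0
  have hG0 : 0 < G 0 := by
    have := hRpos 0; have := hpos 0
    simp only [hG]; positivity
  refine ⟨hq0, √(G 0), sqrt_pos.2 hG0, fun θ => ?_⟩
  have hReq : q₀ * cos θ ^ 2 + sin θ ^ 2 = R θ := by simp only [hR, hq1, hq2]; ring
  have hRW : R θ * W θ = √(G 0) / √(R θ) := by
    have := (hRpos θ).ne'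
    rw [← hGconst θ, ← sqrt_div' _ (hRpos θ).le,
      show G θ / R θ = (R θ * W θ) ^ 2 by simp only [hG]; field_simp,
      sqrt_sq (mul_pos (hRpos θ) (hpos θ)).le]
  rw [hReq]
  change cos θ * R θ * W θ = _
  rw [mul_assoc, hRW]
  ring

/-- A positively homogeneous function on the plane with the partial derivative
`k s / √(a s² + t²)` in the direction of `s`. -/
theorem randers_of_partial {N f : ℝ × ℝ → ℝ} {a k : ℝ} (ha : 0 < a)
    (hom : ∀ (p : ℝ × ℝ) (r : ℝ), 0 < r → N (r • p) = r * N p) (h0 : N 0 = 0)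
    (hd : ∀ p ≠ 0, HasDerivAt (fun s => N (s, p.2)) (f p) p.1)
    (hf : ∀ p : ℝ × ℝ, p.2 ≠ 0 → f p = k * p.1 / √(a * p.1 ^ 2 + p.2 ^ 2))
    (hN : DifferentiableAt ℝ (fun t => N (1, t)) 0) (hN' : ContinuousAt (fun t => N (-1, t)) 0) :
    ∃ c, ∀ p, N p = k / a * √(a * p.1 ^ 2 + p.2 ^ 2) + c * p.2 := by
  set Q : ℝ × ℝ → ℝ := fun p => √(a * p.1 ^ 2 + p.2 ^ 2) with hQ
  -- The difference from the expected Euclidean part; it has to be shown linear in the second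
  -- coordinate.
  set H : ℝ × ℝ → ℝ := fun p => N p - k / a * Q p with hH
  have hQhom : ∀ (p : ℝ × ℝ) (r : ℝ), 0 < r → Q (r • p) = r * Q p := by
    intro p r hr
    simp only [hQ, Prod.smul_fst, Prod.smul_snd, smul_eq_mul]
    rw [show a * (r * p.1) ^ 2 + (r * p.2) ^ 2 = r ^ 2 * (a * p.1 ^ 2 + p.2 ^ 2) by ring,
      sqrt_mul (sq_nonneg r), sqrt_sq hr.le]
  have hHhom : ∀ (p : ℝ × ℝ) (r : ℝ), 0 < r → H (r • p) = r * H p := by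
    intro p r hr
    simp only [hH, hom p r hr, hQhom p r hr]
    ring
  have hQd : ∀ s t : ℝ, t ≠ 0 → HasDerivAt (fun s => Q (s, t)) (a * s / Q (s, t)) s := by
    intro s t ht
    have hpos : 0 < a * s ^ 2 + t ^ 2 := by positivity
    have h1 : HasDerivAt (fun s : ℝ => a * s ^ 2 + t ^ 2) (2 * a * s) s := by
      refine ((((hasDerivAt_id s).pow 2).const_mul a).add_const (t ^ 2)).congr_deriv ?_
      simp; ring
    refine (h1.sqrt hpos.ne').congr_deriv ?_
    simp only [hQ]
    field_simp
  -- Off the axis `t = 0` the partial derivatives in `s` cancel, so `H` depends on `t` alone and is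
  -- linear on each open half-plane by homogeneity.
  have hHs : ∀ s t : ℝ, t ≠ 0 → H (s, t) = H (0, t) := by
    intro s t ht
    have hd' : ∀ s, HasDerivAt (fun s => H (s, t)) 0 s := by
      intro s
      have h1 := (hd (s, t) (by simp [ht])).sub ((hQd s t ht).const_mul (k / a))
      refine h1.congr_deriv ?_
      rw [hf (s, t) ht]
      have : 0 < Q (s, t) := sqrt_pos.2 (by positivity)
      simp only [hQ] at this ⊢
      field_simp
      ring
    exact is_const_of_deriv_eq_zero (fun z => (hd' z).differentiableAt) (fun z => (hd' z).deriv) s 0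
  have hHp : ∀ s t : ℝ, 0 < t → H (s, t) = t * H (0, 1) := by
    intro s t ht
    rw [hHs s t ht.ne', ← hHhom (0, 1) t ht]
    simp
  have hHn : ∀ s t : ℝ, t < 0 → H (s, t) = -t * H (0, -1) := by
    intro s t ht
    rw [hHs s t ht.ne, ← hHhom (0, -1) (-t) (neg_pos.2 ht)]
    simp
  have hQc : ∀ s : ℝ, Continuous (fun t => Q (s, t)) := fun s => by fun_prop
  have hzero : ∀ s : ℝ, ContinuousAt (fun t => N (s, t)) 0 → H (s, 0) = 0 := by
    intro s hs
    have h1 : ContinuousAt (fun t => H (s, t)) 0 :=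
      hs.sub (continuousAt_const.mul (hQc s).continuousAt)
    have h2 : Filter.Tendsto (fun t => H (s, t)) (𝓝[>] 0) (𝓝 (H (s, 0))) :=
      h1.tendsto.mono_left nhdsWithin_le_nhds
    have h3 : Filter.Tendsto (fun t : ℝ => t * H (0, 1)) (𝓝[>] 0) (𝓝 (0 * H (0, 1))) :=
      (by fun_prop : Continuous fun t : ℝ => t * H (0, 1)).continuousAt.tendsto.mono_left
        nhdsWithin_le_nhds
    rw [zero_mul] at h3
    refine tendsto_nhds_unique h2 (h3.congr' ?_)
    filter_upwards [self_mem_nhdsWithin] with t ht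
    exact (hHp s t ht).symm
  have hH1 : H (1, 0) = 0 := hzero 1 hN.continuousAt
  have hHm1 : H (-1, 0) = 0 := hzero (-1) hN'
  have hHdiff : DifferentiableAt ℝ (fun t => H (1, t)) 0 := by
    have : DifferentiableAt ℝ (fun t : ℝ => Q (1, t)) 0 := by
      have h1 : DifferentiableAt ℝ (fun t : ℝ => a * 1 ^ 2 + t ^ 2) 0 := by fun_prop
      exact h1.sqrt (by simp [ha.ne'])
    exact hN.sub (this.const_mul _)
  -- The two half-planes could carry different slopes; differentiability across the axis at `(1, 0)`
  -- identifies the one-sided derivatives.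
  have hsym : H (0, -1) = -H (0, 1) := by
    have hd := hHdiff.hasDerivAt
    set m := deriv (fun t => H (1, t)) 0
    have e1 : HasDerivWithinAt (fun t => H (1, t)) (H (0, 1)) (Ici 0) 0 := by
      have : HasDerivAt (fun t : ℝ => t * H (0, 1)) (H (0, 1)) 0 := by
        simpa using (hasDerivAt_id (0 : ℝ)).mul_const (H (0, 1))
      refine this.hasDerivWithinAt.congr (fun t ht => ?_) (by simp [hH1])
      rcases eq_or_lt_of_le (mem_Ici.1 ht) with h | h
      · rw [← h, hH1, zero_mul]
      · exact hHp 1 t h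
    have e2 : HasDerivWithinAt (fun t => H (1, t)) (-H (0, -1)) (Iic 0) 0 := by
      have : HasDerivAt (fun t : ℝ => -t * H (0, -1)) (-H (0, -1)) 0 := by
        simpa using (hasDerivAt_id (0 : ℝ)).neg.mul_const (H (0, -1))
      refine this.hasDerivWithinAt.congr (fun t ht => ?_) (by simp [hH1])
      rcases eq_or_lt_of_le (mem_Iic.1 ht) with h | h
      · rw [h, hH1]; simp
      · exact hHn 1 t h
    have h1 := (uniqueDiffWithinAt_Ici (0 : ℝ)).eq_deriv _ e1 hd.hasDerivWithinAt
    have h2 := (uniqueDiffWithinAt_Iic (0 : ℝ)).eq_deriv _ e2 hd.hasDerivWithinAt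
    linarith
  refine ⟨H (0, 1), fun p => ?_⟩
  have hfin : H p = H (0, 1) * p.2 := by
    obtain ⟨s, t⟩ := p
    rcases lt_trichotomy t 0 with h | h | h
    · rw [hHn s t h, hsym]; ring
    · subst h
      simp only [mul_zero]
      rcases lt_trichotomy s 0 with h | h | h
      · have := hHhom (-1, 0) (-s) (neg_pos.2 h)
        simpa [hHm1] using this
      · subst h
        have : N (0, 0) = 0 := h0
        simp [hH, hQ, this]
      · have := hHhom (1, 0) s h
        simpa [hH1] using this
    · rw [hHp s t h]; ring
  rw [← hfin]
  simp only [hH]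
  ring

end PlaneNorms

/-! ### From the Hessian equation to a Randers norm in the plane. -/

section Planar

open Real

theorem fderiv_comp_affine {V W : Type*} [NormedAddCommGroup V] [NormedSpace ℝ V]
    [NormedAddCommGroup W] [NormedSpace ℝ W] {L : W → ℝ} {c : W} (A : V →L[ℝ] W) {p : V}
    (hL : DifferentiableAt ℝ L (c + A p)) :
    fderiv ℝ (fun q => L (c + A q)) p = (fderiv ℝ L (c + A p)).comp A :=
  (hL.hasFDerivAt.comp p (A.hasFDerivAt.const_add c)).fderiv

theorem fderiv_fderiv_comp_affine {V W : Type*} [NormedAddCommGroup V] [NormedSpace ℝ V]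
    [NormedAddCommGroup W] [NormedSpace ℝ W] {L : W → ℝ} {c : W} (A : V →L[ℝ] W) {p : V}
    (hL : ContDiffAt ℝ 2 L (c + A p)) (v w : V) :
    fderiv ℝ (fderiv ℝ fun q => L (c + A q)) p v w =
      fderiv ℝ (fderiv ℝ L) (c + A p) (A v) (A w) := by
  have hc : ContinuousAt (fun q => c + A q) p := by fun_prop
  have h1 : (fderiv ℝ fun q => L (c + A q)) =ᶠ[𝓝 p] fun q => (fderiv ℝ L (c + A q)).comp A := by
    have h2 : ∀ᶠ z in 𝓝 (c + A p), DifferentiableAt ℝ L z :=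
      (hL.eventually (by simp)).mono fun z hz => hz.differentiableAt (by simp)
    filter_upwards [hc.eventually h2] with q hq using fderiv_comp_affine A hq
  rw [h1.fderiv_eq]
  have h3 : DifferentiableAt ℝ (fderiv ℝ L) (c + A p) :=
    (hL.fderiv_right (m := 1) (by norm_num)).differentiableAt one_ne_zero
  have h4 : HasFDerivAt (fun q => fderiv ℝ L (c + A q)) ((fderiv ℝ (fderiv ℝ L) (c + A p)).comp A) p :=
    h3.hasFDerivAt.comp p (A.hasFDerivAt.const_add c)
  have h5 := (((ContinuousLinearMap.compL ℝ V W ℝ).flip A).hasFDerivAt.comp p h4).fderiv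
  change (fderiv ℝ ((ContinuousLinearMap.compL ℝ V W ℝ).flip A ∘ fun q => fderiv ℝ L (c + A q)) p) v w = _
  rw [h5]
  rfl

/-- Rigidity of planar Minkowski norms whose second derivative in a quadratic direction is a
multiple of a first derivative. -/
theorem randers_of_hessian {N : ℝ × ℝ → ℝ} (hN : ∀ p ≠ 0, ContDiffAt ℝ ∞ N p)
    (hom : ∀ (p : ℝ × ℝ) (r : ℝ), 0 < r → N (r • p) = r * N p) (h0 : N 0 = 0)
    (hess : ∀ p : ℝ × ℝ, p ≠ 0 → ∀ v : ℝ × ℝ, p.1 * v.2 - p.2 * v.1 ≠ 0 →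
      0 < fderiv ℝ (fderiv ℝ N) p v v)
    {c a₀ a₁ a₂ b₀ b₁ b₂ : ℝ} (hc : c ≠ 0)
    (hB : ∀ p : ℝ × ℝ, p ≠ 0 → ∀ w : ℝ × ℝ, fderiv ℝ (fderiv ℝ N) p
      (a₀ * p.1 ^ 2 + a₁ * (p.1 * p.2) + a₂ * p.2 ^ 2,
        b₀ * p.1 ^ 2 + b₁ * (p.1 * p.2) + b₂ * p.2 ^ 2) w =
      (p.1 * w.2 - p.2 * w.1) * (c * fderiv ℝ N p (1, 0)))
    (h01 : fderiv ℝ N (0, 1) (1, 0) = 0) :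
    ∃ a > 0, ∃ k > 0, ∃ d, ∀ p, N p = k / a * √(a * p.1 ^ 2 + p.2 ^ 2) + d * p.2 := by
  have hdN : ∀ p ≠ 0, DifferentiableAt ℝ N p := fun p hp => (hN p hp).differentiableAt (by simp)
  have hd2N : ∀ p ≠ 0, DifferentiableAt ℝ (fderiv ℝ N) p := fun p hp =>
    ((hN p hp).fderiv_right (m := 1) (by norm_cast)).differentiableAt one_ne_zero
  -- homogeneity
  have hfom : ∀ p ≠ 0, ∀ r : ℝ, 0 < r → fderiv ℝ N (r • p) = fderiv ℝ N p := by
    intro p hp r hr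
    have h1 : (fun q => N (r • q)) = fun q => r • N q := by
      funext q; rw [hom q r hr, smul_eq_mul]
    have h2 : fderiv ℝ (fun q => N (r • q)) p = r • fderiv ℝ N (r • p) := by
      have := ((hdN (r • p) (smul_ne_zero hr.ne' hp)).hasFDerivAt.comp p
        ((hasFDerivAt_id p).const_smul r)).fderiv
      refine this.trans ?_
      ext <;> simp
    rw [h1, show (fun q => r • N q) = r • N from rfl, fderiv_const_smul (hdN p hp)] at h2
    exact (smul_right_injective _ hr.ne' h2).symm
  have hrad : ∀ p ≠ 0, ∀ w, fderiv ℝ (fderiv ℝ N) p p w = 0 := by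
    intro p hp w
    have h1 : HasDerivAt (fun r : ℝ => r • p) p 1 := by
      simpa using (hasDerivAt_id (1 : ℝ)).smul_const p
    have h2 : HasDerivAt (fun r : ℝ => fderiv ℝ N (r • p)) (fderiv ℝ (fderiv ℝ N) p p) 1 := by
      have := hd2N p hp
      rw [← one_smul ℝ p] at this
      have h3 := this.hasFDerivAt.comp_hasDerivAt (1 : ℝ) h1
      rwa [one_smul] at h3
    have h3 : (fun r : ℝ => fderiv ℝ N (r • p)) =ᶠ[𝓝 1] fun _ => fderiv ℝ N p := by
      filter_upwards [lt_mem_nhds (show (0 : ℝ) < 1 by norm_num)] with r hr using hfom p hp r hr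
    rw [h2.unique ((hasDerivAt_const _ _).congr_of_eventuallyEq h3)]
    rfl
  have hsymm : ∀ p ≠ 0, ∀ v w, fderiv ℝ (fderiv ℝ N) p v w = fderiv ℝ (fderiv ℝ N) p w v :=
    fun p hp v w => ((hN p hp).isSymmSndFDerivAt (by simp; norm_cast)) v w
  set D2 : ℝ × ℝ → ℝ × ℝ → ℝ × ℝ → ℝ := fun p v w => fderiv ℝ (fderiv ℝ N) p v w with hD2
  -- The Hessian annihilates `p`, so in the plane it is a multiple `W` of the square of `det(p, ·)`;
  -- taking traces determines `W`.
  obtain ⟨W, hWdef⟩ : ∃ W : ℝ × ℝ → ℝ, W = fun p =>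
    (D2 p (1, 0) (1, 0) + D2 p (0, 1) (0, 1)) / (p.1 ^ 2 + p.2 ^ 2) := ⟨_, rfl⟩
  have hnorm : ∀ p : ℝ × ℝ, p ≠ 0 → 0 < p.1 ^ 2 + p.2 ^ 2 := by
    intro p hp
    by_contra h
    have h1 : p.1 = 0 := by nlinarith [sq_nonneg p.1, sq_nonneg p.2]
    have h2 : p.2 = 0 := by nlinarith [sq_nonneg p.1, sq_nonneg p.2]
    exact hp (Prod.ext h1 h2)
  have hexp : ∀ p v w : ℝ × ℝ, D2 p v w = v.1 * w.1 * D2 p (1, 0) (1, 0) +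
      v.1 * w.2 * D2 p (1, 0) (0, 1) + v.2 * w.1 * D2 p (0, 1) (1, 0) +
      v.2 * w.2 * D2 p (0, 1) (0, 1) := by
    intro p v w
    have hv : v = v.1 • ((1 : ℝ), (0 : ℝ)) + v.2 • ((0 : ℝ), (1 : ℝ)) := by ext <;> simp
    have hw : w = w.1 • ((1 : ℝ), (0 : ℝ)) + w.2 • ((0 : ℝ), (1 : ℝ)) := by ext <;> simp
    calc D2 p v w = D2 p (v.1 • ((1 : ℝ), (0 : ℝ)) + v.2 • ((0 : ℝ), (1 : ℝ)))
          (w.1 • ((1 : ℝ), (0 : ℝ)) + w.2 • ((0 : ℝ), (1 : ℝ))) := by rw [← hv, ← hw]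
      _ = _ := by
        simp only [hD2, map_add, map_smul, add_apply, smul_apply, smul_eq_mul]
        ring
  have hW : ∀ p ≠ 0, D2 p (1, 0) (1, 0) = W p * p.2 ^ 2 ∧ D2 p (1, 0) (0, 1) = -W p * (p.1 * p.2) ∧
      D2 p (0, 1) (1, 0) = -W p * (p.1 * p.2) ∧ D2 p (0, 1) (0, 1) = W p * p.1 ^ 2 := by
    intro p hp
    have e1 := hrad p hp (1, 0)
    have e2 := hrad p hp (0, 1)
    change D2 p p _ = 0 at e1 e2
    rw [hexp] at e1 e2
    have e3 : D2 p (1, 0) (0, 1) = D2 p (0, 1) (1, 0) := hsymm p hp _ _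
    have hp' := (hnorm p hp).ne'
    have e4 : W p * (p.1 ^ 2 + p.2 ^ 2) = D2 p (1, 0) (1, 0) + D2 p (0, 1) (0, 1) := by
      simp only [hWdef]; field_simp
    simp only [mul_one, mul_zero, zero_mul, add_zero, zero_add] at e1 e2
    rw [← e3] at e1 ⊢
    have e5 : D2 p (1, 0) (0, 1) = -W p * (p.1 * p.2) := by
      apply mul_right_cancel₀ hp'
      linear_combination p.2 * e1 + p.1 * e2 + p.1 * p.2 * e4
    refine ⟨?_, e5, e5, ?_⟩ <;> apply mul_right_cancel₀ hp'
    · linear_combination p.1 * e1 - p.2 * e2 + p.2 ^ 2 * (-e4)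
    · linear_combination p.2 * e2 - p.1 * e1 + p.1 ^ 2 * (-e4)
  have hWpos : ∀ p ≠ 0, 0 < W p := by
    intro p hp
    have h1 := hess p hp (-p.2, p.1) (by have := (hnorm p hp).ne'; ring_nf at this ⊢; exact this)
    change 0 < D2 p _ _ at h1
    obtain ⟨e1, e2, e3, e4⟩ := hW p hp
    rw [hexp, e1, e2, e3, e4] at h1
    have h2 : 0 < W p * (p.1 ^ 2 + p.2 ^ 2) ^ 2 := by
      refine h1.trans_eq ?_
      ring
    exact pos_of_mul_pos_left h2 (by positivity)
  -- Evaluating `hB` on `p` rotated by a right angle expresses the first derivative as `W` times a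
  -- cubic form, the determinant of `p` with the quadratic vector.
  have hNs : ∀ p ≠ 0, fderiv ℝ N p (1, 0) = W p * ((p.1 * (b₀ * p.1 ^ 2 + b₁ * (p.1 * p.2) +
      b₂ * p.2 ^ 2) - p.2 * (a₀ * p.1 ^ 2 + a₁ * (p.1 * p.2) + a₂ * p.2 ^ 2)) / c) := by
    intro p hp
    have h1 := hB p hp (-p.2, p.1)
    change D2 p _ _ = _ at h1
    obtain ⟨e1, e2, e3, e4⟩ := hW p hp
    rw [hexp, e1, e2, e3, e4] at h1
    have hp' := (hnorm p hp).ne'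
    apply mul_left_cancel₀ (mul_ne_zero hp' hc)
    simp only at h1
    rw [show ∀ A B : ℝ, (p.1 ^ 2 + p.2 ^ 2) * c * (A * (B / c)) = (p.1 ^ 2 + p.2 ^ 2) * (A * B) from
      fun A B => by field_simp]
    linear_combination -h1
  have hcirc : ∀ θ : ℝ, ((cos θ, sin θ) : ℝ × ℝ) ≠ 0 := by
    intro θ h
    rw [Prod.mk_eq_zero] at h
    have := cos_sq_add_sin_sq θ
    rw [h.1, h.2] at this
    norm_num at this
  -- The derivative vanishes at `(0, 1)` while `W` does not, so the cubic form has no `t³` term and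
  -- is divisible by `s`. This is the factor `cos θ` in the circle equation.
  have ha₂ : a₂ = 0 := by
    have h1 := hNs (0, 1) (by simp)
    rw [h01] at h1
    have h2 := (hWpos (0, 1) (by simp)).ne'
    simp only [ne_eq, OfNat.ofNat_ne_zero, not_false_eq_true, zero_pow, mul_zero, zero_mul,
      one_pow, mul_one, zero_add, zero_sub, one_mul] at h1
    have h3 := (mul_eq_zero.1 h1.symm).resolve_left h2
    rw [div_eq_zero_iff] at h3
    simpa using h3.resolve_right hc
  have hcs : ContDiff ℝ ∞ fun θ : ℝ => ((cos θ, sin θ) : ℝ × ℝ) := by fun_prop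
  have hWsm : ContDiff ℝ 1 fun θ : ℝ => W (cos θ, sin θ) := by
    rw [contDiff_iff_contDiffAt]
    intro θ
    have h1 : ContDiffAt ℝ 1 (fderiv ℝ (fderiv ℝ N)) (cos θ, sin θ) :=
      ((hN _ (hcirc θ)).fderiv_right (m := 2) (by norm_cast)).fderiv_right (m := 1) (by norm_num)
    have h2 : ContDiffAt ℝ 1 (fun θ => fderiv ℝ (fderiv ℝ N) (cos θ, sin θ)) θ :=
      h1.comp θ (hcs.contDiffAt.of_le (by simp))
    have h3 : (fun θ : ℝ => W (cos θ, sin θ)) = fun θ =>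
        fderiv ℝ (fderiv ℝ N) (cos θ, sin θ) (1, 0) (1, 0) +
        fderiv ℝ (fderiv ℝ N) (cos θ, sin θ) (0, 1) (0, 1) := by
      funext θ
      simp [hWdef, hD2]
    rw [h3]
    exact ((h2.clm_apply contDiffAt_const).clm_apply contDiffAt_const).add
      ((h2.clm_apply contDiffAt_const).clm_apply contDiffAt_const)
  have hf0 : ∀ θ, fderiv ℝ N (cos θ, sin θ) (1, 0) =
      cos θ * (b₀ / c * cos θ ^ 2 + (b₁ - a₀) / c * (cos θ * sin θ) + (b₂ - a₁) / c * sin θ ^ 2) *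
        W (cos θ, sin θ) := by
    intro θ
    rw [hNs _ (hcirc θ), ha₂]
    field_simp
    ring
  -- Along the circle the derivative is the Hessian on the unit tangent and `(1, 0)`, whose
  -- determinants with `p` are 1 and `-sin θ`.
  have hf : ∀ θ, HasDerivAt (fun θ => fderiv ℝ N (cos θ, sin θ) (1, 0))
      (-sin θ * W (cos θ, sin θ)) θ := by
    intro θ
    have h1 : HasDerivAt (fun θ : ℝ => ((cos θ, sin θ) : ℝ × ℝ)) (-sin θ, cos θ) θ :=
      (hasDerivAt_cos θ).prodMk (hasDerivAt_sin θ)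
    have h2 := (hd2N _ (hcirc θ)).hasFDerivAt.comp_hasDerivAt θ h1
    have h3 := h2.clm_apply (hasDerivAt_const θ ((1 : ℝ), (0 : ℝ)))
    refine h3.congr_deriv ?_
    have h4 : fderiv ℝ (fderiv ℝ N) (cos θ, sin θ) (-sin θ, cos θ) (1, 0) =
      -sin θ * W (cos θ, sin θ) := by
      change D2 _ _ _ = _
      obtain ⟨e1, e2, e3, e4⟩ := hW _ (hcirc θ)
      rw [hexp, e1, e2, e3, e4]
      have := sin_sq_add_cos_sq θ
      simp only
      linear_combination -sin θ * W (cos θ, sin θ) * this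
    rw [h4, map_zero, add_zero]
  obtain ⟨hq0, k, hk, hfk⟩ := circle_rigidity (q₀ := b₀ / c) (q₁ := (b₁ - a₀) / c)
    (q₂ := (b₂ - a₁) / c) hWsm (fun θ => hWpos _ (hcirc θ)) (by simp)
    (fun θ => by simpa only [hf0, ← mul_assoc] using hf θ)
  -- The derivative is homogeneous of degree 0, so its values on the circle determine it.
  have hf' : ∀ p : ℝ × ℝ, p ≠ 0 →
      fderiv ℝ N p (1, 0) = k * p.1 / √(b₀ / c * p.1 ^ 2 + p.2 ^ 2) := by
    intro p hp
    obtain ⟨r, hr, θ, h1, h2⟩ : ∃ r > 0, ∃ θ, p.1 = r * cos θ ∧ p.2 = r * sin θ := by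
      rcases le_total 0 p.2 with h | h
      · obtain ⟨r, hr, θ, -, h1, h2⟩ := exists_polar h hp
        exact ⟨r, hr, θ, h1, h2⟩
      · obtain ⟨r, hr, θ, -, h1, h2⟩ := exists_polar (s := -p.1) (neg_nonneg.2 h)
          (fun h' => hp (neg_eq_zero.1 h'))
        exact ⟨r, hr, θ + π, by rw [cos_add_pi]; linarith, by rw [sin_add_pi]; linarith⟩
    have h3 : p = r • (cos θ, sin θ) := Prod.ext h1 h2
    rw [h3, hfom _ (hcirc θ) r hr, hf0, ← mul_assoc (_ / _) (cos θ), hfk]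
    simp only [Prod.smul_mk, smul_eq_mul]
    rw [show b₀ / c * (r * cos θ) ^ 2 + (r * sin θ) ^ 2 =
      r ^ 2 * (b₀ / c * cos θ ^ 2 + sin θ ^ 2) by ring, sqrt_mul (sq_nonneg r), sqrt_sq hr.le]
    have : √(b₀ / c * cos θ ^ 2 + sin θ ^ 2) ≠ 0 := by
      rw [Real.sqrt_ne_zero']
      by_contra h
      have e1 : cos θ = 0 := by
        by_contra h1
        have : 0 < cos θ ^ 2 := by positivity
        nlinarith [sq_nonneg (sin θ), mul_pos hq0 this]
      have e2 := cos_sq_add_sin_sq θ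
      rw [e1] at e2 h
      nlinarith
    field_simp
  refine ⟨b₀ / c, hq0, k, hk, randers_of_partial (f := fun p => fderiv ℝ N p (1, 0)) hq0 hom h0
    (fun p hp => ?_) (fun p hp => hf' p fun h => hp (by rw [h]; rfl)) ?_ ?_⟩
  · have h1 : HasDerivAt (fun s : ℝ => ((s, p.2) : ℝ × ℝ)) (1, 0) p.1 :=
      (hasDerivAt_id p.1).prodMk (hasDerivAt_const _ _)
    exact (hdN p hp).hasFDerivAt.comp_hasDerivAt p.1 h1
  · have h1 : DifferentiableAt ℝ (fun t : ℝ => (((1 : ℝ), t) : ℝ × ℝ)) 0 := by fun_prop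
    exact (hdN (1, 0) (by simp)).comp 0 h1
  · have h1 : ContinuousAt (fun t : ℝ => (((-1 : ℝ), t) : ℝ × ℝ)) 0 := by fun_prop
    exact (hdN (-1, 0) (by simp)).continuousAt.comp h1

end Planar

/-! ### Convexity of the norms and the torsion identity. -/

section Pointwise

variable {n : ℕ} {M : Type*} [TopologicalSpace M] [ChartedSpace (Coord n) M]
  [IsManifold (𝓡 n) ∞ M] {F : FinslerMetric n M} {x₀ : M} {u y : Coord n}

theorem hessian_energy_pos (hu : u ∈ (extChartAt (𝓡 n) x₀).target) (hy : y ≠ 0) {v : Coord n}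
    (hv : v ≠ 0) :
    0 < fderiv ℝ (fderiv ℝ (energyCoord F.toFun x₀)) (u, y) (0, v) (0, v) := by
  have h1 := (F.posDef x₀ u hu y hy).dotProduct_mulVec_pos (x := fun i => v i)
    (fun h => hv (by ext i; exact congrFun h i))
  refine h1.trans_eq ?_
  change ∑ i, v i * (∑ j, fundamentalMatrix F.toFun x₀ (u, y) i j * v j) = _
  have h2 : ∀ i, ∑ j, fundamentalMatrix F.toFun x₀ (u, y) i j * v j =
      fderiv ℝ (fderiv ℝ (energyCoord F.toFun x₀)) (u, y) (0, v) (0, EuclideanSpace.single i 1) := by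
    intro i
    rw [fderiv_fderiv_symm (contDiffAt_energyCoord F hu hy), ← sum_smul_apply_snd]
    exact Finset.sum_congr rfl fun j _ => by rw [fundamentalMatrix_apply F hu hy, mul_comm]
  simp only [h2]
  exact sum_smul_apply_snd _ v

/-- Subtracting from `v` the multiple of `y` that puts it in the kernel of `F_y` leaves the Hessian
of `F` unchanged, as `y` is in its kernel. On that kernel the Hessian of the energy is `F` times the
Hessian of `F`. -/
theorem hessian_finslerCoord_pos (hu : u ∈ (extChartAt (𝓡 n) x₀).target) (hy : y ≠ 0) {v : Coord n}
    (hv : ∀ r : ℝ, v ≠ r • y) :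
    0 < fderiv ℝ (fderiv ℝ (finslerCoord F x₀)) (u, y) (0, v) (0, v) := by
  have hL := contDiffAt_finslerCoord F hu hy
  have hpos := finslerCoord_pos F hu hy
  have hom : ∀ (u z : Coord n) (r : ℝ), 0 < r →
      finslerCoord F x₀ (u, r • z) = r * finslerCoord F x₀ (u, z) :=
    fun u z r hr => finslerCoord_smul F x₀ u z hr
  have hrad : fderiv ℝ (finslerCoord F x₀) (u, y) (0, y) = finslerCoord F x₀ (u, y) :=
    fderiv_radial hL (hom u)
  set s := fderiv ℝ (finslerCoord F x₀) (u, y) (0, v) / finslerCoord F x₀ (u, y) with hs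
  have hsub : ((0 : Coord n), v - s • y) = (0, v) - s • (0, y) := by simp
  have h1 := hessian_energy_pos (F := F) hu hy (v := v - s • y) (sub_ne_zero.2 (hv s))
  rw [energyCoord_eq, fderiv_fderiv_halfSq hL] at h1
  have h2 : fderiv ℝ (finslerCoord F x₀) (u, y) (0, v - s • y) = 0 := by
    rw [hsub, map_sub, map_smul, hrad, hs, smul_eq_mul, div_mul_cancel₀ _ hpos.ne', sub_self]
  have h3 := fderiv_fderiv_radial hL hom
  rw [h2, zero_mul, add_zero] at h1
  have h4 : fderiv ℝ (fderiv ℝ (finslerCoord F x₀)) (u, y) (0, v - s • y) (0, v - s • y) =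
      fderiv ℝ (fderiv ℝ (finslerCoord F x₀)) (u, y) (0, v) (0, v) := by
    have h3' : ∀ w, fderiv ℝ (fderiv ℝ (finslerCoord F x₀)) (u, y) (0, w) (0, y) = 0 := fun w => by
      rw [fderiv_fderiv_symm hL, h3]
    simp only [hsub, map_sub, map_smul, sub_apply, smul_apply, h3, h3', smul_zero, sub_zero]
  rw [h4] at h1
  exact pos_of_mul_pos_right h1 hpos.le

/-- The spray equation is compared with the Euler-Lagrange expression of the energy along the spray
of `D`, which invariance of `F` reduces to torsion. There remains a multiple of `F_y`, and it has to
vanish. -/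
theorem hessian_difference_eq_torsion [T2Space M] {D : AffineConnection n M} (h : PreservedBy F D)
    (hD : D.ContMDiffCovariantDerivative ∞) (hu : u ∈ (extChartAt (𝓡 n) x₀).target) (hy : y ≠ 0)
    {B : Coord n →L[ℝ] Coord n →L[ℝ] Coord n} {r μ : ℝ} (hr : 0 < r)
    (hS : sprayVec F x₀ (u, r • y) = christoffelL D x₀ u (r • y) (r • y) + B (r • y) (r • y) +
      μ • r • y) (w : Coord n) :
    fderiv ℝ (fderiv ℝ (finslerCoord F x₀)) (u, y) (0, B y y) (0, w) =
      fderiv ℝ (finslerCoord F x₀) (u, y) (0, christoffelL D x₀ u y w - christoffelL D x₀ u w y) := by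
  have hom : ∀ (u z : Coord n) (r : ℝ), 0 < r →
      finslerCoord F x₀ (u, r • z) = r * finslerCoord F x₀ (u, z) :=
    fun u z r hr => finslerCoord_smul F x₀ u z hr
  have hz : r • y ≠ 0 := smul_ne_zero hr.ne' hy
  have hLy := contDiffAt_finslerCoord F hu hy
  have hLz := contDiffAt_finslerCoord F hu hz
  have hpos := finslerCoord_pos F hu hz
  have hdy := hLy.differentiableAt (by simp)
  have hdz := hLz.differentiableAt (by simp)
  have hrad := fderiv_radial hLz (hom u)
  have key : ∀ w, finslerCoord F x₀ (u, r • y) *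
        fderiv ℝ (fderiv ℝ (finslerCoord F x₀)) (u, r • y) (0, B (r • y) (r • y)) (0, w) +
      (fderiv ℝ (finslerCoord F x₀) (u, r • y) (0, B (r • y) (r • y)) +
        μ * finslerCoord F x₀ (u, r • y)) * fderiv ℝ (finslerCoord F x₀) (u, r • y) (0, w) =
      finslerCoord F x₀ (u, r • y) * fderiv ℝ (finslerCoord F x₀) (u, r • y)
        (0, christoffelL D x₀ u (r • y) w - christoffelL D x₀ u w (r • y)) := by
    intro w
    have h1 := hessian_sprayVec (F := F) hu hz (christoffelL D x₀ u (r • y) (r • y)) w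
    rw [hS, energyCoord_eq, eulerLagrange_halfSq hLz,
      eulerLagrange_of_parallel hLz hz (fun z hz v => h.fderiv_eq_zero hD hu hz v),
      h.fderiv_eq_zero hD hu hz, zero_mul, add_zero] at h1
    rw [← h1]
    have h2 : ((0 : Coord n), christoffelL D x₀ u (r • y) (r • y) + B (r • y) (r • y) + μ • r • y -
        christoffelL D x₀ u (r • y) (r • y)) = (0, B (r • y) (r • y)) + μ • (0, r • y) := by
      ext1
      · simp
      · simp only [Prod.snd_add, Prod.smul_snd]; abel
    have h3 := hessian_energy_radial (F := F) hu hz w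
    rw [energyCoord_eq] at h3
    rw [h2, map_add, map_smul _ μ, add_apply, smul_apply, h3, fderiv_fderiv_halfSq hLz, smul_eq_mul]
    ring
  -- For `w` along the ray both the Hessian and the torsion term vanish, which forces the
  -- coefficient of `F_y` to be 0; this determines `μ`.
  have hμ := key (r • y)
  rw [sub_self, fderiv_fderiv_symm hLz, fderiv_fderiv_radial hLz hom, hrad] at hμ
  have hμ' : fderiv ℝ (finslerCoord F x₀) (u, r • y) (0, B (r • y) (r • y)) +
      μ * finslerCoord F x₀ (u, r • y) = 0 := by
    have h0 : ((0 : Coord n), (0 : Coord n)) = 0 := rfl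
    rw [h0, map_zero, mul_zero, zero_add] at hμ
    exact (mul_eq_zero.1 hμ).resolve_right hpos.ne'
  have h4 := key w
  rw [hμ', zero_mul, add_zero] at h4
  have h5 := mul_left_cancel₀ hpos.ne' h4
  -- Passage from `r • y` to `y`: the Hessian has degree -1 and `B` degree 2, while on the other
  -- side `F_y` has degree 0 and the torsion degree 1.
  have h6 := fderiv_fderiv_smul_of_homogeneous hom hr hLy hLz (B y y) w
  have h7 : ((0 : Coord n), B (r • y) (r • y)) = (r * r) • (0, B y y) := by
    simp [smul_smul]
  have h8 : ((0 : Coord n), christoffelL D x₀ u (r • y) w - christoffelL D x₀ u w (r • y)) =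
      r • (0, christoffelL D x₀ u y w - christoffelL D x₀ u w y) := by
    simp [smul_sub]
  rw [h7, h8, map_smul, map_smul, smul_apply, smul_eq_mul, smul_eq_mul,
    fderiv_smul_of_homogeneous hom hr hdy hdz] at h5
  apply mul_left_cancel₀ hr.ne'
  rw [← h6, ← h5]
  ring

end Pointwise

/-! ### Torsion at a point forces a Randers norm. -/

section RandersNorms

/-- `f = √q + ℓ` for a positive definite quadratic form `q` on a plane and a linear form `ℓ`. -/
def IsRandersNorm {V : Type*} [AddCommGroup V] [Module ℝ V] (f : V → ℝ) : Prop :=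
  ∃ a b ℓ : V →ₗ[ℝ] ℝ, (∀ v, a v = 0 → b v = 0 → v = 0) ∧ ∀ v, f v = √(a v ^ 2 + b v ^ 2) + ℓ v

theorem IsRandersNorm.comp {V W : Type*} [AddCommGroup V] [Module ℝ V] [AddCommGroup W] [Module ℝ W]
    {f : V → ℝ} (h : IsRandersNorm f) (A : W →ₗ[ℝ] V) (hA : Function.Injective A) :
    IsRandersNorm (fun w => f (A w)) := by
  obtain ⟨a, b, ℓ, h1, h2⟩ := h
  exact ⟨a ∘ₗ A, b ∘ₗ A, ℓ ∘ₗ A, fun v h3 h4 => (map_eq_zero_iff A hA).1 (h1 _ h3 h4),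
    fun v => h2 _⟩

variable {M : Type*} [TopologicalSpace M] [ChartedSpace (Coord 2) M]
  [IsManifold (𝓡 2) ∞ M] {F : FinslerMetric 2 M} {x₀ : M} {u : Coord 2}

/-- Rotating from `τ` to `-τ`, the derivative along `τ` goes from `F(τ) > 0` to `-F(-τ) < 0`, and so
vanishes strictly in between, at a direction independent of `τ`. Used as second basis vector, `e`
makes the cubic form divisible by the first coordinate. -/
theorem exists_perp_direction (hu : u ∈ (extChartAt (𝓡 2) x₀).target) {τ : Coord 2} (hτ : τ ≠ 0) :
    ∃ e : Coord 2, fderiv ℝ (finslerCoord F x₀) (u, e) (0, τ) = 0 ∧ τ 0 * e 1 - τ 1 * e 0 ≠ 0 := by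
  have hom : ∀ (u z : Coord 2) (r : ℝ), 0 < r →
      finslerCoord F x₀ (u, r • z) = r * finslerCoord F x₀ (u, z) :=
    fun u z r hr => finslerCoord_smul F x₀ u z hr
  have hτ2 : 0 < τ 0 * τ 0 + τ 1 * τ 1 := by
    by_contra h
    apply hτ
    ext i
    fin_cases i
    · change τ 0 = 0
      nlinarith [mul_self_nonneg (τ 0), mul_self_nonneg (τ 1)]
    · change τ 1 = 0
      nlinarith [mul_self_nonneg (τ 0), mul_self_nonneg (τ 1)]
  set τ' : Coord 2 := !₂[-τ 1, τ 0] with hτ'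
  set e : ℝ → Coord 2 := fun θ => Real.cos θ • τ + Real.sin θ • τ' with he
  have hdet : ∀ θ, τ 0 * e θ 1 - τ 1 * e θ 0 = Real.sin θ * (τ 0 * τ 0 + τ 1 * τ 1) := by
    intro θ
    simp [he, hτ']
    ring
  have hdot : ∀ θ, τ 0 * e θ 0 + τ 1 * e θ 1 = Real.cos θ * (τ 0 * τ 0 + τ 1 * τ 1) := by
    intro θ
    simp [he, hτ']
    ring
  have hne : ∀ θ, e θ ≠ 0 := by
    intro θ h
    have h1 := hdet θ
    have h2 := hdot θ
    rw [h] at h1 h2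
    have h3 := (mul_eq_zero.1 (h1.symm.trans (by simp))).resolve_right hτ2.ne'
    have h4 := (mul_eq_zero.1 (h2.symm.trans (by simp))).resolve_right hτ2.ne'
    have := Real.sin_sq_add_cos_sq θ
    rw [h3, h4] at this
    norm_num at this
  set φ : ℝ → ℝ := fun θ => fderiv ℝ (finslerCoord F x₀) (u, e θ) (0, τ) with hφ
  have hcont : Continuous φ := by
    rw [continuous_iff_continuousAt]
    intro θ
    have h1 := (differentiableAt_fderiv (contDiffAt_finslerCoord F hu (hne θ))).continuousAt
    have h2 : ContinuousAt (fun θ => (u, e θ)) θ := by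
      simp only [he]; fun_prop
    have h3 : ContinuousAt (fun θ => fderiv ℝ (finslerCoord F x₀) (u, e θ)) θ :=
      ContinuousAt.comp (f := fun θ => (u, e θ)) h1 h2
    exact h3.clm_apply continuousAt_const
  have e0 : e 0 = τ := by simp [he]
  have eπ : e Real.pi = -τ := by simp [he]
  have h0 : 0 < φ 0 := by
    simp only [hφ, e0]
    rw [fderiv_radial (contDiffAt_finslerCoord F hu hτ) (hom u)]
    exact finslerCoord_pos F hu hτ
  have hπ : φ Real.pi < 0 := by
    have hτn : -τ ≠ 0 := neg_ne_zero.2 hτ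
    have h1 := fderiv_radial (contDiffAt_finslerCoord F hu hτn) (hom u)
    have h2 := finslerCoord_pos F hu hτn
    simp only [hφ, eπ]
    rw [show ((0 : Coord 2), -τ) = -(0, τ) by simp, map_neg] at h1
    linarith
  obtain ⟨θ, hθ, hθ0⟩ := intermediate_value_Icc' Real.pi_pos.le hcont.continuousOn ⟨hπ.le, h0.le⟩
  refine ⟨e θ, hθ0, ?_⟩
  rw [hdet]
  refine mul_ne_zero (Real.sin_pos_of_pos_of_lt_pi ?_ ?_).ne' hτ2.ne'
  · rcases hθ.1.eq_or_lt with h | h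
    · rw [← h] at hθ0; exact absurd hθ0 h0.ne'
    · exact h
  · rcases hθ.2.eq_or_lt with h | h
    · rw [h] at hθ0; exact absurd hθ0 hπ.ne
    · exact h

theorem coord_two_eq (y : Coord 2) :
    y = y 0 • EuclideanSpace.single 0 1 + y 1 • EuclideanSpace.single 1 1 := by
  ext i; fin_cases i <;> simp

/-- Alternating bilinear maps on a plane are multiples of the determinant, so the torsion takes
values in one line. -/
theorem alternating_eq (T : Coord 2 →L[ℝ] Coord 2 →L[ℝ] Coord 2) (y w : Coord 2) :
    T y w - T w y = (y 0 * w 1 - y 1 * w 0) • (T (EuclideanSpace.single 0 1)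
      (EuclideanSpace.single 1 1) - T (EuclideanSpace.single 1 1) (EuclideanSpace.single 0 1)) := by
  conv_lhs => rw [coord_two_eq y, coord_two_eq w]
  simp only [map_add, map_smul, add_apply, smul_apply]
  module

/-- Wherever the connection preserving a Douglas metric has torsion, the metric is a Randers norm
whose linear part vanishes on the image of the torsion. -/
theorem isRandersNorm_of_torsion [T2Space M] {D : AffineConnection 2 M} (h : PreservedBy F D)
    (hD : D.ContMDiffCovariantDerivative ∞) (hu : u ∈ (extChartAt (𝓡 2) x₀).target)
    {B : Coord 2 →L[ℝ] Coord 2 →L[ℝ] Coord 2}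
    (hS : ∀ y : Coord 2, y ≠ 0 → ∃ r > (0 : ℝ), ∃ μ : ℝ, sprayVec F x₀ (u, r • y) =
      B (r • y) (r • y) + μ • r • y) {τ : Coord 2}
    (hτ : τ = christoffelL D x₀ u (EuclideanSpace.single 0 1) (EuclideanSpace.single 1 1) -
      christoffelL D x₀ u (EuclideanSpace.single 1 1) (EuclideanSpace.single 0 1)) (hτ0 : τ ≠ 0) :
    IsRandersNorm (fun y => finslerCoord F x₀ (u, y)) ∧
      finslerCoord F x₀ (u, -τ) = finslerCoord F x₀ (u, τ) := by
  -- In the basis `τ, e` the derivative along `τ` is the partial derivative in the first coordinate.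
  obtain ⟨e, he, hdet⟩ := exists_perp_direction (F := F) hu hτ0
  set A₀ : ℝ × ℝ →ₗ[ℝ] Coord 2 :=
    (LinearMap.toSpanSingleton ℝ _ τ).coprod (LinearMap.toSpanSingleton ℝ _ e) with hA₀
  have hA₀a : ∀ p, A₀ p = p.1 • τ + p.2 • e := fun p => by simp [hA₀]
  have hinj : Function.Injective A₀ := by
    rw [← LinearMap.ker_eq_bot, LinearMap.ker_eq_bot']
    intro p hp
    rw [hA₀a] at hp
    have h0 : p.1 * τ 0 + p.2 * e 0 = 0 := by simpa using congrArg (fun z : Coord 2 => z 0) hp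
    have h1 : p.1 * τ 1 + p.2 * e 1 = 0 := by simpa using congrArg (fun z : Coord 2 => z 1) hp
    have h2 : p.2 * (τ 0 * e 1 - τ 1 * e 0) = 0 := by linear_combination τ 0 * h1 - τ 1 * h0
    have h3 : p.1 * (τ 0 * e 1 - τ 1 * e 0) = 0 := by linear_combination e 1 * h0 - e 0 * h1
    exact Prod.ext ((mul_eq_zero.1 h3).resolve_right hdet) ((mul_eq_zero.1 h2).resolve_right hdet)
  set A : (ℝ × ℝ) ≃ₗ[ℝ] Coord 2 := A₀.linearEquivOfInjective hinj (by simp) with hA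
  have hAa : ∀ p, A p = p.1 • τ + p.2 • e := hA₀a
  set A' : ℝ × ℝ →L[ℝ] Coord 2 × Coord 2 :=
    (ContinuousLinearMap.inr ℝ (Coord 2) (Coord 2)).comp (LinearMap.toContinuousLinearMap A₀) with hA'
  have hA'a : ∀ p, A' p = (0, A p) := fun p => rfl
  have hpt : ∀ p, (u, (0 : Coord 2)) + A' p = (u, A p) := fun p => by simp [hA'a]
  have hAne : ∀ p, p ≠ 0 → A p ≠ 0 := fun p hp => by simpa using hp
  set N : ℝ × ℝ → ℝ := fun p => finslerCoord F x₀ ((u, 0) + A' p) with hN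
  have hsm : ∀ p ≠ 0, ContDiffAt ℝ ∞ (finslerCoord F x₀) ((u, 0) + A' p) := fun p hp => by
    rw [hpt]; exact contDiffAt_finslerCoord F hu (hAne p hp)
  have hN1 : ∀ p ≠ 0, ∀ v, fderiv ℝ N p v = fderiv ℝ (finslerCoord F x₀) (u, A p) (0, A v) := by
    intro p hp v
    rw [hN, fderiv_comp_affine A' ((hsm p hp).differentiableAt (by simp)), hpt]
    rfl
  have hN2 : ∀ p ≠ 0, ∀ v w, fderiv ℝ (fderiv ℝ N) p v w =
      fderiv ℝ (fderiv ℝ (finslerCoord F x₀)) (u, A p) (0, A v) (0, A w) := by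
    intro p hp v w
    rw [hN, fderiv_fderiv_comp_affine A' ((hsm p hp).of_le (by norm_cast)), hpt]
    rfl
  -- The difference of the Douglas connection and the metric one; `C y y` is the quadratic vector
  -- field of the planar problem.
  set C : Coord 2 →L[ℝ] Coord 2 →L[ℝ] Coord 2 := B - christoffelL D x₀ u with hC
  have hCA : ∀ p : ℝ × ℝ, C (A p) (A p) = A (p.1 ^ 2 • A.symm (C τ τ) +
      (p.1 * p.2) • A.symm (C τ e + C e τ) + p.2 ^ 2 • A.symm (C e e)) := by
    intro p
    simp only [map_add, map_smul, LinearEquiv.apply_symm_apply]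
    rw [hAa]
    simp only [map_add, map_smul, add_apply, smul_apply]
    module
  -- The constant `c` is the determinant of the basis change, which appears when `det(y, w)` is
  -- written in the new coordinates.
  obtain ⟨a, ha, k, hk, d, hNeq⟩ := randers_of_hessian (N := N) (c := τ 0 * e 1 - τ 1 * e 0)
    (a₀ := (A.symm (C τ τ)).1) (a₁ := (A.symm (C τ e + C e τ)).1) (a₂ := (A.symm (C e e)).1)
    (b₀ := (A.symm (C τ τ)).2) (b₁ := (A.symm (C τ e + C e τ)).2) (b₂ := (A.symm (C e e)).2)
    (fun p hp => (hsm p hp).comp p (contDiffAt_const.add A'.contDiff.contDiffAt))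
    (fun p r hr => by
      simp only [hN, hpt, map_smul]
      exact finslerCoord_smul F x₀ u _ hr)
    (by simp only [hN, hpt, map_zero]; exact finslerCoord_zero F x₀ u)
    (fun p hp v hv => by
      rw [hN2 p hp]
      refine hessian_finslerCoord_pos hu (hAne p hp) fun r hr => hv ?_
      rw [← map_smul] at hr
      rw [A.injective hr]
      simp only [Prod.smul_fst, Prod.smul_snd, smul_eq_mul]
      ring)
    hdet
    (fun p hp w => by
      rw [hN2 p hp, hN1 p hp]
      obtain ⟨r, hr, μ, hS'⟩ := hS (A p) (hAne p hp)
      have h1 := hessian_difference_eq_torsion h hD hu (hAne p hp) (B := C) (μ := μ) hr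
        (by rw [hS', hC, sub_apply, sub_apply]; abel) (A w)
      rw [hCA p] at h1
      have h2 : (p.1 ^ 2 • A.symm (C τ τ) + (p.1 * p.2) • A.symm (C τ e + C e τ) +
          p.2 ^ 2 • A.symm (C e e)) = ((A.symm (C τ τ)).1 * p.1 ^ 2 + (A.symm (C τ e + C e τ)).1 *
            (p.1 * p.2) + (A.symm (C e e)).1 * p.2 ^ 2, (A.symm (C τ τ)).2 * p.1 ^ 2 +
            (A.symm (C τ e + C e τ)).2 * (p.1 * p.2) + (A.symm (C e e)).2 * p.2 ^ 2) := by
        ext <;> simp only [Prod.fst_add, Prod.snd_add, Prod.smul_fst, Prod.smul_snd, smul_eq_mul] <;>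
          ring
      rw [h2] at h1
      rw [h1, alternating_eq, ← hτ]
      have h3 : A p 0 * A w 1 - A p 1 * A w 0 =
          (p.1 * w.2 - p.2 * w.1) * (τ 0 * e 1 - τ 1 * e 0) := by
        rw [hAa, hAa]
        simp
        ring
      have h4 : A (1, 0) = τ := by simp [hAa]
      rw [h3, h4, show ((0 : Coord 2), ((p.1 * w.2 - p.2 * w.1) * (τ 0 * e 1 - τ 1 * e 0)) • τ) =
        ((p.1 * w.2 - p.2 * w.1) * (τ 0 * e 1 - τ 1 * e 0)) • (0, τ) by simp, map_smul, smul_eq_mul,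
        mul_assoc])
    (by
      rw [hN1 _ (by simp)]
      simpa [hAa] using he)
  have hL : ∀ y, finslerCoord F x₀ (u, y) = k / a * √(a * (A.symm y).1 ^ 2 + (A.symm y).2 ^ 2) +
      d * (A.symm y).2 := by
    intro y
    have := hNeq (A.symm y)
    simpa only [hN, hpt, A.apply_symm_apply] using this
  have hAτ : A.symm τ = (1, 0) := by
    rw [LinearEquiv.symm_apply_eq]; simp [hAa]
  -- The factor `k / a` is moved under the root: `(k / a)² a = (k / √a)²`. The linear part involves
  -- only the coordinate along `e`, which is why the norm is symmetric on the line of `τ`.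
  refine ⟨⟨(k / √a) • (LinearMap.fst ℝ ℝ ℝ ∘ₗ A.symm.toLinearMap),
    (k / a) • (LinearMap.snd ℝ ℝ ℝ ∘ₗ A.symm.toLinearMap),
    d • (LinearMap.snd ℝ ℝ ℝ ∘ₗ A.symm.toLinearMap), fun v h1 h2 => ?_, fun v => ?_⟩, ?_⟩
  · have h3 : k / √a ≠ 0 := (div_pos hk (Real.sqrt_pos.2 ha)).ne'
    have h4 : k / a ≠ 0 := (div_pos hk ha).ne'
    have h5 : (A.symm v).1 = 0 := (mul_eq_zero.1 h1).resolve_left h3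
    have h6 : (A.symm v).2 = 0 := (mul_eq_zero.1 h2).resolve_left h4
    exact A.symm.map_eq_zero_iff.1 (Prod.ext h5 h6)
  · change finslerCoord F x₀ (u, v) = √((k / √a * (A.symm v).1) ^ 2 + (k / a * (A.symm v).2) ^ 2) +
      d * (A.symm v).2
    rw [hL, show (k / √a * (A.symm v).1) ^ 2 + (k / a * (A.symm v).2) ^ 2 =
      (k / a) ^ 2 * (a * (A.symm v).1 ^ 2 + (A.symm v).2 ^ 2) by
        rw [mul_pow, div_pow, Real.sq_sqrt ha.le]; field_simp,
      Real.sqrt_mul (sq_nonneg _), Real.sqrt_sq (div_pos hk ha).le]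
  · rw [hL, hL, map_neg, hAτ]
    simp

end RandersNorms

/-! ### 1-forms and Riemannian metrics in charts. -/

section Tensors

variable {n : ℕ} {M : Type*} [TopologicalSpace M] [ChartedSpace (Coord n) M]

instance finiteDimensional_tangentSpace (x : M) : FiniteDimensional ℝ (TangentSpace (𝓡 n) x) :=
  inferInstanceAs (FiniteDimensional ℝ (Coord n))

instance t2Space_tangentSpace (x : M) : T2Space (TangentSpace (𝓡 n) x) :=
  inferInstanceAs (T2Space (Coord n))

variable [IsManifold (𝓡 n) ∞ M]

section

variable {F₂ : Type*} [NormedAddCommGroup F₂] [NormedSpace ℝ F₂] {E₂ : M → Type*}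
  [∀ x, AddCommGroup (E₂ x)] [∀ x, Module ℝ (E₂ x)] [TopologicalSpace (TotalSpace F₂ E₂)]
  [∀ x, TopologicalSpace (E₂ x)] [FiberBundle F₂ E₂] [VectorBundle ℝ F₂ E₂]
  [∀ x, IsTopologicalAddGroup (E₂ x)] [∀ x, ContinuousSMul ℝ (E₂ x)]

/-- A family of linear maps on the tangent spaces is smooth if it maps the coordinate fields to
smooth sections. -/
theorem contMDiffAt_hom_of_coordField {φ : ∀ x : M, TangentSpace (𝓡 n) x →L[ℝ] E₂ x} {x₀ : M}
    (h : ∀ w : Coord n, ContMDiffAt (𝓡 n) ((𝓡 n).prod 𝓘(ℝ, F₂)) ∞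
      (fun x => TotalSpace.mk' F₂ (E := E₂) x (φ x (coordField x₀ w x))) x₀) :
    ContMDiffAt (𝓡 n) ((𝓡 n).prod 𝓘(ℝ, Coord n →L[ℝ] F₂)) ∞
      (fun x => TotalSpace.mk' (Coord n →L[ℝ] F₂)
        (E := fun x : M => TangentSpace (𝓡 n) x →L[ℝ] E₂ x) x (φ x)) x₀ := by
  rw [contMDiffAt_hom_bundle]
  refine ⟨contMDiffAt_id, ?_⟩
  have hx : x₀ ∈ (chartAt (Coord n) x₀).source := mem_chart_source _ x₀
  rw [smoothAt_iff_coord hx]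
  refine contDiffAt_clm_of_apply fun w => ?_
  have h1 := (contMDiffAt_totalSpace.1 (h w)).2
  have h2 : ContMDiffAt (𝓡 n) 𝓘(ℝ, F₂) ∞ (fun x => ContinuousLinearMap.inCoordinates (Coord n)
      (TangentSpace (𝓡 n) (M := M)) F₂ E₂ x₀ x x₀ x (φ x) w) x₀ := by
    refine h1.congr_of_eventuallyEq ?_
    filter_upwards [(trivializationAt F₂ E₂ x₀).open_baseSet.mem_nhds
      (mem_baseSet_trivializationAt F₂ E₂ x₀)] with x hx
    simp only [ContinuousLinearMap.inCoordinates, ContinuousLinearMap.comp_apply]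
    exact Trivialization.continuousLinearMapAt_apply_of_mem ℝ _ hx _
  exact (smoothAt_iff_coord hx _).1 h2

end

theorem contMDiffAt_trivial_section {f : M → ℝ} {x : M} :
    ContMDiffAt (𝓡 n) ((𝓡 n).prod 𝓘(ℝ, ℝ)) ∞
      (fun x => TotalSpace.mk' ℝ (E := Bundle.Trivial M ℝ) x (f x)) x ↔
      ContMDiffAt (𝓡 n) 𝓘(ℝ, ℝ) ∞ f x := by
  rw [contMDiffAt_totalSpace]
  exact ⟨fun h => h.2, fun h => ⟨contMDiffAt_id, h⟩⟩

theorem contMDiffAt_oneForm_of_coord {b : ∀ x : M, TangentSpace (𝓡 n) x →L[ℝ] ℝ} {x₀ : M}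
    (h : ∀ w : Coord n, ContDiffAt ℝ ∞ (fun u => b ((extChartAt (𝓡 n) x₀).symm u)
      (coordField x₀ w ((extChartAt (𝓡 n) x₀).symm u))) (extChartAt (𝓡 n) x₀ x₀)) :
    ContMDiffAt (𝓡 n) ((𝓡 n).prod 𝓘(ℝ, Coord n →L[ℝ] ℝ)) ∞
      (fun x => TotalSpace.mk' (Coord n →L[ℝ] ℝ)
        (E := fun x : M => TangentSpace (𝓡 n) x →L[ℝ] ℝ) x (b x)) x₀ := by
  refine contMDiffAt_hom_of_coordField (E₂ := Bundle.Trivial M ℝ) fun w => ?_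
  rw [contMDiffAt_trivial_section, smoothAt_iff_coord (mem_chart_source _ x₀)]
  exact h w

theorem exists_oneForm (b : ∀ x : M, TangentSpace (𝓡 n) x →ₗ[ℝ] ℝ)
    (h : ∀ (x₀ : M) (w : Coord n), ContDiffAt ℝ ∞ (fun u => b ((extChartAt (𝓡 n) x₀).symm u)
      (coordField x₀ w ((extChartAt (𝓡 n) x₀).symm u))) (extChartAt (𝓡 n) x₀ x₀)) :
    ∃ β : OneForm n M, ∀ x v, β.toFun x v = b x v :=
  ⟨⟨fun x => LinearMap.toContinuousLinearMap (b x),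
    fun x₀ => contMDiffAt_oneForm_of_coord (h x₀)⟩, fun _ _ => rfl⟩

/-- Positivity on the compact unit sphere gives `m ‖v‖² ≤ q v v` with `m > 0`. Boundedness of the
unit balls is one of the fields of a bundled Riemannian metric. -/
theorem isVonNBounded_of_pos (q : Coord n →L[ℝ] Coord n →L[ℝ] ℝ) (hq : ∀ v ≠ 0, 0 < q v v) :
    Bornology.IsVonNBounded ℝ {v : Coord n | q v v < 1} := by
  have hc : Continuous fun v => q v v := q.continuous.clm_apply continuous_id
  obtain ⟨m, hm, h⟩ := (isCompact_sphere (0 : Coord n) 1).exists_forall_le' hc.continuousOn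
    (a := 0) (fun v hv => hq v (by rintro rfl; simp at hv))
  have key : ∀ v, m * ‖v‖ ^ 2 ≤ q v v := by
    intro v
    rcases eq_or_ne v 0 with rfl | hv
    · simp
    · have hv' := norm_pos_iff.2 hv
      have h1 := h (‖v‖⁻¹ • v) (by simp [norm_smul, hv'.ne'])
      simp only [map_smul, smul_apply, smul_eq_mul] at h1
      field_simp at h1
      linarith
  rw [NormedSpace.isVonNBounded_iff, isBounded_iff_forall_norm_le]
  refine ⟨1 / m + 1, fun v hv => ?_⟩
  have h1 : m * ‖v‖ ^ 2 < 1 := (key v).trans_lt hv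
  by_contra! h2
  have h3 : 0 < 1 / m := by positivity
  have h4 : 1 / m < ‖v‖ ^ 2 := by nlinarith
  rw [div_lt_iff₀ hm] at h4
  linarith

theorem exists_riemannianMetric (q : ∀ x : M, TangentSpace (𝓡 n) x →ₗ[ℝ] TangentSpace (𝓡 n) x →ₗ[ℝ] ℝ)
    (hs : ∀ x v w, q x v w = q x w v) (hp : ∀ x v, v ≠ 0 → 0 < q x v v)
    (h : ∀ (x₀ : M) (v w : Coord n), ∀ u ∈ (extChartAt (𝓡 n) x₀).target,
      ContDiffAt ℝ ∞ (fun u => q ((extChartAt (𝓡 n) x₀).symm u)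
      (coordField x₀ v ((extChartAt (𝓡 n) x₀).symm u))
      (coordField x₀ w ((extChartAt (𝓡 n) x₀).symm u))) u) :
    ∃ α : RiemannianMetric n M, ∀ x v w, α.inner x v w = q x v w := by
  refine ⟨⟨fun x => (q x).toContinuousBilinearMap, hs, hp,
    fun x => isVonNBounded_of_pos (n := n) (q x).toContinuousBilinearMap (hp x), fun x₀ => ?_⟩,
    fun _ _ _ => rfl⟩
  refine contMDiffAt_hom_of_coordField (F₂ := Coord n →L[ℝ] ℝ)
    (E₂ := fun x : M => TangentSpace (𝓡 n) x →L[ℝ] ℝ) fun v => ?_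
  exact contMDiffAt_oneForm_of_coord fun w => h x₀ v w _ (mem_extChartAt_target x₀)

/-- The local representation of a 1-form. -/
def formCoord (β : OneForm n M) (x₀ : M) (u : Coord n) : Coord n →L[ℝ] ℝ :=
  LinearMap.toContinuousLinearMap
    { toFun := fun w => β.toFun ((extChartAt (𝓡 n) x₀).symm u)
        (coordField x₀ w ((extChartAt (𝓡 n) x₀).symm u))
      map_add' := fun v w => by rw [coordField_add, map_add]
      map_smul' := fun a v => by rw [coordField_smul, map_smul]; rfl }

theorem formCoord_apply (β : OneForm n M) (x₀ : M) (u w : Coord n) :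
    formCoord β x₀ u w = β.toFun ((extChartAt (𝓡 n) x₀).symm u)
      (coordField x₀ w ((extChartAt (𝓡 n) x₀).symm u)) := rfl

theorem formCoord_extChartAt (β : OneForm n M) {x₀ x : M} (hx : x ∈ (chartAt (Coord n) x₀).source)
    (v : TangentSpace (𝓡 n) x) :
    formCoord β x₀ (extChartAt (𝓡 n) x₀ x) (coordVec x₀ x v) = β.toFun x v := by
  rw [formCoord_apply, extChartAt_symm_left hx, coordField_coordVec hx]

/-- The local representation of a Riemannian metric. -/
def metricCoord (α : RiemannianMetric n M) (x₀ : M) (u : Coord n) :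
    Coord n →L[ℝ] Coord n →L[ℝ] ℝ :=
  (LinearMap.mk₂ ℝ (fun v w => α.inner ((extChartAt (𝓡 n) x₀).symm u)
    (coordField x₀ v ((extChartAt (𝓡 n) x₀).symm u))
    (coordField x₀ w ((extChartAt (𝓡 n) x₀).symm u)))
    (fun v v' w => by rw [coordField_add, map_add, add_apply])
    (fun a v w => by rw [coordField_smul, map_smul, smul_apply])
    (fun v w w' => by rw [coordField_add, map_add])
    (fun a v w => by rw [coordField_smul, map_smul])).toContinuousBilinearMap

theorem metricCoord_apply (α : RiemannianMetric n M) (x₀ : M) (u v w : Coord n) :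
    metricCoord α x₀ u v w = α.inner ((extChartAt (𝓡 n) x₀).symm u)
      (coordField x₀ v ((extChartAt (𝓡 n) x₀).symm u))
      (coordField x₀ w ((extChartAt (𝓡 n) x₀).symm u)) := rfl

theorem metricCoord_extChartAt (α : RiemannianMetric n M) {x₀ x : M}
    (hx : x ∈ (chartAt (Coord n) x₀).source) (v w : TangentSpace (𝓡 n) x) :
    metricCoord α x₀ (extChartAt (𝓡 n) x₀ x) (coordVec x₀ x v) (coordVec x₀ x w) =
      α.inner x v w := by
  rw [metricCoord_apply, extChartAt_symm_left hx, coordField_coordVec hx, coordField_coordVec hx]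

theorem metricCoord_symm (α : RiemannianMetric n M) (x₀ : M) (u v w : Coord n) :
    metricCoord α x₀ u v w = metricCoord α x₀ u w v := α.symm _ _ _

theorem metricCoord_pos (α : RiemannianMetric n M) {x₀ : M} {u : Coord n}
    (hu : u ∈ (extChartAt (𝓡 n) x₀).target) {v : Coord n} (hv : v ≠ 0) :
    0 < metricCoord α x₀ u v v :=
  α.pos _ _ (coordField_ne_zero (mem_chart_target hu) hv)

theorem contDiffAt_formCoord (β : OneForm n M) {x₀ : M} {u : Coord n}
    (hu : u ∈ (extChartAt (𝓡 n) x₀).target) : ContDiffAt ℝ ∞ (formCoord β x₀) u := by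
  refine contDiffAt_clm_of_apply fun w => ?_
  have hx := mem_chart_target hu
  have h1 := ContMDiffAt.clm_bundle_apply (E₂ := Bundle.Trivial M ℝ) (β.smooth _)
    (fieldSmoothAt_coordField hx w)
  rw [contMDiffAt_trivial_section, smoothAt_iff_coord hx, extChartAt_symm_right hu] at h1
  exact h1

theorem contDiffAt_metricCoord (α : RiemannianMetric n M) {x₀ : M} {u : Coord n}
    (hu : u ∈ (extChartAt (𝓡 n) x₀).target) : ContDiffAt ℝ ∞ (metricCoord α x₀) u := by
  refine contDiffAt_clm_of_apply fun v => contDiffAt_clm_of_apply fun w => ?_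
  have hx := mem_chart_target hu
  have h1 := ContMDiffAt.clm_bundle_apply (F₂ := Coord n →L[ℝ] ℝ)
    (E₂ := fun x : M => TangentSpace (𝓡 n) x →L[ℝ] ℝ) (α.contMDiff _)
    (fieldSmoothAt_coordField hx v)
  have h2 := ContMDiffAt.clm_bundle_apply (E₂ := Bundle.Trivial M ℝ) h1
    (fieldSmoothAt_coordField hx w)
  rw [contMDiffAt_trivial_section, smoothAt_iff_coord hx, extChartAt_symm_right hu] at h2
  exact h2

theorem fderiv_formCoord_apply (β : OneForm n M) {x₀ : M} {u : Coord n}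
    (hu : u ∈ (extChartAt (𝓡 n) x₀).target) (v w : Coord n) :
    fderiv ℝ (fun z => formCoord β x₀ z w) u v = fderiv ℝ (formCoord β x₀) u v w := by
  have h1 := ((contDiffAt_formCoord β hu).differentiableAt (by simp)).hasFDerivAt
  have h2 := (h1.clm_apply (hasFDerivAt_const w u)).fderiv
  rw [h2]
  simp

theorem OneForm.isClosed_iff (β : OneForm n M) :
    β.IsClosed ↔ ∀ x₀ : M, ∀ u ∈ (extChartAt (𝓡 n) x₀).target, ∀ v w : Coord n,
      fderiv ℝ (formCoord β x₀) u v w = fderiv ℝ (formCoord β x₀) u w v := by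
  constructor
  · intro h x₀ u hu v w
    set B := fderiv ℝ (formCoord β x₀) u with hB
    have h1 : ∀ i j : Fin n, B (EuclideanSpace.single i 1) (EuclideanSpace.single j 1) =
        B (EuclideanSpace.single j 1) (EuclideanSpace.single i 1) := by
      intro i j
      have := h x₀ u hu i j
      rw [hB, ← fderiv_formCoord_apply β hu, ← fderiv_formCoord_apply β hu]
      exact this
    have h2 : ∀ (v : Coord n) (i : Fin n),
        B v (EuclideanSpace.single i 1) = B (EuclideanSpace.single i 1) v := by
      intro v i
      rw [← sum_smul_single v, map_sum, map_sum, sum_apply]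
      exact Finset.sum_congr rfl fun j _ => by rw [map_smul, map_smul, smul_apply, h1]
    rw [← sum_smul_single w, map_sum, map_sum, sum_apply]
    exact Finset.sum_congr rfl fun j _ => by rw [map_smul, map_smul, smul_apply, h2]
  · intro h x₀ u hu i j
    have := h x₀ u hu (EuclideanSpace.single i 1) (EuclideanSpace.single j 1)
    rw [← fderiv_formCoord_apply β hu, ← fderiv_formCoord_apply β hu] at this
    exact this

theorem isUnit_det_metricMatrix (α : RiemannianMetric n M) {x₀ : M} {u : Coord n}
    (hu : u ∈ (extChartAt (𝓡 n) x₀).target) : IsUnit (metricMatrix α x₀ u).det := by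
  rw [← Matrix.isUnit_iff_isUnit_det, ← Matrix.mulVec_injective_iff_isUnit]
  refine (injective_iff_map_eq_zero (Matrix.mulVecLin (metricMatrix α x₀ u))).2 fun v hv => ?_
  by_contra hne
  set w : Coord n := WithLp.toLp 2 v with hw
  have hw0 : w ≠ 0 := fun h => hne (by ext i; exact congrArg (fun z : Coord n => z i) h)
  have h1 : ∀ i, metricCoord α x₀ u (EuclideanSpace.single i 1) w = 0 := by
    intro i
    have h2 : ∑ j, metricCoord α x₀ u (EuclideanSpace.single i 1) (EuclideanSpace.single j 1) * v j
      = 0 := congrFun hv i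
    rw [← h2]
    conv_lhs => rw [← sum_smul_single w, map_sum]
    exact Finset.sum_congr rfl fun j _ => by rw [map_smul, smul_eq_mul, mul_comm]
  have h3 := metricCoord_pos α hu hw0
  have h4 : metricCoord α x₀ u w w = ∑ i, w i * metricCoord α x₀ u (EuclideanSpace.single i 1) w := by
    conv_lhs => arg 1; rw [← sum_smul_single w, map_sum]
    rw [sum_apply]
    exact Finset.sum_congr rfl fun j _ => by rw [map_smul, smul_apply, smul_eq_mul]
  rw [h4] at h3
  simp [h1] at h3

/-- Raising an index gives `α^{ij} β_j = c^i`, so the inverse matrix can be traded for the vector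
dual to `β`. -/
theorem length_eq (α : RiemannianMetric n M) (β : OneForm n M) {x₀ : M} {u : Coord n}
    (hu : u ∈ (extChartAt (𝓡 n) x₀).target) {c : Coord n}
    (hc : ∀ w, metricCoord α x₀ u c w = formCoord β x₀ u w) :
    ∑ i, ∑ j, (metricMatrix α x₀ u)⁻¹ i j * β.component x₀ i u * β.component x₀ j u =
      formCoord β x₀ u c := by
  have h1 : (metricMatrix α x₀ u).mulVec (fun j => c j) = fun j => β.component x₀ j u := by
    ext i
    have h2 := hc (EuclideanSpace.single i 1)
    rw [metricCoord_symm, ← sum_smul_single c, map_sum] at h2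
    refine Eq.trans ?_ h2
    change ∑ j, metricCoord α x₀ u (EuclideanSpace.single i 1) (EuclideanSpace.single j 1) * c j = _
    exact Finset.sum_congr rfl fun j _ => by rw [map_smul, smul_eq_mul, mul_comm]
  have h3 : (metricMatrix α x₀ u)⁻¹.mulVec (fun j => β.component x₀ j u) = fun j => c j := by
    rw [← h1, Matrix.mulVec_mulVec, Matrix.nonsing_inv_mul _ (isUnit_det_metricMatrix α hu),
      Matrix.one_mulVec]
  have h4 : ∀ i, ∑ j, (metricMatrix α x₀ u)⁻¹ i j * β.component x₀ j u = c i :=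
    fun i => congrFun h3 i
  have h5 : formCoord β x₀ u c = ∑ i, c i * β.component x₀ i u := by
    conv_lhs => rw [← sum_smul_single c, map_sum]
    exact Finset.sum_congr rfl fun j _ => by rw [map_smul, smul_eq_mul]; rfl
  rw [h5]
  refine Finset.sum_congr rfl fun i _ => ?_
  rw [← h4, Finset.sum_mul]
  exact Finset.sum_congr rfl fun j _ => by ring

theorem exists_dual_vector {V : Type*} [AddCommGroup V] [Module ℝ V] [FiniteDimensional ℝ V]
    {q : V →ₗ[ℝ] V →ₗ[ℝ] ℝ} (hq : ∀ v ≠ 0, 0 < q v v) (ℓ : V →ₗ[ℝ] ℝ) :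
    ∃ c, ∀ w, q c w = ℓ w := by
  have hinj : Function.Injective q := by
    refine (injective_iff_map_eq_zero q).2 fun v hv => ?_
    by_contra h
    have := hq v h
    rw [hv] at this
    exact lt_irrefl _ this
  obtain ⟨c, hc⟩ := (LinearMap.injective_iff_surjective_of_finrank_eq_finrank
    (Subspace.dual_finrank_eq (K := ℝ) (V := V)).symm).1 hinj ℓ
  exact ⟨c, fun w => by rw [hc]⟩

end Tensors

/-! ### Torsion as the antisymmetric part of the Christoffel symbols. -/

section Torsion

variable {n : ℕ} {M : Type*} [TopologicalSpace M] [ChartedSpace (Coord n) M]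
  [IsManifold (𝓡 n) ∞ M]

/-- The constant vector field on the coordinate space. -/
def constField (w u : Coord n) : TangentSpace 𝓘(ℝ, Coord n) u := w

theorem mpullback_const_eq_coordField {x₀ x : M} (hx : x ∈ (chartAt (Coord n) x₀).source)
    (w : Coord n) :
    VectorField.mpullback (𝓡 n) 𝓘(ℝ, Coord n) (extChartAt (𝓡 n) x₀)
      (constField w) x = coordField x₀ w x := by
  rw [VectorField.mpullback_apply]
  have h1 : mfderiv (𝓡 n) 𝓘(ℝ, Coord n) (extChartAt (𝓡 n) x₀) x =
      (trivializationAt (Coord n) (TangentSpace (𝓡 n) (M := M)) x₀).continuousLinearMapAt ℝ x :=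
    ContinuousLinearMap.ext fun v => (coordVec_eq_mfderiv hx v).symm
  rw [h1]
  have h2 : ((trivializationAt (Coord n) (TangentSpace (𝓡 n) (M := M)) x₀).continuousLinearMapAt
      ℝ x).inverse = (trivializationAt (Coord n) (TangentSpace (𝓡 n) (M := M)) x₀).symmL ℝ x := by
    refine ContinuousLinearMap.inverse_eq ?_ ?_
    · exact ContinuousLinearMap.ext fun v => coordVec_coordField hx v
    · exact ContinuousLinearMap.ext fun v => coordField_coordVec hx v
  exact congrArg (fun A => A w) h2

/-- Coordinate fields are pullbacks of constant fields under the chart, and the bracket is natural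
under pullback. -/
theorem mlieBracket_coordField {x₀ x : M} (hx : x ∈ (chartAt (Coord n) x₀).source)
    (v w : Coord n) :
    VectorField.mlieBracket (𝓡 n) (coordField x₀ v) (coordField x₀ w) x = 0 := by
  have hc : ∀ w : Coord n, MDifferentiableAt 𝓘(ℝ, Coord n) (𝓘(ℝ, Coord n).prod 𝓘(ℝ, Coord n))
      (fun u => TotalSpace.mk' (Coord n) u (constField w u)) (extChartAt (𝓡 n) x₀ x) := fun w => by
    refine (contMDiffAt_vectorSpace_iff_contDiffAt (n := 1)).2 ?_ |>.mdifferentiableAt one_ne_zero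
    exact contDiffAt_const
  have : IsManifold (𝓡 n) (minSmoothness ℝ 2) M := by
    rw [minSmoothness_of_isRCLikeNormedField]; infer_instance
  have hs : ∀ w : Coord n, coordField x₀ w =ᶠ[𝓝 x] VectorField.mpullback (𝓡 n) 𝓘(ℝ, Coord n)
      (extChartAt (𝓡 n) x₀) (constField w) := fun w => by
    filter_upwards [eventually_source hx] with z hz
    exact (mpullback_const_eq_coordField hz w).symm
  rw [(hs v).mlieBracket_vectorField_eq (hs w), ← VectorField.mpullback_mlieBracket (n := ∞),
    VectorField.mpullback_apply]
  · have : VectorField.mlieBracket 𝓘(ℝ, Coord n) (constField v) (constField w)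
        (extChartAt (𝓡 n) x₀ x) = 0 := by
      rw [← VectorField.mlieBracketWithin_univ, VectorField.mlieBracketWithin_eq_lieBracketWithin]
      change fderivWithin ℝ (fun _ : Coord n => w) univ _ v -
        fderivWithin ℝ (fun _ : Coord n => v) univ _ w = 0
      simp
    rw [this, map_zero]
  · exact hc v
  · exact hc w
  · exact contMDiffAt_extChartAt' hx
  · rw [minSmoothness_of_isRCLikeNormedField]; exact ENat.LEInfty.out

/-- Coordinate fields commute, so the bracket term of the torsion drops out. -/
theorem coordVec_torsion (D : AffineConnection n M) {x₀ x : M}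
    (hx : x ∈ (chartAt (Coord n) x₀).source) (v w : Coord n) :
    coordVec x₀ x (D.torsion x (coordField x₀ v x) (coordField x₀ w x)) =
      christoffel D x₀ x v w - christoffel D x₀ x w v := by
  rw [D.torsion_apply (fieldDiffAt_coordField hx v) (fieldDiffAt_coordField hx w),
    mlieBracket_coordField hx, sub_zero]
  exact map_sub _ _ _

theorem christoffel_symm_of_torsion_eq_zero {D : AffineConnection n M} (hD : D.torsion = 0)
    {x₀ : M} {u : Coord n} (hu : u ∈ (extChartAt (𝓡 n) x₀).target) (v w : Coord n) :
    christoffelL D x₀ u v w = christoffelL D x₀ u w v := by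
  rw [christoffelL_apply D hu, christoffelL_apply D hu]
  refine sub_eq_zero.1 ?_
  rw [← coordVec_torsion D (mem_chart_target hu), hD]
  exact coordVec_zero _ _

theorem torsion_eq_zero_of_christoffel_symm {D : AffineConnection n M}
    (hD : ∀ (x : M) (v w : Coord n), christoffel D x x v w = christoffel D x x w v) :
    D.torsion = 0 := by
  funext x
  have hx := mem_chart_source (Coord n) x
  refine ContinuousLinearMap.ext fun v => ContinuousLinearMap.ext fun w => ?_
  rw [← coordField_coordVec hx (D.torsion x v w), ← coordField_coordVec hx v,
    ← coordField_coordVec hx w, coordVec_torsion D hx, hD, sub_self, coordField_zero]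
  rfl

end Torsion

/-! ### Douglas and generalized Berwald metrics are Berwald or Randers. -/

section Forward

variable {M : Type*} [TopologicalSpace M] [ChartedSpace (Coord 2) M]
  [IsManifold (𝓡 2) ∞ M] {F : FinslerMetric 2 M}

/-- For a fixed vector this includes `w = 0`, where `F` is not smooth in the fibre but vanishes
identically in the base. -/
theorem contDiffAt_finslerCoord_left {x₀ : M} {u : Coord 2}
    (hu : u ∈ (extChartAt (𝓡 2) x₀).target) (w : Coord 2) :
    ContDiffAt ℝ ∞ (fun z => finslerCoord F x₀ (z, w)) u := by
  by_cases hw : w = 0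
  · simp only [hw, finslerCoord_zero]
    exact contDiffAt_const
  · exact (contDiffAt_finslerCoord F hu hw).comp u (contDiffAt_id.prodMk contDiffAt_const)

/-- Torsion at a single point suffices: the norm there is a Randers norm, and all other tangent
norms are linearly isometric to it. -/
theorem isRandersNorm_of_torsion_ne_zero [T2Space M] [ConnectedSpace M] {D : AffineConnection 2 M}
    (hF : IsDouglas F) (h : PreservedBy F D) (hD : D.ContMDiffCovariantDerivative ∞)
    (hT : D.torsion ≠ 0) (x : M) : IsRandersNorm (F.toFun x) := by
  obtain ⟨D', hD'⟩ := hF.exists_sprayVec_eq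
  have : ∃ (x : M) (v w : Coord 2), christoffel D x x v w ≠ christoffel D x x w v := by
    by_contra! h
    exact hT (torsion_eq_zero_of_christoffel_symm h)
  obtain ⟨x', v, w, hvw⟩ := this
  have hx' := mem_chart_source (Coord 2) x'
  have hu := extChartAt_mem_target hx'
  rw [christoffel_eq_christoffelL D hx', christoffel_eq_christoffelL D hx', ← sub_ne_zero,
    alternating_eq] at hvw
  have h1 := (isRandersNorm_of_torsion h hD hu (hD' x' _ hu) rfl (right_ne_zero_of_smul hvw)).1
  have h2 : IsRandersNorm (F.toFun x') := by
    have := h1.comp (((trivializationAt (Coord 2) (TangentSpace (𝓡 2) (M := M))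
      x').continuousLinearMapAt ℝ x').toLinearMap) (fun v w hvw => by
        rw [← coordField_coordVec hx' v, ← coordField_coordVec hx' w]
        exact congrArg (fun z => coordField x' z x') hvw)
    have h3 : F.toFun x' = fun v => finslerCoord F x' (extChartAt (𝓡 2) x' x', coordVec x' x' v) :=
      funext fun v => (finslerCoord_extChartAt F hx' v).symm
    rw [h3]
    exact this
  obtain ⟨L, hL⟩ := h.exists_isometry hD x x'
  have := h2.comp L.toLinearMap L.injective
  have h3 : F.toFun x = fun v => F.toFun x' (L v) := funext fun v => (hL v).symm
  rw [h3]
  exact this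

/-- A Finsler metric consisting of Randers norms is a Randers metric. -/
theorem exists_isRanders (h : ∀ x, IsRandersNorm (F.toFun x)) :
    ∃ (α : RiemannianMetric 2 M) (β : OneForm 2 M), IsRanders F α β := by
  choose a b ℓ h1 h2 using h
  -- The forms `a`, `b`, `ℓ` are chosen pointwise, with no regularity in `x`; but `ℓ` and `a² + b²`
  -- are determined by the odd and even parts of `F`, which are smooth.
  have hodd : ∀ x v, ℓ x v = (F.toFun x v - F.toFun x (-v)) / 2 := by
    intro x v
    rw [h2, h2, map_neg, map_neg, map_neg, neg_sq, neg_sq]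
    ring
  have heven : ∀ x v, a x v * a x v + b x v * b x v = ((F.toFun x v + F.toFun x (-v)) / 2) ^ 2 := by
    intro x v
    rw [h2, h2, map_neg, map_neg, map_neg, neg_sq, neg_sq]
    have := Real.sq_sqrt (show 0 ≤ a x v ^ 2 + b x v ^ 2 by positivity)
    linear_combination -this
  obtain ⟨β, hβ⟩ := exists_oneForm ℓ fun x₀ w => by
    have hu := mem_extChartAt_target (I := 𝓡 2) x₀
    simp only [hodd, ← coordField_neg]
    exact ((contDiffAt_finslerCoord_left hu w).sub
      (contDiffAt_finslerCoord_left hu (-w))).div_const 2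
  obtain ⟨α, hα⟩ := exists_riemannianMetric (M := M)
    (fun x => (a x).smulRight (a x) + (b x).smulRight (b x))
    (fun x v w => by
      change a x v * a x w + b x v * b x w = a x w * a x v + b x w * b x v
      ring)
    (fun x v hv => by
      change 0 < a x v * a x v + b x v * b x v
      by_contra hn
      refine hv (h1 x v ?_ ?_) <;> nlinarith [mul_self_nonneg (a x v), mul_self_nonneg (b x v)])
    (fun x₀ v w u hu => by
      have hS : ∀ z : Coord 2, ContDiffAt ℝ ∞
          (fun u => ((finslerCoord F x₀ (u, z) + finslerCoord F x₀ (u, -z)) / 2) ^ 2) u := fun z =>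
        (((contDiffAt_finslerCoord_left hu z).add
          (contDiffAt_finslerCoord_left hu (-z))).div_const 2).pow 2
      -- Polarization recovers the bilinear form from the smooth quadratic form.
      refine (((hS (v + w)).sub (hS v)).sub (hS w)).div_const 2 |>.congr_of_eventuallyEq ?_
      refine Filter.Eventually.of_forall fun u => ?_
      have e : ∀ z, ((finslerCoord F x₀ (u, z) + finslerCoord F x₀ (u, -z)) / 2) ^ 2 =
          a _ (coordField x₀ z ((extChartAt (𝓡 2) x₀).symm u)) *
            a _ (coordField x₀ z ((extChartAt (𝓡 2) x₀).symm u)) +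
          b _ (coordField x₀ z ((extChartAt (𝓡 2) x₀).symm u)) *
            b _ (coordField x₀ z ((extChartAt (𝓡 2) x₀).symm u)) := by
        intro z
        rw [heven, ← coordField_neg]
        rfl
      simp only [e, coordField_add, map_add]
      change a _ _ * a _ _ + b _ _ * b _ _ = _
      ring)
  refine ⟨α, β, fun x y => ?_⟩
  rw [hα, hβ, h2]
  congr 2
  change _ = a x y * a x y + b x y * b x y
  ring

variable {α : RiemannianMetric 2 M} {β : OneForm 2 M}

theorem IsRanders.oneForm_eq {n : ℕ} {M : Type*} [TopologicalSpace M] [ChartedSpace (Coord n) M]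
    [IsManifold (𝓡 n) ∞ M] {F : FinslerMetric n M} {α : RiemannianMetric n M} {β : OneForm n M}
    (hR : IsRanders F α β) (x : M) (v : TangentSpace (𝓡 n) x) :
    β.toFun x v = (F.toFun x v - F.toFun x (-v)) / 2 := by
  rw [hR, hR]
  simp only [map_neg, neg_apply, neg_neg]
  ring

theorem IsRanders.inner_eq {n : ℕ} {M : Type*} [TopologicalSpace M] [ChartedSpace (Coord n) M]
    [IsManifold (𝓡 n) ∞ M] {F : FinslerMetric n M} {α : RiemannianMetric n M} {β : OneForm n M}
    (hR : IsRanders F α β) (x : M) (v : TangentSpace (𝓡 n) x) :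
    α.inner x v v = ((F.toFun x v + F.toFun x (-v)) / 2) ^ 2 := by
  have h0 : 0 ≤ α.inner x v v := by
    by_cases hv : v = 0
    · simp [hv]
    · exact (α.pos x v hv).le
  have := Real.sq_sqrt h0
  rw [hR, hR]
  simp only [map_neg, neg_apply, neg_neg]
  linear_combination -this

/-- A linear isometry of `F` between two fibres preserves even and odd parts, hence `α` and `β`; it
carries the dual vector of `β` to the dual vector and so preserves the length. -/
theorem IsRanders.hasConstantLength {n : ℕ} {M : Type*} [TopologicalSpace M]
    [ChartedSpace (Coord n) M] [IsManifold (𝓡 n) ∞ M] [T2Space M] [ConnectedSpace M]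
    {F : FinslerMetric n M} {α : RiemannianMetric n M} {β : OneForm n M} (hR : IsRanders F α β)
    {D : AffineConnection n M} (h : PreservedBy F D) (hD : D.ContMDiffCovariantDerivative ∞) :
    HasConstantLength α β := by
  obtain ⟨x'⟩ := (inferInstance : Nonempty M)
  obtain ⟨c, hc⟩ := exists_dual_vector (q := (ContinuousLinearMap.coeLM ℝ) ∘ₗ
    (α.inner x').toLinearMap) (α.pos x') (β.toFun x').toLinearMap
  refine ⟨β.toFun x' c, fun x₀ u hu => ?_⟩
  set x := (extChartAt (𝓡 n) x₀).symm u with hx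
  have hxs : x ∈ (chartAt (Coord n) x₀).source := mem_chart_target hu
  have hxu : extChartAt (𝓡 n) x₀ x = u := extChartAt_symm_right hu
  obtain ⟨L, hL⟩ := h.exists_isometry hD x' x
  have hβ : ∀ v, β.toFun x (L v) = β.toFun x' v := fun v => by
    rw [hR.oneForm_eq, hR.oneForm_eq, ← map_neg, hL, hL]
  have hα' : ∀ v, α.inner x (L v) (L v) = α.inner x' v v := fun v => by
    rw [hR.inner_eq, hR.inner_eq, ← map_neg, hL, hL]
  have hα : ∀ v w, α.inner x (L v) (L w) = α.inner x' v w := fun v w => by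
    have h1 := hα' (v + w)
    simp only [map_add, add_apply] at h1
    have h2 := α.symm x (L v) (L w)
    have h3 := α.symm x' v w
    linarith [hα' v, hα' w]
  rw [length_eq α β hu (c := coordVec x₀ x (L c)), ← hxu, formCoord_extChartAt β hxs, hβ]
  intro w
  obtain ⟨w', rfl⟩ : ∃ w', coordVec x₀ x (L w') = w :=
    ⟨L.symm (coordField x₀ w x), by rw [L.apply_symm_apply, coordVec_coordField hxs]⟩
  rw [← hxu, metricCoord_extChartAt α hxs, formCoord_extChartAt β hxs, hα, hβ]
  exact hc w'

theorem formCoord_eq_of_isRanders {n : ℕ} {M : Type*} [TopologicalSpace M]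
    [ChartedSpace (Coord n) M] [IsManifold (𝓡 n) ∞ M]
    {F : FinslerMetric n M} {α : RiemannianMetric n M} {β : OneForm n M} (hR : IsRanders F α β)
    (x₀ : M) (u w : Coord n) :
    formCoord β x₀ u w = (finslerCoord F x₀ (u, w) - finslerCoord F x₀ (u, -w)) / 2 := by
  rw [formCoord_apply, hR.oneForm_eq, ← coordField_neg]
  rfl

/-- The linear part of a preserved Randers metric is parallel. -/
theorem IsRanders.fderiv_formCoord {n : ℕ} {M : Type*} [TopologicalSpace M]
    [ChartedSpace (Coord n) M] [IsManifold (𝓡 n) ∞ M] [T2Space M]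
    {F : FinslerMetric n M} {α : RiemannianMetric n M} {β : OneForm n M} (hR : IsRanders F α β)
    {D : AffineConnection n M} (h : PreservedBy F D) (hD : D.ContMDiffCovariantDerivative ∞)
    {x₀ : M} {u : Coord n} (hu : u ∈ (extChartAt (𝓡 n) x₀).target) (v w : Coord n) :
    fderiv ℝ (formCoord β x₀) u v w = formCoord β x₀ u (christoffelL D x₀ u v w) := by
  by_cases hw : w = 0
  · simp [hw]
  have hw' : -w ≠ 0 := neg_ne_zero.2 hw
  have h1 := ((contDiffAt_finslerCoord F hu hw).differentiableAt (by simp)).hasFDerivAt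
  have h2 := ((contDiffAt_finslerCoord F hu hw').differentiableAt (by simp)).hasFDerivAt
  -- Along `w - tΓ` and along its negative, `F` is constant to first order; half the difference is
  -- `β`, whose derivative therefore vanishes.
  have h3 : HasDerivAt (fun t : ℝ => (u + t • v, w + t • (-christoffelL D x₀ u v w)))
      (v, -christoffelL D x₀ u v w) 0 := by
    have e : ∀ a b : Coord n, HasDerivAt (fun t : ℝ => a + t • b) b 0 := fun a b => by
      simpa using ((hasDerivAt_id (0 : ℝ)).smul_const b).const_add a
    exact (e _ _).prodMk (e _ _)
  have h4 : HasDerivAt (fun t : ℝ => (u + t • v, -w + t • christoffelL D x₀ u v w))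
      (v, christoffelL D x₀ u v w) 0 := by
    have e : ∀ a b : Coord n, HasDerivAt (fun t : ℝ => a + t • b) b 0 := fun a b => by
      simpa using ((hasDerivAt_id (0 : ℝ)).smul_const b).const_add a
    exact (e _ _).prodMk (e _ _)
  have h1' := h1.comp_hasDerivAt_of_eq (0 : ℝ) h3 (by simp)
  have h2' := h2.comp_hasDerivAt_of_eq (0 : ℝ) h4 (by simp)
  rw [h.fderiv_eq_zero hD hu hw] at h1'
  have h5 := h.fderiv_eq_zero hD hu hw' v
  rw [map_neg, neg_neg] at h5
  rw [h5] at h2'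
  have h6 := (h1'.sub h2').div_const 2
  have h7 : HasDerivAt (fun t : ℝ => formCoord β x₀ (u + t • v)
      (w + t • (-christoffelL D x₀ u v w))) ((0 - 0) / 2) 0 := by
    refine h6.congr_of_eventuallyEq (Filter.Eventually.of_forall fun t => ?_)
    change formCoord β x₀ (u + t • v) (w + t • (-christoffelL D x₀ u v w)) = _
    rw [formCoord_eq_of_isRanders hR]
    simp [sub_eq_add_neg, add_comm]
  have h8 := ((contDiffAt_formCoord β hu).differentiableAt (by simp)).hasFDerivAt
  have h9 := h8.comp_hasDerivAt_of_eq (0 : ℝ) (hasDerivAt_fst_snd h3).1 (by simp)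
  have h10 := h9.clm_apply (hasDerivAt_fst_snd h3).2
  have h11 := h10.unique h7
  simp only [Function.comp_apply, zero_smul, add_zero, map_neg] at h11
  linarith

/-- As `β` is parallel, `dβ` is `β` applied to the torsion. The torsion lies in the line of `τ`, and
where `τ ≠ 0` the norm takes equal values on `τ` and `-τ`, so its odd part `β` kills `τ`. -/
theorem isClosed_of_isDouglas [T2Space M] (hR : IsRanders F α β) (hF : IsDouglas F)
    {D : AffineConnection 2 M} (h : PreservedBy F D) (hD : D.ContMDiffCovariantDerivative ∞) :
    β.IsClosed := by
  obtain ⟨D', hD'⟩ := hF.exists_sprayVec_eq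
  rw [OneForm.isClosed_iff]
  intro x₀ u hu v w
  rw [hR.fderiv_formCoord h hD hu, hR.fderiv_formCoord h hD hu, ← sub_eq_zero, ← map_sub,
    alternating_eq, map_smul]
  set τ := christoffelL D x₀ u (EuclideanSpace.single 0 1) (EuclideanSpace.single 1 1) -
      christoffelL D x₀ u (EuclideanSpace.single 1 1) (EuclideanSpace.single 0 1) with hτ
  by_cases hτ0 : τ = 0
  · simp [hτ0]
  · have h1 := (isRandersNorm_of_torsion h hD hu (hD' x₀ u hu) hτ hτ0).2
    rw [formCoord_eq_of_isRanders hR, h1]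
    simp

theorem berwald_or_randers [T2Space M] [ConnectedSpace M] (hF : IsDouglas F)
    (hF' : IsGeneralizedBerwald F) :
    IsBerwald F ∨ ∃ (α : RiemannianMetric 2 M) (β : OneForm 2 M),
      IsRanders F α β ∧ β.IsClosed ∧ HasConstantLength α β := by
  obtain ⟨D, hD, h⟩ := hF'
  by_cases hT : D.torsion = 0
  · exact Or.inl ⟨D, hD, hT, h⟩
  · obtain ⟨α, β, hR⟩ := exists_isRanders
      (fun x => isRandersNorm_of_torsion_ne_zero hF h hD hT x)
    exact Or.inr ⟨α, β, hR, isClosed_of_isDouglas hR hF h hD, hR.hasConstantLength h hD⟩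

end Forward

/-! ### Construction of a connection from Christoffel symbols. -/

section ConnectionOfChristoffel

variable {n : ℕ} {M : Type*} [TopologicalSpace M] [ChartedSpace (Coord n) M]
  [IsManifold (𝓡 n) ∞ M]

theorem components_add (x₀ : M) (σ ρ : ∀ x : M, TangentSpace (𝓡 n) x) :
    components x₀ (σ + ρ) = components x₀ σ + components x₀ ρ :=
  funext fun _ => coordVec_add _ _ _ _

theorem components_smul (x₀ : M) (g : M → ℝ) (σ : ∀ x : M, TangentSpace (𝓡 n) x) :
    components x₀ (g • σ) = fun u => (g ∘ (extChartAt (𝓡 n) x₀).symm) u • components x₀ σ u :=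
  funext fun _ => coordVec_smul _ _ _ _

theorem components_coordField {x₀ : M} {u : Coord n} (hu : u ∈ (extChartAt (𝓡 n) x₀).target)
    (w : Coord n) : components x₀ (coordField x₀ w) =ᶠ[𝓝 u] fun _ => w := by
  filter_upwards [(isOpen_target x₀).mem_nhds hu] with z hz
  exact coordVec_coordField (mem_chart_target hz) w

/-- The connection with prescribed Christoffel symbols at each point `x`, in the preferred chart
at `x`. -/
def connectionOfChristoffel (Γ : M → Coord n →L[ℝ] Coord n →L[ℝ] Coord n) :
    AffineConnection n M where
  toFun σ x := ((trivializationAt (Coord n) (TangentSpace (𝓡 n) (M := M)) x).symmL ℝ x).comp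
    ((fderiv ℝ (components x σ) (extChartAt (𝓡 n) x x) + (Γ x).flip (coordVec x x (σ x))).comp
      ((trivializationAt (Coord n) (TangentSpace (𝓡 n) (M := M)) x).continuousLinearMapAt ℝ x))
  isCovariantDerivativeOnUniv :=
    { add := by
        intro σ ρ x hσ hρ _
        have hx := mem_chart_source (Coord n) x
        have h1 : coordVec x x ((σ + ρ) x) = coordVec x x (σ x) + coordVec x x (ρ x) :=
          coordVec_add _ _ _ _
        rw [components_add, fderiv_add (differentiableAt_components hx hσ)
          (differentiableAt_components hx hρ), h1, map_add, ← ContinuousLinearMap.comp_add,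
          ← ContinuousLinearMap.add_comp]
        congr 2
        abel
      leibniz := by
        intro σ g x hσ hg _
        have hx := mem_chart_source (Coord n) x
        have hg' := (mdiffAt_iff_coord hx g).1 hg
        have h1 : coordVec x x ((g • σ) x) = g x • coordVec x x (σ x) := coordVec_smul _ _ _ _
        refine ContinuousLinearMap.ext fun v => ?_
        change coordField x (fderiv ℝ (components x (g • σ)) (extChartAt (𝓡 n) x x) (coordVec x x v) +
          Γ x (coordVec x x v) (coordVec x x ((g • σ) x))) x = g x • coordField x (fderiv ℝ
            (components x σ) (extChartAt (𝓡 n) x x) (coordVec x x v) +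
          Γ x (coordVec x x v) (coordVec x x (σ x))) x + mvfderiv (𝓡 n) g x v • σ x
        rw [components_smul, fderiv_fun_smul hg' (differentiableAt_components hx hσ), h1,
          mvfderiv_eq_fderiv_coord hx hg, ← coordField_smul]
        conv_rhs => rw [← coordField_coordVec hx (σ x), ← coordField_smul, ← coordField_add]
        congr 1
        rw [components_extChartAt hx]
        simp only [add_apply, smul_apply, ContinuousLinearMap.smulRight_apply, map_smul,
          Function.comp_apply, extChartAt_symm_left hx, coordVec_coordField hx]
        module }

theorem christoffel_connectionOfChristoffel (Γ : M → Coord n →L[ℝ] Coord n →L[ℝ] Coord n) (x : M)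
    (v w : Coord n) : christoffel (connectionOfChristoffel Γ) x x v w = Γ x v w := by
  have hx := mem_chart_source (Coord n) x
  change coordVec x x (coordField x (fderiv ℝ (components x (coordField x w)) (extChartAt (𝓡 n) x x)
    (coordVec x x (coordField x v x)) + Γ x (coordVec x x (coordField x v x))
      (coordVec x x (coordField x w x))) x) = _
  rw [(components_coordField (extChartAt_mem_target hx) w).fderiv_eq]
  simp [coordVec_coordField hx]

end ConnectionOfChristoffel

/-! ### Metric connections and the Levi-Civita connection. -/

section MetricConnections

set_option synthInstance.maxHeartbeats 400000

variable {n : ℕ} {M : Type*} [TopologicalSpace M] [ChartedSpace (Coord n) M]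
  [IsManifold (𝓡 n) ∞ M]

/-- The metric `α` is parallel with respect to `D` in the chart at `x₀`, at the point with
coordinates `u`. -/
def IsMetricAt (α : RiemannianMetric n M) (D : AffineConnection n M) (x₀ : M) (u : Coord n) : Prop :=
  ∀ v a b : Coord n, fderiv ℝ (metricCoord α x₀) u v a b =
    metricCoord α x₀ u (christoffelL D x₀ u v a) b + metricCoord α x₀ u a (christoffelL D x₀ u v b)

theorem inner_comp_symm (α : RiemannianMetric n M) {x₀ : M} {u : Coord n}
    (hu : u ∈ (extChartAt (𝓡 n) x₀).target) (σ ρ : ∀ x : M, TangentSpace (𝓡 n) x) :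
    (fun z => α.inner z (σ z) (ρ z)) ∘ (extChartAt (𝓡 n) x₀).symm =ᶠ[𝓝 u]
      fun u => metricCoord α x₀ u (components x₀ σ u) (components x₀ ρ u) := by
  filter_upwards [(isOpen_target x₀).mem_nhds hu] with z hz
  rw [metricCoord_apply, components, components, coordField_coordVec (mem_chart_target hz),
    coordField_coordVec (mem_chart_target hz)]
  rfl

theorem mdifferentiableAt_inner (α : RiemannianMetric n M) {x : M}
    {σ ρ : ∀ x : M, TangentSpace (𝓡 n) x} (hσ : FieldDiffAt σ x) (hρ : FieldDiffAt ρ x) :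
    MDifferentiableAt (𝓡 n) 𝓘(ℝ, ℝ) (fun z => α.inner z (σ z) (ρ z)) x := by
  have hx := mem_chart_source (Coord n) x
  have hu := extChartAt_mem_target hx
  rw [mdiffAt_iff_coord hx]
  refine DifferentiableAt.congr_of_eventuallyEq ?_ (inner_comp_symm α hu σ ρ)
  exact (((contDiffAt_metricCoord α hu).differentiableAt (by simp)).clm_apply
    (differentiableAt_components hx hσ)).clm_apply (differentiableAt_components hx hρ)

/-- The product rule for the metric does not mention a chart. Together with
`isMetricAt_of_mvfderiv_inner` it moves metric compatibility from one chart to any other. -/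
theorem IsMetricAt.mvfderiv_inner {α : RiemannianMetric n M} {D : AffineConnection n M} {x₀ x : M}
    (hx : x ∈ (chartAt (Coord n) x₀).source) (h : IsMetricAt α D x₀ (extChartAt (𝓡 n) x₀ x))
    {σ ρ : ∀ x : M, TangentSpace (𝓡 n) x} (hσ : FieldDiffAt σ x) (hρ : FieldDiffAt ρ x)
    (v : TangentSpace (𝓡 n) x) :
    mvfderiv (𝓡 n) (fun z => α.inner z (σ z) (ρ z)) x v =
      α.inner x (D σ x v) (ρ x) + α.inner x (σ x) (D ρ x v) := by
  have hu := extChartAt_mem_target hx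
  rw [mvfderiv_eq_fderiv_coord hx (mdifferentiableAt_inner α hσ hρ),
    (inner_comp_symm α hu σ ρ).fderiv_eq]
  have h1 := ((contDiffAt_metricCoord α hu).differentiableAt (by simp)).hasFDerivAt
  have h2 := (differentiableAt_components hx hσ).hasFDerivAt
  have h3 := (differentiableAt_components hx hρ).hasFDerivAt
  have h4 := h1.clm_apply h2
  have h5 := h4.clm_apply h3
  rw [h5.fderiv, ← metricCoord_extChartAt α hx, ← metricCoord_extChartAt α hx, coordVec_cov D hx hσ,
    coordVec_cov D hx hρ, christoffel_eq_christoffelL D hx, christoffel_eq_christoffelL D hx]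
  have h6 := h (coordVec x₀ x v) (coordVec x₀ x (σ x)) (coordVec x₀ x (ρ x))
  simp only [components_extChartAt hx, add_apply, ContinuousLinearMap.comp_apply,
    ContinuousLinearMap.flip_apply, map_add, h6]
  ring

theorem isMetricAt_of_mvfderiv_inner {α : RiemannianMetric n M} {D : AffineConnection n M} {x₀ : M}
    {u : Coord n} (hu : u ∈ (extChartAt (𝓡 n) x₀).target)
    (h : ∀ σ ρ : ∀ x : M, TangentSpace (𝓡 n) x, FieldDiffAt σ ((extChartAt (𝓡 n) x₀).symm u) →
      FieldDiffAt ρ ((extChartAt (𝓡 n) x₀).symm u) →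
      ∀ v, mvfderiv (𝓡 n) (fun z => α.inner z (σ z) (ρ z)) ((extChartAt (𝓡 n) x₀).symm u) v =
      α.inner _ (D σ _ v) (ρ _) + α.inner _ (σ _) (D ρ _ v)) : IsMetricAt α D x₀ u := by
  intro v a b
  have hx := mem_chart_target hu
  have ha := fieldDiffAt_coordField hx a
  have hb := fieldDiffAt_coordField hx b
  have h1 := h _ _ ha hb (coordField x₀ v _)
  rw [mvfderiv_eq_fderiv_coord hx (mdifferentiableAt_inner α ha hb), coordVec_coordField hx,
    extChartAt_symm_right hu] at h1
  have h2 : (fun z => α.inner z (coordField x₀ a z) (coordField x₀ b z)) ∘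
    (extChartAt (𝓡 n) x₀).symm = fun u => metricCoord α x₀ u a b := rfl
  have h3 := ((contDiffAt_metricCoord α hu).differentiableAt (by simp)).hasFDerivAt
  have h4 := h3.clm_apply (hasFDerivAt_const a u)
  have h5 := h4.clm_apply (hasFDerivAt_const b u)
  rw [h2, h5.fderiv, ← metricCoord_extChartAt α hx, ← metricCoord_extChartAt α hx,
    extChartAt_symm_right hu, coordVec_coordField hx, coordVec_coordField hx] at h1
  rw [christoffelL_apply D hu, christoffelL_apply D hu]
  simp only [zero_add, ContinuousLinearMap.comp_zero, ContinuousLinearMap.flip_apply] at h1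
  exact h1

theorem exists_equiv_of_pos {q : Coord n →L[ℝ] Coord n →L[ℝ] ℝ} (hq : ∀ v ≠ 0, 0 < q v v) :
    ∃ e : Coord n ≃L[ℝ] (Coord n →L[ℝ] ℝ), (e : Coord n →L[ℝ] Coord n →L[ℝ] ℝ) = q := by
  have hb : Function.Bijective q.toLinearMap := by
    refine ⟨(injective_iff_map_eq_zero q.toLinearMap).2 fun v hv => ?_, fun ℓ => ?_⟩
    · by_contra h
      have := hq v h
      have h' : q v = 0 := hv
      rw [h'] at this
      exact lt_irrefl _ this
    · obtain ⟨c, hc⟩ := exists_dual_vector (q := ContinuousLinearMap.coeLM ℝ ∘ₗ q.toLinearMap) hq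
        ℓ.toLinearMap
      exact ⟨c, ContinuousLinearMap.ext hc⟩
  exact ⟨(LinearEquiv.ofBijective q.toLinearMap hb).toContinuousLinearEquiv, rfl⟩

theorem apply_inverse_of_pos {q : Coord n →L[ℝ] Coord n →L[ℝ] ℝ} (hq : ∀ v ≠ 0, 0 < q v v)
    (ℓ : Coord n →L[ℝ] ℝ) : q (q.inverse ℓ) = ℓ := by
  obtain ⟨e, rfl⟩ := exists_equiv_of_pos hq
  rw [ContinuousLinearMap.inverse_equiv]
  exact e.apply_symm_apply ℓ

theorem inverse_apply_of_pos {q : Coord n →L[ℝ] Coord n →L[ℝ] ℝ} (hq : ∀ v ≠ 0, 0 < q v v)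
    (v : Coord n) : q.inverse (q v) = v := by
  obtain ⟨e, rfl⟩ := exists_equiv_of_pos hq
  rw [ContinuousLinearMap.inverse_equiv]
  exact e.symm_apply_apply v

theorem contDiffAt_inverse_metricCoord (α : RiemannianMetric n M) {x₀ : M} {u : Coord n}
    (hu : u ∈ (extChartAt (𝓡 n) x₀).target) :
    ContDiffAt ℝ ∞ (fun u => (metricCoord α x₀ u).inverse) u := by
  obtain ⟨e, he⟩ := exists_equiv_of_pos fun v hv => metricCoord_pos α hu hv
  have h1 := contDiffAt_map_inverse (n := ∞) e
  rw [he] at h1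
  exact h1.comp u (contDiffAt_metricCoord α hu)

instance normedAddCommGroup_bilin : NormedAddCommGroup (Coord n →L[ℝ] Coord n →L[ℝ] ℝ) :=
  ContinuousLinearMap.toNormedAddCommGroup

instance normedSpace_bilin : NormedSpace ℝ (Coord n →L[ℝ] Coord n →L[ℝ] ℝ) :=
  ContinuousLinearMap.toNormedSpace

/-- The right-hand side of the Koszul formula for the derivative `B` of a metric. -/
def koszulForm (B : Coord n →L[ℝ] Coord n →L[ℝ] Coord n →L[ℝ] ℝ) (v w : Coord n) : Coord n →L[ℝ] ℝ :=
  (1 / 2 : ℝ) • (B v w + B w v - (B.flip v).flip w)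

theorem koszulForm_apply (B : Coord n →L[ℝ] Coord n →L[ℝ] Coord n →L[ℝ] ℝ) (v w z : Coord n) :
    koszulForm B v w z = (1 / 2) * (B v w z + B w v z - B z v w) := rfl

/-- The Christoffel symbols of a metric `q` with the derivative `B`. -/
def koszul (q : Coord n →L[ℝ] Coord n →L[ℝ] ℝ) (B : Coord n →L[ℝ] Coord n →L[ℝ] Coord n →L[ℝ] ℝ) :
    Coord n →L[ℝ] Coord n →L[ℝ] Coord n :=
  (LinearMap.mk₂ ℝ (fun v w => q.inverse (koszulForm B v w))
    (fun v v' w => by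
      rw [← map_add]
      congr 1
      ext z
      simp only [koszulForm_apply, add_apply, map_add]
      ring)
    (fun a v w => by
      rw [← map_smul]
      congr 1
      ext z
      simp only [koszulForm_apply, smul_apply, map_smul, smul_eq_mul]
      ring)
    (fun v w w' => by
      rw [← map_add]
      congr 1
      ext z
      simp only [koszulForm_apply, add_apply, map_add]
      ring)
    (fun a v w => by
      rw [← map_smul]
      congr 1
      ext z
      simp only [koszulForm_apply, smul_apply, map_smul, smul_eq_mul]
      ring)).toContinuousBilinearMap

theorem koszul_apply (q : Coord n →L[ℝ] Coord n →L[ℝ] ℝ)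
    (B : Coord n →L[ℝ] Coord n →L[ℝ] Coord n →L[ℝ] ℝ) (v w : Coord n) :
    koszul q B v w = q.inverse (koszulForm B v w) := rfl

theorem fderiv_metricCoord_symm (α : RiemannianMetric n M) {x₀ : M} {u : Coord n}
    (hu : u ∈ (extChartAt (𝓡 n) x₀).target) (v a b : Coord n) :
    fderiv ℝ (metricCoord α x₀) u v a b = fderiv ℝ (metricCoord α x₀) u v b a := by
  have h3 := ((contDiffAt_metricCoord α hu).differentiableAt (by simp)).hasFDerivAt
  have h4 : ∀ a b, fderiv ℝ (fun u => metricCoord α x₀ u a b) u v =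
      fderiv ℝ (metricCoord α x₀) u v a b := by
    intro a b
    have e1 := h3.clm_apply (hasFDerivAt_const a u)
    have e2 := e1.clm_apply (hasFDerivAt_const b u)
    rw [e2.fderiv]
    simp
  rw [← h4, ← h4]
  simp only [metricCoord_symm α x₀ _ a b]

theorem metricCoord_koszul (α : RiemannianMetric n M) {x₀ : M} {u : Coord n}
    (hu : u ∈ (extChartAt (𝓡 n) x₀).target) (v w z : Coord n) :
    metricCoord α x₀ u (koszul (metricCoord α x₀ u) (fderiv ℝ (metricCoord α x₀) u) v w) z =
      koszulForm (fderiv ℝ (metricCoord α x₀) u) v w z := by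
  rw [koszul_apply, apply_inverse_of_pos fun v hv => metricCoord_pos α hu hv]

/-- The Christoffel symbols of a torsion-free metric connection are given by the Koszul formula. -/
theorem eq_koszul {α : RiemannianMetric n M} {D : AffineConnection n M} {x₀ : M} {u : Coord n}
    (hu : u ∈ (extChartAt (𝓡 n) x₀).target) (h : IsMetricAt α D x₀ u)
    (hs : ∀ v w, christoffelL D x₀ u v w = christoffelL D x₀ u w v) :
    christoffelL D x₀ u = koszul (metricCoord α x₀ u) (fderiv ℝ (metricCoord α x₀) u) := by
  refine ContinuousLinearMap.ext fun v => ContinuousLinearMap.ext fun w => ?_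
  rw [koszul_apply, ← inverse_apply_of_pos (fun v hv => metricCoord_pos α hu hv)
    (christoffelL D x₀ u v w)]
  congr 1
  ext z
  rw [koszulForm_apply, h v w z, h w v z, h z v w, hs w v, hs z v, hs z w, metricCoord_symm α x₀ u v,
    metricCoord_symm α x₀ u w]
  ring

theorem contDiffAt_koszul [T2Space M] (α : RiemannianMetric n M) {x₀ : M} {u : Coord n}
    (hu : u ∈ (extChartAt (𝓡 n) x₀).target) :
    ContDiffAt ℝ ∞ (fun u => koszul (metricCoord α x₀ u) (fderiv ℝ (metricCoord α x₀) u)) u := by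
  refine contDiffAt_clm_of_apply fun v => contDiffAt_clm_of_apply fun w => ?_
  simp only [koszul_apply]
  refine (contDiffAt_inverse_metricCoord α hu).clm_apply (contDiffAt_clm_of_apply fun z => ?_)
  have h1 : ContDiffAt ℝ ∞ (fderiv ℝ (metricCoord α x₀)) u :=
    (contDiffAt_metricCoord α hu).fderiv_right (by simp)
  have h2 : ∀ a b c : Coord n, ContDiffAt ℝ ∞ (fun u => fderiv ℝ (metricCoord α x₀) u a b c) u := by
    intro a b c
    have e1 := h1.clm_apply (contDiffAt_const (c := a))
    have e2 := e1.clm_apply (contDiffAt_const (c := b))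
    exact e2.clm_apply contDiffAt_const
  simp only [koszulForm_apply]
  exact contDiffAt_const.mul (((h2 v w z).add (h2 w v z)).sub (h2 z v w))

/-- The Levi-Civita connection. -/
theorem exists_leviCivita [T2Space M] (α : RiemannianMetric n M) :
    ∃ D : AffineConnection n M, D.ContMDiffCovariantDerivative ∞ ∧ D.torsion = 0 ∧
      ∀ x₀ : M, ∀ u ∈ (extChartAt (𝓡 n) x₀).target, IsMetricAt α D x₀ u := by
  -- At each point the Koszul symbols are prescribed in the preferred chart of that very point, so
  -- no gluing is needed, but smoothness is not yet visible.
  set D : AffineConnection n M := connectionOfChristoffel fun x =>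
    koszul (metricCoord α x (extChartAt (𝓡 n) x x))
      (fderiv ℝ (metricCoord α x) (extChartAt (𝓡 n) x x)) with hD
  have hΓ : ∀ x, christoffelL D x (extChartAt (𝓡 n) x x) =
      koszul (metricCoord α x (extChartAt (𝓡 n) x x))
      (fderiv ℝ (metricCoord α x) (extChartAt (𝓡 n) x x)) := by
    intro x
    refine ContinuousLinearMap.ext fun v => ContinuousLinearMap.ext fun w => ?_
    rw [← christoffel_eq_christoffelL D (mem_chart_source _ x), hD,
      christoffel_connectionOfChristoffel]
  have hT : D.torsion = 0 := by
    refine torsion_eq_zero_of_christoffel_symm fun x v w => ?_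
    have hu := extChartAt_mem_target (mem_chart_source (Coord n) x)
    rw [christoffel_eq_christoffelL D (mem_chart_source _ x),
      christoffel_eq_christoffelL D (mem_chart_source _ x), hΓ, koszul_apply, koszul_apply]
    congr 1
    ext z
    rw [koszulForm_apply, koszulForm_apply, fderiv_metricCoord_symm α hu z v w]
    ring
  have hM : ∀ x, IsMetricAt α D x (extChartAt (𝓡 n) x x) := by
    intro x v a b
    have hu := extChartAt_mem_target (mem_chart_source (Coord n) x)
    rw [hΓ, metricCoord_koszul α hu, metricCoord_symm α x _ a, metricCoord_koszul α hu,
      koszulForm_apply, koszulForm_apply, fderiv_metricCoord_symm α hu v b a]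
    ring
  -- Compatibility is known at the centre of each preferred chart; its invariant form carries it to
  -- all charts.
  have hM' : ∀ x₀ : M, ∀ u ∈ (extChartAt (𝓡 n) x₀).target, IsMetricAt α D x₀ u := fun x₀ u hu =>
    isMetricAt_of_mvfderiv_inner hu fun σ ρ hσ hρ v =>
      (hM _).mvfderiv_inner (mem_chart_source _ _) hσ hρ v
  refine ⟨D, smooth_of_christoffelL D fun x₀ u hu => ?_, hT, hM'⟩
  -- Uniqueness gives smoothness: in any fixed chart a torsion-free metric connection has the Koszul
  -- symbols, which depend smoothly on the point.
  refine (contDiffAt_koszul α hu).congr_of_eventuallyEq ?_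
  filter_upwards [(isOpen_target x₀).mem_nhds hu] with z hz
  exact eq_koszul hz (hM' x₀ z hz) (christoffel_symm_of_torsion_eq_zero hT hz)

end MetricConnections

/-! ### Randers metrics with a form of constant length are generalized Berwald. -/

section ParallelRanders

set_option synthInstance.maxHeartbeats 400000

variable {n : ℕ} {M : Type*} [TopologicalSpace M] [ChartedSpace (Coord n) M]
  [IsManifold (𝓡 n) ∞ M]

/-- The 1-form `β` is parallel with respect to `D` in the chart at `x₀`, at the point with
coordinates `u`. -/
def IsParallelFormAt (β : OneForm n M) (D : AffineConnection n M) (x₀ : M) (u : Coord n) : Prop :=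
  ∀ v w : Coord n, fderiv ℝ (formCoord β x₀) u v w = formCoord β x₀ u (christoffelL D x₀ u v w)

theorem constant_of_hasDerivAt {J : Set ℝ} (hJ : IsOpen J) (hJ' : J.OrdConnected) {f : ℝ → ℝ}
    (hf : ∀ t ∈ J, HasDerivAt f 0 t) {s t : ℝ} (hs : s ∈ J) (ht : t ∈ J) : f s = f t := by
  obtain ⟨a, ha⟩ := hJ.exists_is_const_of_deriv_eq_zero hJ'.isPreconnected
    (fun t ht => (hf t ht).differentiableAt.differentiableWithinAt) fun t ht => (hf t ht).deriv
  rw [ha s hs, ha t ht]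

/-- Along a parallel field `X` both `α(X, X)` and `β(X)` have zero derivative. -/
theorem preservedBy_of_parallel {F : FinslerMetric n M} {α : RiemannianMetric n M}
    {β : OneForm n M} (hR : IsRanders F α β) {D : AffineConnection n M}
    (hα : ∀ x₀ : M, ∀ u ∈ (extChartAt (𝓡 n) x₀).target, IsMetricAt α D x₀ u)
    (hβ : ∀ x₀ : M, ∀ u ∈ (extChartAt (𝓡 n) x₀).target, IsParallelFormAt β D x₀ u) :
    PreservedBy F D := by
  intro J c X hc hX s hs t ht
  have key : ∀ t ∈ J, HasDerivAt (fun s => α.inner (c s) (X s) (X s)) 0 t ∧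
      HasDerivAt (fun s => β.toFun (c s) (X s)) 0 t := by
    intro t ht
    have hct := hc.smoothAt ht
    have hx : c t ∈ (chartAt (Coord n) (c t)).source := mem_chart_source _ _
    have hu := extChartAt_mem_target hx
    have h1 := hasDerivAt_chart_comp hct hx
    have h2 := hX t ht (c t) hx
    rw [christoffel_eq_christoffelL D hx] at h2
    have hev := eventually_mem_source hct hx
    constructor
    · have h3 := ((contDiffAt_metricCoord α hu).differentiableAt (by simp)).hasFDerivAt
      have h4 := h3.comp_hasDerivAt t h1
      have h5 := h4.clm_apply h2
      have h6 := h5.clm_apply h2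
      refine (h6.congr_deriv ?_).congr_of_eventuallyEq ?_
      · simp only [add_apply, Function.comp_apply, map_neg, neg_apply]
        rw [hα _ _ hu]
        ring
      · filter_upwards [hev] with s hs
        exact (metricCoord_extChartAt α hs _ _).symm
    · have h3 := ((contDiffAt_formCoord β hu).differentiableAt (by simp)).hasFDerivAt
      have h4 := h3.comp_hasDerivAt t h1
      have h5 := h4.clm_apply h2
      refine (h5.congr_deriv ?_).congr_of_eventuallyEq ?_
      · simp only [Function.comp_apply, map_neg]
        rw [hβ _ _ hu]
        ring
      · filter_upwards [hev] with s hs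
        exact (formCoord_extChartAt β hs _).symm
  rw [hR, hR, constant_of_hasDerivAt hc.1 hc.2.1 (fun t ht => (key t ht).1) hs ht,
    constant_of_hasDerivAt hc.1 hc.2.1 (fun t ht => (key t ht).2) hs ht]

variable {α : RiemannianMetric n M} {β : OneForm n M} {b : ∀ x : M, TangentSpace (𝓡 n) x}

theorem exists_sharp (α : RiemannianMetric n M) (β : OneForm n M) :
    ∃ b : ∀ x : M, TangentSpace (𝓡 n) x, ∀ x v, α.inner x (b x) v = β.toFun x v := by
  have : ∀ x : M, ∃ c : TangentSpace (𝓡 n) x, ∀ v, α.inner x c v = β.toFun x v := fun x =>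
    exists_dual_vector (q := (ContinuousLinearMap.coeLM ℝ) ∘ₗ (α.inner x).toLinearMap) (α.pos x)
      (β.toFun x).toLinearMap
  choose b hb using this
  exact ⟨b, hb⟩

theorem metricCoord_sharp (hb : ∀ x v, α.inner x (b x) v = β.toFun x v) {x₀ : M} {u : Coord n}
    (hu : u ∈ (extChartAt (𝓡 n) x₀).target) (w : Coord n) :
    metricCoord α x₀ u (components x₀ b u) w = formCoord β x₀ u w := by
  rw [metricCoord_apply, components, coordField_coordVec (mem_chart_target hu), hb]
  rfl

theorem contDiffAt_sharp (hb : ∀ x v, α.inner x (b x) v = β.toFun x v) {x₀ : M} {u : Coord n}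
    (hu : u ∈ (extChartAt (𝓡 n) x₀).target) : ContDiffAt ℝ ∞ (components x₀ b) u := by
  refine ((contDiffAt_inverse_metricCoord α hu).clm_apply
    (contDiffAt_formCoord β hu)).congr_of_eventuallyEq ?_
  filter_upwards [(isOpen_target x₀).mem_nhds hu] with z hz
  rw [← inverse_apply_of_pos (fun v hv => metricCoord_pos α hz hv) (components x₀ b z)]
  congr 1
  exact ContinuousLinearMap.ext (metricCoord_sharp hb hz)

theorem sharp_length (hb : ∀ x v, α.inner x (b x) v = β.toFun x v) {k : ℝ} {x₀ : M} {u : Coord n}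
    (hk : ∑ i, ∑ j, (metricMatrix α x₀ u)⁻¹ i j * β.component x₀ i u * β.component x₀ j u = k)
    (hu : u ∈ (extChartAt (𝓡 n) x₀).target) :
    metricCoord α x₀ u (components x₀ b u) (components x₀ b u) = k := by
  rw [← hk, length_eq α β hu (metricCoord_sharp hb hu), metricCoord_sharp hb hu]

/-- The endomorphism-valued 1-form correcting the Levi-Civita connection of `α` to a metric
connection for which the vector field `b` of length `√k` is parallel. -/
def correction (α : RiemannianMetric n M) (D : AffineConnection n M)
    (b : ∀ x : M, TangentSpace (𝓡 n) x) (k : ℝ) (x : M) :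
    TangentSpace (𝓡 n) x →L[ℝ] TangentSpace (𝓡 n) x →L[ℝ] TangentSpace (𝓡 n) x :=
  (LinearMap.mk₂ ℝ (fun w v => (1 / k) • (α.inner x (D b x v) w • b x - α.inner x (b x) w • D b x v))
    (fun w w' v => by simp only [map_add]; module)
    (fun a w v => by simp only [map_smul, smul_eq_mul]; module)
    (fun w v v' => by simp only [map_add, add_apply]; module)
    (fun a w v => by simp only [map_smul, smul_apply, smul_eq_mul]; module)).toContinuousBilinearMap

variable {D : AffineConnection n M}

/-- The components of the covariant derivative of `b` in the direction of `v`. -/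
def covComponents (D : AffineConnection n M) (b : ∀ x : M, TangentSpace (𝓡 n) x) (x₀ : M)
    (u v : Coord n) : Coord n :=
  fderiv ℝ (components x₀ b) u v + christoffelL D x₀ u v (components x₀ b u)

theorem christoffelL_correction (hb : ∀ x v, α.inner x (b x) v = β.toFun x v) (k : ℝ) {x₀ : M}
    {u : Coord n} (hu : u ∈ (extChartAt (𝓡 n) x₀).target) (v w : Coord n) :
    christoffelL (D.addOneForm (correction α D b k)) x₀ u v w = christoffelL D x₀ u v w +
      (1 / k) • (metricCoord α x₀ u (covComponents D b x₀ u v) w • components x₀ b u -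
        metricCoord α x₀ u (components x₀ b u) w • covComponents D b x₀ u v) := by
  have hx := mem_chart_target hu
  set x := (extChartAt (𝓡 n) x₀).symm u with hxdef
  have hxu : extChartAt (𝓡 n) x₀ x = u := extChartAt_symm_right hu
  have hbs : FieldDiffAt b x := by
    have : FieldSmoothAt b x := by
      rw [fieldSmoothAt_iff_components hx, hxu]
      exact contDiffAt_sharp hb hu
    exact FieldSmoothAt.fieldDiffAt this
  have h1 : coordVec x₀ x (D b x (coordField x₀ v x)) = covComponents D b x₀ u v := by
    rw [coordVec_cov D hx hbs, coordVec_coordField hx, hxu, christoffel_eq_christoffelL D hx, hxu]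
    rfl
  have h2 : D b x (coordField x₀ v x) = coordField x₀ (covComponents D b x₀ u v) x := by
    rw [← h1, coordField_coordVec hx]
  have h3 : b x = coordField x₀ (components x₀ b u) x := (coordField_coordVec hx _).symm
  rw [christoffelL_apply _ hu, christoffelL_apply D hu]
  change coordVec x₀ x (D (coordField x₀ w) x (coordField x₀ v x) + (1 / k) •
    (α.inner x (D b x (coordField x₀ v x)) (coordField x₀ w x) • b x -
      α.inner x (b x) (coordField x₀ w x) • D b x (coordField x₀ v x))) = _
  rw [coordVec_add, coordVec_smul, h2]
  conv_lhs => rw [h3]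
  rw [← coordField_smul, ← coordField_smul, sub_eq_add_neg, ← coordField_neg, ← coordField_add,
    coordVec_coordField hx, ← sub_eq_add_neg]
  rfl

/-- Differentiate `α(b, b) = k`: a vector field of constant length is orthogonal to its covariant
derivatives. -/
theorem metricCoord_covComponents (hb : ∀ x v, α.inner x (b x) v = β.toFun x v) {k : ℝ}
    (hk : ∀ x₀ : M, ∀ u ∈ (extChartAt (𝓡 n) x₀).target,
      ∑ i, ∑ j, (metricMatrix α x₀ u)⁻¹ i j * β.component x₀ i u * β.component x₀ j u = k)
    {x₀ : M} {u : Coord n} (hu : u ∈ (extChartAt (𝓡 n) x₀).target) (h : IsMetricAt α D x₀ u)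
    (v : Coord n) :
    metricCoord α x₀ u (components x₀ b u) (covComponents D b x₀ u v) = 0 := by
  have h1 := ((contDiffAt_metricCoord α hu).differentiableAt (by simp)).hasFDerivAt
  have h2 := ((contDiffAt_sharp hb hu).differentiableAt (by simp)).hasFDerivAt
  have h3 := (h1.clm_apply h2).clm_apply h2
  have h4 : (fun u => metricCoord α x₀ u (components x₀ b u) (components x₀ b u)) =ᶠ[𝓝 u]
      fun _ => k := by
    filter_upwards [(isOpen_target x₀).mem_nhds hu] with z hz using sharp_length hb (hk x₀ z hz) hz
  have h5 := h3.unique ((hasFDerivAt_const k u).congr_of_eventuallyEq h4)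
  have h6 := congrArg (fun A : Coord n →L[ℝ] ℝ => A v) h5
  simp only [add_apply, ContinuousLinearMap.comp_apply, ContinuousLinearMap.flip_apply,
    zero_apply] at h6
  rw [h, metricCoord_symm α x₀ u (fderiv ℝ (components x₀ b) u v),
    metricCoord_symm α x₀ u (christoffelL D x₀ u v (components x₀ b u))] at h6
  rw [covComponents, map_add]
  linarith

/-- The correction is skew for `α`, so the new connection stays metric. It sends `b` to `(1 / k)
(α(∇b, b) b - k ∇b) = -∇b`, so `b` and its dual form `β` become parallel. -/
theorem isGeneralizedBerwald_of_randers [T2Space M] {F : FinslerMetric n M} (hR : IsRanders F α β)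
    (hk : HasConstantLength α β) : IsGeneralizedBerwald F := by
  obtain ⟨k, hk⟩ := hk
  obtain ⟨b, hb⟩ := exists_sharp α β
  obtain ⟨D, hD, -, hM⟩ := exists_leviCivita α
  have hΓ : ∀ x₀ : M, ∀ u ∈ (extChartAt (𝓡 n) x₀).target, ∀ v w,
      christoffelL (D.addOneForm (correction α D b k)) x₀ u v w = _ :=
    fun x₀ u hu v w => christoffelL_correction (D := D) hb k hu v w
  refine ⟨D.addOneForm (correction α D b k), smooth_of_christoffelL _ fun x₀ u hu => ?_,
    preservedBy_of_parallel hR (fun x₀ u hu v w z => ?_) (fun x₀ u hu v w => ?_)⟩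
  · refine contDiffAt_clm_of_apply fun v => contDiffAt_clm_of_apply fun w => ?_
    have hB := contDiffAt_sharp hb hu
    have hB' : ContDiffAt ℝ ∞ (fderiv ℝ (components x₀ b)) u := hB.fderiv_right (by simp)
    have hG := contDiffAt_metricCoord α hu
    have hC := contDiffAt_christoffelL D hD hu
    have hCv := hC.clm_apply (contDiffAt_const (c := v))
    have hN : ContDiffAt ℝ ∞ (fun u => covComponents D b x₀ u v) u :=
      (hB'.clm_apply contDiffAt_const).add (hCv.clm_apply hB)
    have h1 := (hG.clm_apply hN).clm_apply (contDiffAt_const (c := w))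
    have h2 := (hG.clm_apply hB).clm_apply (contDiffAt_const (c := w))
    refine ((hCv.clm_apply (contDiffAt_const (c := w))).add
      (((h1.smul hB).sub (h2.smul hN)).const_smul (1 / k))).congr_of_eventuallyEq ?_
    filter_upwards [(isOpen_target x₀).mem_nhds hu] with z hz using hΓ x₀ z hz v w
  · rw [hM x₀ u hu, hΓ x₀ u hu, hΓ x₀ u hu]
    simp only [map_add, map_sub, map_smul, add_apply, sub_apply, smul_apply, smul_eq_mul]
    rw [metricCoord_symm α x₀ u w (components x₀ b u),
      metricCoord_symm α x₀ u w (covComponents D b x₀ u v)]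
    ring
  · have h1 := ((contDiffAt_metricCoord α hu).differentiableAt (by simp)).hasFDerivAt
    have h2 := ((contDiffAt_sharp hb hu).differentiableAt (by simp)).hasFDerivAt
    have h3 := (h1.clm_apply h2).clm_apply (hasFDerivAt_const w u)
    have h4 : (fun u => formCoord β x₀ u w) =ᶠ[𝓝 u]
        fun u => metricCoord α x₀ u (components x₀ b u) w := by
      filter_upwards [(isOpen_target x₀).mem_nhds hu] with z hz using (metricCoord_sharp hb hz w).symm
    -- The covariant derivative of `β` is dual to that of `b`, because the Levi-Civita connection is
    -- metric.
    have h5 : fderiv ℝ (formCoord β x₀) u v w = metricCoord α x₀ u (covComponents D b x₀ u v) w +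
        metricCoord α x₀ u (components x₀ b u) (christoffelL D x₀ u v w) := by
      rw [← fderiv_formCoord_apply β hu, h4.fderiv_eq, h3.fderiv]
      simp only [add_apply, ContinuousLinearMap.comp_apply, ContinuousLinearMap.flip_apply,
        zero_apply, map_zero, zero_add]
      rw [hM x₀ u hu, covComponents, map_add, add_apply]
      ring
    rw [h5, hΓ x₀ u hu, ← metricCoord_sharp hb hu]
    simp only [map_add, map_sub, map_smul, smul_eq_mul]
    rw [metricCoord_covComponents hb hk hu (hM x₀ u hu), sharp_length hb (hk x₀ u hu) hu]
    -- If `k = 0` then `b` vanishes identically, along with its covariant derivative, and nothing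
    -- needs correcting.
    by_cases hk0 : k = 0
    · have h6 : components x₀ b =ᶠ[𝓝 u] fun _ => 0 := by
        filter_upwards [(isOpen_target x₀).mem_nhds hu] with z hz
        by_contra hne
        have := metricCoord_pos α hz hne
        rw [sharp_length hb (hk x₀ z hz) hz, hk0] at this
        exact lt_irrefl _ this
      have h7 : covComponents D b x₀ u v = 0 := by
        rw [covComponents, h6.fderiv_eq, h6.eq_of_nhds]
        simp
      rw [h7, hk0]
      simp
    · field_simp
      ring

end ParallelRanders

/-! ### Sprays of Berwald metrics and of Randers metrics with closed form. -/

section RandersSpray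

set_option synthInstance.maxHeartbeats 400000

variable {n : ℕ} {M : Type*} [TopologicalSpace M] [ChartedSpace (Coord n) M]
  [IsManifold (𝓡 n) ∞ M] {α : RiemannianMetric n M} {β : OneForm n M} {x₀ : M} {u y : Coord n}

theorem contDiffAt_metricSq (hu : u ∈ (extChartAt (𝓡 n) x₀).target) (y : Coord n) :
    ContDiffAt ℝ ∞ (fun p : Coord n × Coord n => metricCoord α x₀ p.1 p.2 p.2) (u, y) := by
  have h1 : ContDiffAt ℝ ∞ (fun p : Coord n × Coord n => metricCoord α x₀ p.1) (u, y) :=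
    ContDiffAt.comp (g := metricCoord α x₀) (f := Prod.fst) (u, y) (contDiffAt_metricCoord α hu) contDiffAt_fst
  exact (h1.clm_apply contDiffAt_snd).clm_apply contDiffAt_snd

theorem fderiv_metricSq (hu : u ∈ (extChartAt (𝓡 n) x₀).target) (y v z : Coord n) :
    fderiv ℝ (fun p : Coord n × Coord n => metricCoord α x₀ p.1 p.2 p.2) (u, y) (v, z) =
      fderiv ℝ (metricCoord α x₀) u v y y + 2 * metricCoord α x₀ u y z := by
  have h1 := ((contDiffAt_metricCoord α hu).differentiableAt (by simp)).hasFDerivAt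
  have h2 : HasFDerivAt (fun p : Coord n × Coord n => metricCoord α x₀ p.1) _ (u, y) :=
    HasFDerivAt.comp (u, y) (f := Prod.fst) h1 hasFDerivAt_fst
  have h3 := (h2.clm_apply hasFDerivAt_snd).clm_apply hasFDerivAt_snd
  rw [h3.fderiv]
  simp only [add_apply, ContinuousLinearMap.comp_apply, ContinuousLinearMap.flip_apply,
    ContinuousLinearMap.coe_fst', ContinuousLinearMap.coe_snd']
  rw [metricCoord_symm α x₀ u z y]
  ring

theorem contDiffAt_formPair (hu : u ∈ (extChartAt (𝓡 n) x₀).target) (y : Coord n) :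
    ContDiffAt ℝ ∞ (fun p : Coord n × Coord n => formCoord β x₀ p.1 p.2) (u, y) := by
  have h1 : ContDiffAt ℝ ∞ (fun p : Coord n × Coord n => formCoord β x₀ p.1) (u, y) :=
    ContDiffAt.comp (g := formCoord β x₀) (f := Prod.fst) (u, y) (contDiffAt_formCoord β hu) contDiffAt_fst
  exact h1.clm_apply contDiffAt_snd

theorem fderiv_formPair (hu : u ∈ (extChartAt (𝓡 n) x₀).target) (y v z : Coord n) :
    fderiv ℝ (fun p : Coord n × Coord n => formCoord β x₀ p.1 p.2) (u, y) (v, z) =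
      fderiv ℝ (formCoord β x₀) u v y + formCoord β x₀ u z := by
  have h1 := ((contDiffAt_formCoord β hu).differentiableAt (by simp)).hasFDerivAt
  have h2 : HasFDerivAt (fun p : Coord n × Coord n => formCoord β x₀ p.1) _ (u, y) :=
    HasFDerivAt.comp (u, y) (f := Prod.fst) h1 hasFDerivAt_fst
  have h3 := h2.clm_apply hasFDerivAt_snd
  rw [h3.fderiv]
  simp only [add_apply, ContinuousLinearMap.comp_apply, ContinuousLinearMap.flip_apply,
    ContinuousLinearMap.coe_fst', ContinuousLinearMap.coe_snd']
  ring

theorem contDiffAt_metricNorm (hu : u ∈ (extChartAt (𝓡 n) x₀).target) (hy : y ≠ 0) :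
    ContDiffAt ℝ ∞ (fun p : Coord n × Coord n => √(metricCoord α x₀ p.1 p.2 p.2)) (u, y) :=
  (contDiffAt_metricSq hu y).sqrt (metricCoord_pos α hu hy).ne'

theorem fderiv_metricNorm (hu : u ∈ (extChartAt (𝓡 n) x₀).target) (hy : y ≠ 0)
    {D : AffineConnection n M} (h : IsMetricAt α D x₀ u) (v : Coord n) :
    fderiv ℝ (fun p : Coord n × Coord n => √(metricCoord α x₀ p.1 p.2 p.2)) (u, y)
      (v, -christoffelL D x₀ u v y) = 0 := by
  have h1 := ((contDiffAt_metricSq (α := α) hu y).differentiableAt (by simp)).hasFDerivAt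
  have h2 := h1.sqrt (metricCoord_pos α hu hy).ne'
  rw [h2.fderiv, smul_apply, fderiv_metricSq hu, h, map_neg,
    metricCoord_symm α x₀ u (christoffelL D x₀ u v y) y]
  simp only [smul_eq_mul]
  ring

/-- For a Lagrangian linear in `y` the acceleration drops out, and the expression is `dβ (y, w)`. -/
theorem eulerLagrange_formPair (hβ : β.IsClosed) (hu : u ∈ (extChartAt (𝓡 n) x₀).target)
    (G w : Coord n) :
    eulerLagrange (fun p : Coord n × Coord n => formCoord β x₀ p.1 p.2) G (u, y) w = 0 := by
  have hs := contDiffAt_formPair (β := β) hu y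
  have h1 : (fun q : Coord n × Coord n => fderiv ℝ (fun p : Coord n × Coord n =>
      formCoord β x₀ p.1 p.2) q (0, w)) =ᶠ[𝓝 (u, y)] fun q => formCoord β x₀ q.1 w := by
    have : ∀ᶠ q : Coord n × Coord n in 𝓝 (u, y), q.1 ∈ (extChartAt (𝓡 n) x₀).target :=
      continuousAt_fst.eventually ((isOpen_target x₀).mem_nhds hu)
    filter_upwards [this] with q hq
    have := fderiv_formPair (β := β) hq q.2 0 w
    rw [Prod.mk.eta] at this
    rw [this]
    simp
  have h2 : HasFDerivAt (fun p : Coord n × Coord n => formCoord β x₀ p.1) _ (u, y) :=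
    HasFDerivAt.comp (u, y) (f := Prod.fst)
      ((contDiffAt_formCoord β hu).differentiableAt (by simp)).hasFDerivAt hasFDerivAt_fst
  have h3 := h2.clm_apply (hasFDerivAt_const w (u, y))
  have h4 := fderiv_fderiv_apply hs (y, -G) (0, w)
  rw [h1.fderiv_eq, h3.fderiv] at h4
  rw [eulerLagrange, ← h4, fderiv_formPair hu, (OneForm.isClosed_iff β).1 hβ x₀ u hu w y]
  simp

theorem finslerCoord_of_isRanders {F : FinslerMetric n M} (hR : IsRanders F α β) (x₀ : M) :
    finslerCoord F x₀ = fun p => √(metricCoord α x₀ p.1 p.2 p.2) + formCoord β x₀ p.1 p.2 :=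
  funext fun _ => hR _ _

/-- The norm of `α` is invariant under its torsion-free connection and the closed form contributes
nothing, so the Levi-Civita spray satisfies the Euler-Lagrange equations of `F`. -/
theorem sprayVec_of_isRanders {F : FinslerMetric n M} (hR : IsRanders F α β) (hβ : β.IsClosed)
    {D : AffineConnection n M} (hT : D.torsion = 0)
    (h : ∀ x₀ : M, ∀ u ∈ (extChartAt (𝓡 n) x₀).target, IsMetricAt α D x₀ u)
    (hu : u ∈ (extChartAt (𝓡 n) x₀).target) (hy : y ≠ 0) :
    sprayVec F x₀ (u, y) = christoffelL D x₀ u y y +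
      (fderiv ℝ (finslerCoord F x₀) (u, y) (y, -christoffelL D x₀ u y y) /
        finslerCoord F x₀ (u, y)) • y := by
  refine sprayVec_of_eulerLagrange F hu hy fun w => ?_
  rw [finslerCoord_of_isRanders hR, eulerLagrange_add (contDiffAt_metricNorm hu hy)
    (contDiffAt_formPair hu y), eulerLagrange_formPair hβ hu, add_zero,
    eulerLagrange_of_parallel (contDiffAt_metricNorm hu hy) hy
      fun z hz v => fderiv_metricNorm hu hz (h x₀ u hu) v,
    christoffel_symm_of_torsion_eq_zero hT hu y w, sub_self]
  exact map_zero _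

/-- Here the projective factor is the derivative of `F` along the spray of `D`, which is zero by
invariance. -/
theorem sprayVec_of_preservedBy [T2Space M] {F : FinslerMetric n M} {D : AffineConnection n M}
    (h : PreservedBy F D) (hD : D.ContMDiffCovariantDerivative ∞) (hT : D.torsion = 0)
    (hu : u ∈ (extChartAt (𝓡 n) x₀).target) (hy : y ≠ 0) :
    sprayVec F x₀ (u, y) = christoffelL D x₀ u y y := by
  have h1 := sprayVec_of_eulerLagrange F hu hy (G := christoffelL D x₀ u y y) fun w => by
    rw [eulerLagrange_of_parallel (contDiffAt_finslerCoord F hu hy) hy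
      fun z hz v => h.fderiv_eq_zero hD hu hz v, christoffel_symm_of_torsion_eq_zero hT hu y w,
      sub_self]
    exact map_zero _
  rw [h1, h.fderiv_eq_zero hD hu hy, zero_div, zero_smul, add_zero]

end RandersSpray

/-! ### Projectively equivalent sprays have the same unparametrized geodesics. -/

section Reparametrization

/-- Solution of `φ' = 1 / σ(φ)`. -/
theorem exists_reparametrization {J : Set ℝ} (hJ : IsOpen J) (hJ' : J.OrdConnected) {σ : ℝ → ℝ}
    (hσ : ContDiffOn ℝ ∞ σ J) (hpos : ∀ t ∈ J, 0 < σ t) :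
    ∃ (J' : Set ℝ) (φ : ℝ → ℝ), IsOpen J' ∧ J'.OrdConnected ∧ ContDiffOn ℝ ∞ φ J' ∧ φ '' J' = J ∧
      ∀ s ∈ J', HasDerivAt φ (σ (φ s))⁻¹ s := by
  rcases J.eq_empty_or_nonempty with rfl | ⟨t₀, ht₀⟩
  · exact ⟨∅, id, isOpen_empty, ordConnected_empty, contDiffOn_empty, image_empty _, by simp⟩
  -- Separation of variables: `φ` is the inverse of a primitive of `σ`, which is strictly increasing
  -- and open on `J`.
  set ψ : ℝ → ℝ := fun t => ∫ s in t₀..t, σ s with hψ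
  have hd : ∀ t ∈ J, HasDerivAt ψ (σ t) t := fun t ht =>
    intervalIntegral.integral_hasDerivAt_right
      ((hσ.continuousOn.mono (hJ'.uIcc_subset ht₀ ht)).intervalIntegrable)
      (hσ.continuousOn.stronglyMeasurableAtFilter hJ t ht)
      (hσ.continuousOn.continuousAt (hJ.mem_nhds ht))
  have hψs : ContDiffOn ℝ ∞ ψ J := by
    rw [contDiffOn_infty_iff_deriv_of_isOpen hJ]
    exact ⟨fun t ht => (hd t ht).differentiableAt.differentiableWithinAt,
      hσ.congr fun t ht => (hd t ht).deriv⟩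
  have hmono : StrictMonoOn ψ J := by
    refine strictMonoOn_of_deriv_pos hJ'.convex hψs.continuousOn fun t ht => ?_
    rw [(hd t (interior_subset ht)).deriv]
    exact hpos t (interior_subset ht)
  have hopen : ∀ V ⊆ J, IsOpen V → IsOpen (ψ '' V) := by
    refine fun V hVJ hV => isOpen_iff_mem_nhds.2 ?_
    rintro _ ⟨t, ht, rfl⟩
    have h1 : HasStrictDerivAt ψ (σ t) t :=
      (hψs.contDiffAt (hJ.mem_nhds (hVJ ht))).hasStrictDerivAt' (hd t (hVJ ht)) (by simp)
    rw [← h1.map_nhds_eq (hpos t (hVJ ht)).ne']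
    exact Filter.image_mem_map (hV.mem_nhds ht)
  set f : OpenPartialHomeomorph ℝ ℝ := OpenPartialHomeomorph.ofContinuousOpenRestrict
    (hmono.injOn.toPartialEquiv ψ J) hψs.continuousOn (fun U hU => by
      have h1 := hopen (Subtype.val '' U) (image_subset_iff.2 fun x _ => x.2) (hJ.isOpenMap_subtype_val U hU)
      rwa [image_image] at h1) hJ with hf
  have hft : f.target = ψ '' J := rfl
  have hd' : ∀ s ∈ ψ '' J, f.symm s ∈ J := fun s hs => f.map_target (hft ▸ hs)
  refine ⟨ψ '' J, f.symm, hopen J le_rfl hJ, ?_, fun s hs => ?_, f.symm_image_target_eq_source,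
    fun s hs => ?_⟩
  · exact (hJ'.isPreconnected.image ψ hψs.continuousOn).ordConnected
  · exact (f.contDiffAt_symm_deriv (hpos _ (hd' s hs)).ne' hs (hd _ (hd' s hs))
      (hψs.contDiffAt (hJ.mem_nhds (hd' s hs)))).contDiffWithinAt
  · exact f.hasDerivAt_symm hs (hpos _ (hd' s hs)).ne' (hd _ (hd' s hs))

variable {n : ℕ} {M : Type*} [TopologicalSpace M] [ChartedSpace (Coord n) M]
  [IsManifold (𝓡 n) ∞ M]

theorem contDiffAt_chart_comp {c : ℝ → M} {t : ℝ} (hc : ContMDiffAt 𝓘(ℝ, ℝ) (𝓡 n) ∞ c t) {x₀ : M}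
    (hx : c t ∈ (chartAt (Coord n) x₀).source) :
    ContDiffAt ℝ ∞ (fun s => extChartAt (𝓡 n) x₀ (c s)) t :=
  contMDiffAt_iff_contDiffAt.1 ((contMDiffAt_extChartAt' hx).comp t hc)

theorem IsSmoothCurve.contDiffAt_coordVec_velocity {J : Set ℝ} {c : ℝ → M}
    (hc : IsSmoothCurve (n := n) J c) {t : ℝ} (ht : t ∈ J) {x₀ : M}
    (hx : c t ∈ (chartAt (Coord n) x₀).source) :
    ContDiffAt ℝ ∞ (fun s => coordVec (n := n) x₀ (c s) (velocity c s)) t := by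
  have h1 : ContDiffAt ℝ ∞ (deriv fun s => extChartAt (𝓡 n) x₀ (c s)) t :=
    ((contDiffAt_chart_comp (hc.smoothAt ht) hx).fderiv_right (m := ∞) (by simp)).clm_apply
      contDiffAt_const
  refine h1.congr_of_eventuallyEq ?_
  filter_upwards [hc.1.mem_nhds ht, eventually_mem_source (hc.smoothAt ht) hx] with s hs hs'
  exact (hasDerivAt_chart_comp (hc.smoothAt hs) hs').deriv.symm

/-- Reparametrization of a regular curve by a positive function `σ` of its parameter. -/
theorem IsRegularCurve.exists_reparametrization {J : Set ℝ} {c : ℝ → M}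
    (hc : IsRegularCurve (n := n) J c) {σ : ℝ → ℝ} (hσ : ContDiffOn ℝ ∞ σ J)
    (hpos : ∀ t ∈ J, 0 < σ t) :
    ∃ (J' : Set ℝ) (c' : ℝ → M), IsReparametrization J c J' c' ∧ IsRegularCurve (n := n) J' c' ∧
      ∀ s ∈ J', ∃ t ∈ J, ∃ a > (0 : ℝ), c' s = c t ∧
        ∀ x₀ : M, c t ∈ (chartAt (Coord n) x₀).source →
          coordVec x₀ (c' s) (velocity (n := n) c' s) =
            a • coordVec x₀ (c t) (velocity (n := n) c t) ∧
          ∀ (A : Coord n) (p : ℝ), HasDerivAt (fun s => coordVec x₀ (c s) (velocity c s)) A t →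
            HasDerivAt σ (p * σ t) t → HasDerivAt (fun s => coordVec x₀ (c' s) (velocity c' s))
              (a ^ 2 • (A - p • coordVec x₀ (c t) (velocity c t))) s := by
  obtain ⟨J', φ, hJ', hJ'', hφ, hφJ, hφd⟩ := Finsler.exists_reparametrization hc.1.1 hc.1.2.1 hσ hpos
  have hmem : ∀ s ∈ J', φ s ∈ J := fun s hs => hφJ ▸ mem_image_of_mem φ hs
  have hφs : ∀ s ∈ J', ContDiffAt ℝ ∞ φ s := fun s hs => hφ.contDiffAt (hJ'.mem_nhds hs)
  have hd : ∀ s ∈ J', deriv φ s = (σ (φ s))⁻¹ := fun s hs => (hφd s hs).deriv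
  have hd0 : ∀ s ∈ J', 0 < deriv φ s := fun s hs => by
    rw [hd s hs]
    exact inv_pos.2 (hpos _ (hmem s hs))
  have hv : ∀ s ∈ J', ∀ x₀ : M, c (φ s) ∈ (chartAt (Coord n) x₀).source →
      coordVec x₀ (c (φ s)) (velocity (n := n) (fun s => c (φ s)) s) =
        deriv φ s • coordVec x₀ (c (φ s)) (velocity (n := n) c (φ s)) := fun s hs x₀ hx =>
    coordVec_velocity_comp (c' := fun s => c (φ s)) (hc.1.smoothAt (hmem s hs)) (hφs s hs)
      (Filter.Eventually.of_forall fun _ => rfl) hx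
  refine ⟨J', fun s => c (φ s), ⟨φ, hφ, hd0, hφJ, fun _ _ => rfl⟩,
    ⟨⟨hJ', hJ'', hc.1.2.2.comp hφ.contMDiffOn hmem⟩, fun s hs h0 => ?_⟩,
    fun s hs => ⟨φ s, hmem s hs, deriv φ s, hd0 s hs, rfl, fun x₀ hx =>
      ⟨hv s hs x₀ hx, fun A p hA hp => ?_⟩⟩⟩
  · have hx := mem_chart_source (Coord n) (c (φ s))
    have h1 := hv s hs _ hx
    rw [h0, coordVec_zero] at h1
    exact smul_ne_zero (hd0 s hs).ne' (coordVec_ne_zero hx (hc.2 _ (hmem s hs))) h1.symm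
  · have hσ0 := (hpos _ (hmem s hs)).ne'
    -- With `φ' = 1 / σ(φ)`, the equation `σ' = p σ` becomes `φ'' = -p φ'²`.
    have hb : HasDerivAt (deriv φ) (-(p * deriv φ s ^ 2)) s := by
      have h1 := (hp.comp s (hφd s hs)).inv hσ0
      refine (h1.congr_deriv ?_).congr_of_eventuallyEq ?_
      · rw [hd s hs]
        change -(p * σ (φ s) * (σ (φ s))⁻¹) / σ (φ s) ^ 2 = _
        field_simp
      · filter_upwards [hJ'.mem_nhds hs] with r hr using hd r hr
    have h2 := hasDerivAt_velocity_comp (c' := fun s => c (φ s)) (x₀ := x₀) (t := s)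
      (by filter_upwards [hc.1.1.mem_nhds (hmem s hs)] with r hr using hc.1.smoothAt hr)
      (by filter_upwards [hJ'.mem_nhds hs] with r hr using hφs r hr)
      (Filter.Eventually.of_forall fun _ => rfl) hx hA hb
    refine h2.congr_deriv ?_
    rw [smul_sub, smul_smul, neg_smul, sub_eq_add_neg, mul_comm p]

theorem isFinslerGeodesic_iff {F : FinslerMetric n M} {J : Set ℝ} {c : ℝ → M} :
    IsFinslerGeodesic F J c ↔ IsRegularCurve (n := n) J c ∧
      ∀ t ∈ J, ∀ x₀ : M, c t ∈ (chartAt (Coord n) x₀).source →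
        HasDerivAt (fun s => coordVec (n := n) x₀ (c s) (velocity c s))
          (-sprayVec F x₀ (extChartAt (𝓡 n) x₀ (c t), coordVec x₀ (c t) (velocity c t))) t :=
  and_congr_right fun _ => forall₄_congr fun _ _ _ _ =>
    ⟨fun h => hasDerivAt_of_components h, fun h i => hasDerivAt_component h i⟩

/-- A metric whose spray is projectively equivalent to the spray of the connection `D` is Douglas,
provided that the equations for the reparametrizations can be solved. -/
theorem isDouglas_of_sprayVec {F : FinslerMetric n M} {D : AffineConnection n M}
    (hD : D.ContMDiffCovariantDerivative ∞) {P : M → Coord n → Coord n → ℝ}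
    (hP : ∀ (x₀ : M), ∀ u ∈ (extChartAt (𝓡 n) x₀).target, ∀ y : Coord n, y ≠ 0 →
      sprayVec F x₀ (u, y) = christoffelL D x₀ u y y + P x₀ u y • y)
    (hhom : ∀ (x₀ : M), ∀ u ∈ (extChartAt (𝓡 n) x₀).target, ∀ y : Coord n, y ≠ 0 →
      ∀ r > 0, P x₀ u (r • y) = r * P x₀ u y)
    (h₁ : ∀ J c, IsFinslerGeodesic F J c → ∃ σ : ℝ → ℝ, ContDiffOn ℝ ∞ σ J ∧ ∀ t ∈ J, 0 < σ t ∧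
      ∀ x₀ : M, c t ∈ (chartAt (Coord n) x₀).source → HasDerivAt σ
        (-P x₀ (extChartAt (𝓡 n) x₀ (c t)) (coordVec x₀ (c t) (velocity c t)) * σ t) t)
    (h₂ : ∀ J c, IsConnectionGeodesic D J c → ∃ σ : ℝ → ℝ, ContDiffOn ℝ ∞ σ J ∧ ∀ t ∈ J, 0 < σ t ∧
      ∀ x₀ : M, c t ∈ (chartAt (Coord n) x₀).source → HasDerivAt σ
        (P x₀ (extChartAt (𝓡 n) x₀ (c t)) (coordVec x₀ (c t) (velocity c t)) * σ t) t) :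
    IsDouglas F := by
  refine ⟨D, hD, fun J c hc => ?_, fun J c hc => ?_⟩
  -- The acceleration is `-Γ(ċ, ċ) - P ċ`; with `p = -P` the reparametrization removes the
  -- tangential term.
  · obtain ⟨σ, hσ, hσ'⟩ := h₁ J c hc
    rw [isFinslerGeodesic_iff] at hc
    obtain ⟨J', c', hr, hreg, h⟩ :=
      IsRegularCurve.exists_reparametrization hc.1 hσ fun t ht => (hσ' t ht).1
    refine ⟨J', c', hr, hreg, fun s hs x₀ hx => ?_⟩
    obtain ⟨t, ht, a, ha, hct, h'⟩ := h s hs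
    rw [hct] at hx
    obtain ⟨hv, hacc⟩ := h' x₀ hx
    have hu := extChartAt_mem_target hx
    have hy := coordVec_ne_zero hx (hc.1.2 t ht)
    rw [hv]
    refine (hacc _ _ (hc.2 t ht x₀ hx) ((hσ' t ht).2 x₀ hx)).congr_deriv ?_
    rw [hP x₀ _ hu _ hy, hct, christoffel_eq_christoffelL D hx]
    simp only [map_smul, smul_apply, smul_smul, ← sq]
    module
  -- Here `p = P` creates the tangential term; homogeneity of `P` makes it the right one for the
  -- rescaled velocity.
  · obtain ⟨σ, hσ, hσ'⟩ := h₂ J c hc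
    obtain ⟨J', c', hr, hreg, h⟩ :=
      IsRegularCurve.exists_reparametrization hc.1 hσ fun t ht => (hσ' t ht).1
    refine ⟨J', c', hr, isFinslerGeodesic_iff.2 ⟨hreg, fun s hs x₀ hx => ?_⟩⟩
    obtain ⟨t, ht, a, ha, hct, h'⟩ := h s hs
    rw [hct] at hx
    obtain ⟨hv, hacc⟩ := h' x₀ hx
    have hu := extChartAt_mem_target hx
    have hy := coordVec_ne_zero hx (hc.1.2 t ht)
    rw [hv]
    refine (hacc _ _ (hc.2 t ht x₀ hx) ((hσ' t ht).2 x₀ hx)).congr_deriv ?_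
    rw [hct, hP x₀ _ hu _ (smul_ne_zero ha.ne' hy), hhom x₀ _ hu _ hy a ha,
      christoffel_eq_christoffelL D hx]
    simp only [map_smul, smul_apply, smul_smul, ← sq]
    module

theorem isDouglas_of_isBerwald [T2Space M] {F : FinslerMetric n M} (hF : IsBerwald F) :
    IsDouglas F := by
  obtain ⟨D, hD, hT, h⟩ := hF
  have h0 : ∀ t : ℝ, HasDerivAt (fun _ : ℝ => (1 : ℝ)) 0 t := fun t => hasDerivAt_const t 1
  refine isDouglas_of_sprayVec hD (P := fun _ _ _ => 0) (fun x₀ u hu y hy => ?_) (by simp)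
    (fun J c _ => ⟨fun _ => 1, contDiffOn_const, fun t _ => ⟨one_pos, fun _ _ => by simpa using h0 t⟩⟩)
    (fun J c _ => ⟨fun _ => 1, contDiffOn_const, fun t _ => ⟨one_pos, fun _ _ => by simpa using h0 t⟩⟩)
  rw [sprayVec_of_preservedBy h hD hT hu hy, zero_smul, add_zero]

/-- Derivative of a Lagrangian along a curve. -/
theorem IsSmoothCurve.hasDerivAt_lagrangian {J : Set ℝ} {c : ℝ → M} (hc : IsSmoothCurve (n := n) J c)
    {t : ℝ} (ht : t ∈ J) {x₀ : M} (hx : c t ∈ (chartAt (Coord n) x₀).source)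
    {L : Coord n × Coord n → ℝ}
    (hL : ContDiffAt ℝ ∞ L (extChartAt (𝓡 n) x₀ (c t), coordVec x₀ (c t) (velocity c t)))
    {ℓ : ℝ → ℝ} (hℓ : ∀ s, c s ∈ (chartAt (Coord n) x₀).source →
      ℓ s = L (extChartAt (𝓡 n) x₀ (c s), coordVec x₀ (c s) (velocity c s))) :
    ContDiffAt ℝ ∞ ℓ t ∧ ∀ A, HasDerivAt (fun s => coordVec x₀ (c s) (velocity c s)) A t →
      HasDerivAt ℓ (fderiv ℝ L (extChartAt (𝓡 n) x₀ (c t), coordVec x₀ (c t) (velocity c t))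
        (coordVec x₀ (c t) (velocity c t), A)) t := by
  have he : ℓ =ᶠ[𝓝 t] fun s =>
      L (extChartAt (𝓡 n) x₀ (c s), coordVec x₀ (c s) (velocity c s)) := by
    filter_upwards [eventually_mem_source (hc.smoothAt ht) hx] with s hs using hℓ s hs
  refine ⟨?_, fun A hA => ?_⟩
  · refine ContDiffAt.congr_of_eventuallyEq ?_ he
    exact ContDiffAt.comp (g := L)
      (f := fun s => (extChartAt (𝓡 n) x₀ (c s), coordVec x₀ (c s) (velocity c s))) t hL
      ((contDiffAt_chart_comp (hc.smoothAt ht) hx).prodMk (hc.contDiffAt_coordVec_velocity ht hx))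
  · refine HasDerivAt.congr_of_eventuallyEq ?_ he
    exact HasFDerivAt.comp_hasDerivAt (l := L)
      (f := fun s => (extChartAt (𝓡 n) x₀ (c s), coordVec x₀ (c s) (velocity c s))) t
      (hL.differentiableAt (by simp)).hasFDerivAt
      ((hasDerivAt_chart_comp (hc.smoothAt ht) hx).prodMk hA)

/-- The reparametrizing functions are speeds. A geodesic of one metric becomes a geodesic of the
other when its speed in the other metric is made constant. -/
theorem isDouglas_of_isRanders [T2Space M] {F : FinslerMetric n M} {α : RiemannianMetric n M}
    {β : OneForm n M} (hR : IsRanders F α β) (hβ : β.IsClosed) : IsDouglas F := by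
  obtain ⟨D, hD, hT, hM⟩ := exists_leviCivita α
  have hspray : ∀ {x₀ : M} {u y : Coord n}, u ∈ (extChartAt (𝓡 n) x₀).target → y ≠ 0 → _ :=
    fun {x₀ u y} hu hy => sprayVec_of_isRanders (x₀ := x₀) (u := u) (y := y) hR hβ hT hM hu hy
  refine isDouglas_of_sprayVec hD (P := fun x₀ u y =>
    fderiv ℝ (finslerCoord F x₀) (u, y) (y, -christoffelL D x₀ u y y) / finslerCoord F x₀ (u, y))
    (fun x₀ u hu y hy => hspray hu hy) (fun x₀ u hu y hy r hr => ?_) (fun J c hc => ?_)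
    (fun J c hc => ?_)
  · have hL := (contDiffAt_finslerCoord F hu hy).differentiableAt (by simp)
    have hL' := (contDiffAt_finslerCoord F hu (smul_ne_zero hr.ne' hy)).differentiableAt (by simp)
    have e : ((r • y, -christoffelL D x₀ u (r • y) (r • y)) : Coord n × Coord n) =
        (r • y, r • r • -christoffelL D x₀ u y y) := by
      simp [smul_smul]
    have e' : ((r • y, r • -christoffelL D x₀ u y y) : Coord n × Coord n) =
        r • (y, -christoffelL D x₀ u y y) := rfl
    have hpos := finslerCoord_pos F hu hy
    rw [e, fderiv_prodMap_of_homogeneous (fun u z r hr => finslerCoord_smul F x₀ u z hr) hr hL hL',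
      e', map_smul, finslerCoord_smul F x₀ u y hr, smul_eq_mul]
    field_simp
  · rw [isFinslerGeodesic_iff] at hc
    obtain ⟨hreg, hgeo⟩ := hc
    have key : ∀ t ∈ J, ∀ x₀ : M, ∀ hx : c t ∈ (chartAt (Coord n) x₀).source, _ :=
      fun t ht x₀ hx => hreg.1.hasDerivAt_lagrangian ht hx
        (contDiffAt_metricNorm (α := α) (extChartAt_mem_target hx)
          (coordVec_ne_zero hx (hreg.2 t ht)))
        (ℓ := fun s => √(α.inner (c s) (velocity (n := n) c s) (velocity (n := n) c s)))
        fun s hs => by rw [metricCoord_extChartAt α hs]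
    -- Along the `α`-spray the `α`-length has zero derivative, so the radial term `-P y` of the
    -- Finsler acceleration gives it the logarithmic derivative `-P`.
    refine ⟨fun s => √(α.inner (c s) (velocity (n := n) c s) (velocity (n := n) c s)), fun t ht =>
      (key t ht (c t) (mem_chart_source _ _)).1.contDiffWithinAt, fun t ht =>
      ⟨Real.sqrt_pos.2 (α.pos _ _ (hreg.2 t ht)), fun x₀ hx => ?_⟩⟩
    have hu := extChartAt_mem_target hx
    have hy := coordVec_ne_zero hx (hreg.2 t ht)
    refine ((key t ht x₀ hx).2 _ (hgeo t ht x₀ hx)).congr_deriv ?_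
    rw [hspray hu hy]
    set y := coordVec x₀ (c t) (velocity (n := n) c t) with hy'
    set u := extChartAt (𝓡 n) x₀ (c t) with hu'
    set p := fderiv ℝ (finslerCoord F x₀) (u, y) (y, -christoffelL D x₀ u y y) /
      finslerCoord F x₀ (u, y)
    have e : ((y, -(christoffelL D x₀ u y y + p • y)) : Coord n × Coord n) =
        (y, -christoffelL D x₀ u y y) - p • (0, y) := by simp [sub_eq_add_neg, add_comm]
    rw [e, map_sub, map_smul, fderiv_metricNorm hu hy (hM x₀ u hu) y,
      fderiv_radial (contDiffAt_metricNorm hu hy) fun z r hr => ?_]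
    · rw [hu', hy', metricCoord_extChartAt α hx, smul_eq_mul]
      ring
    · simp only [map_smul, smul_apply, smul_eq_mul]
      rw [← mul_assoc, ← sq, Real.sqrt_mul (sq_nonneg r), Real.sqrt_sq hr.le]
  · obtain ⟨hreg, hgeo⟩ := hc
    have key : ∀ t ∈ J, ∀ x₀ : M, ∀ hx : c t ∈ (chartAt (Coord n) x₀).source, _ :=
      fun t ht x₀ hx => hreg.1.hasDerivAt_lagrangian ht hx
        (contDiffAt_finslerCoord F (extChartAt_mem_target hx)
          (coordVec_ne_zero hx (hreg.2 t ht)))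
        (ℓ := fun s => F.toFun (c s) (velocity (n := n) c s))
        fun s hs => (finslerCoord_extChartAt F hs _).symm
    -- The factor `P` is by definition the logarithmic derivative of `F` along the `α`-spray.
    refine ⟨fun s => F.toFun (c s) (velocity (n := n) c s), fun t ht =>
      (key t ht (c t) (mem_chart_source _ _)).1.contDiffWithinAt, fun t ht =>
      ⟨F.pos _ _ (hreg.2 t ht), fun x₀ hx => ?_⟩⟩
    refine ((key t ht x₀ hx).2 _ (hgeo t ht x₀ hx)).congr_deriv ?_
    have hpos := F.pos _ _ (hreg.2 t ht)
    rw [finslerCoord_extChartAt F hx, christoffel_eq_christoffelL D hx]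
    field_simp

end Reparametrization

end Finsler

end

theorem mainTheorem1 {M : Type*} [TopologicalSpace M] [T2Space M] [SecondCountableTopology M]
    [ConnectedSpace M] [ChartedSpace (Finsler.Coord 2) M] [IsManifold (𝓡 2) ∞ M]
    (F : Finsler.FinslerMetric 2 M) :
    (Finsler.IsDouglas F ∧ Finsler.IsGeneralizedBerwald F) ↔
      (Finsler.IsBerwald F ∨
        ∃ (α : Finsler.RiemannianMetric 2 M) (β : Finsler.OneForm 2 M),
          Finsler.IsRanders F α β ∧ β.IsClosed ∧ Finsler.HasConstantLength α β) := by
  constructor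
  · rintro ⟨h, h'⟩
    exact Finsler.berwald_or_randers h h'
  · rintro (h | ⟨α, β, hR, hβ, hk⟩)
    · exact ⟨Finsler.isDouglas_of_isBerwald h, h.imp fun _ hD => ⟨hD.1, hD.2.2⟩⟩
    · exact ⟨Finsler.isDouglas_of_isRanders hR hβ, Finsler.isGeneralizedBerwald_of_randers hR hk⟩
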